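/- Let $(R,\mathfrak m)$ be a finite commutative local ring with identity, with residue field $R/\mathfrak m\simeq\mathbb F_q$, where $q=p^r$ with $p$ prime, and $|\mathfrak m|=q^{\beta}$. For $k\in\mathbb N$ let $G_R(k)=\mathrm{Cay}(R,U_R(k))$ be the Cayley graph with vertex set $R$ in which $v,w$ are adjacent if and only if $w-v\in U_R(k)=\{x^k : x\in R^*\}$ (in each case below $U_R(k)=-U_R(k)$, so the graph is undirected), and let $\mathcal K_4(G)$ be the number of $4$-cliques (complete subgraphs on $4$ vertices) of a graph $G$. For multiplicative characters $\chi,\psi$ of $\mathbb F_q$ with values in $\mathbb C$, extended by $\chi(0)=\psi(0)=0$ (also for the trivial character $\varepsilon$), put $J(\chi,\psi)=\sum_{a\in\mathbb F_q}\chi(a)\psi(1-a)$ and $\binom{\psi}{\chi}=\frac{\psi(-1)}{q}J(\chi,\overline{\psi})$, and for multiplicative characters $A,B,C,D,E$ of $\mathbb F_q$ put $${}_3F_2\left(\begin{matrix}A,&B,&C\\&D,&E\end{matrix};1\right)_q=\frac{q}{q-1}\sum_{\chi}\binom{A\chi}{\chi}\binom{B\chi}{D\chi}\binom{C\chi}{E\chi}\chi(1),$$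 where $\chi$ runs over all multiplicative characters of $\mathbb F_q$. (a) ($k=2$) Let $q\equiv1\pmod 4$. Write $q=x^2+4y^2$ with $x,y\in\mathbb Z$ such that $p\nmid x$ when $p\equiv1\pmod4$. Then $$\mathcal K_4(G_R(2))=\frac{q^{4\beta+1}(q-1)\big((q-9)^2-16y^2\big)}{2^9\cdot3}.$$ (b) ($k=3$) Let $3\mid q-1$ if $q$ is even, and $6\mid q-1$ if $q$ is odd. When $p\equiv1\pmod3$, write $4q=c^2+27d^2$ with $c,d\in\mathbb Z$ such that $c\equiv1\pmod3$ and $p\nmid c$. When $p\equiv2\pmod3$ (so that $r$ is even), let $c=-2(-p)^{r/2}$. If $\chi_3$ is a multiplicative character of $\mathbb F_q$ of order $3$, then $$\mathcal K_4(G_R(3))=\frac{q^{4\beta+1}(q-1)}{2^3\cdot3^7}\left[q^2+5q(c-11)+10c^2-85c+316+12q^2\,{}_3F_2\left(\begin{matrix}\chi_3,&\chi_3,&\overline{\chi_3}\\&\varepsilon,&\varepsilon\end{matrix};1\right)_q\right].$$ (c) ($k=4$) Let $q\equiv1\pmod8$. Write $q=e^2+4f^2$ with $e,f\in\mathbb Z$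 such that $e\equiv1\pmod4$, and $p\nmid e$ when $p\equiv1\pmod4$. Write $q=u^2+2v^2$ with $u,v\in\mathbb Z$ such that $u\equiv3\pmod4$, and $p\nmid u$ when $p\equiv1,3\pmod8$. If $\varphi$ and $\chi_4$ are multiplicative characters of $\mathbb F_q$ of order $2$ and $4$ respectively, then $$\mathcal K_4(G_R(4))=\frac{q^{4\beta+1}(q-1)}{2^{15}\cdot3}\left[q^2-2q(15e+101)+304e^2+(930-40u)e+801+120u^2+12q^2\,{}_3F_2\left(\begin{matrix}\chi_4,&\chi_4,&\overline{\chi_4}\\&\varepsilon,&\varepsilon\end{matrix};1\right)_q+30q^2\,{}_3F_2\left(\begin{matrix}\chi_4,&\varphi,&\varphi\\&\varepsilon,&\varepsilon\end{matrix};1\right)_q\right].$$ -/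

import Mathlib

/-- The set `U_R(k) = {x ^ k : x ∈ Rˣ}` of `k`-th powers of units. -/
def unitPowers (R : Type*) [CommRing R] (k : ℕ) : Set R :=
  {y | ∃ x : Rˣ, y = (x : R) ^ k}

/-- The graph `G_R(k) = Cay(R, U_R(k))`, as an undirected graph. When `U_R(k)` is symmetric and
does not contain `0`, two vertices `v`, `w` are adjacent if and only if `w - v ∈ U_R(k)`. -/
def unitaryCayleyGraph (R : Type*) [CommRing R] (k : ℕ) : SimpleGraph R :=
  SimpleGraph.addCayley (unitPowers R k)

/-- The number `𝒦_ℓ(G)` of cliques with `ℓ` vertices in `G`. -/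
noncomputable def numCliques {V : Type*} (G : SimpleGraph V) (l : ℕ) : ℕ :=
  (G.cliqueSet l).ncard

/-- The symbol `binom(ψ, χ) = (ψ(-1) / q) J(χ, ψ̄)` for multiplicative characters of a finite
field with `q` elements; here `ψ̄ = ψ⁻¹`, and `J` is the Jacobi sum. -/
noncomputable def charBinom {F : Type*} [Field F] [Fintype F] (ψ χ : MulChar F ℂ) : ℂ :=
  ψ (-1) / (Fintype.card F : ℂ) * jacobiSum χ ψ⁻¹

/-- The finite field hypergeometric function `₃F₂(A, B, C; D, E; x)_q`; the sum runs over all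
(finitely many) multiplicative characters of the field. -/
noncomputable def hypF32 {F : Type*} [Field F] [Fintype F] (A B C D E : MulChar F ℂ) (x : F) : ℂ :=
  (Fintype.card F : ℂ) / ((Fintype.card F : ℂ) - 1) *
    ∑ᶠ χ : MulChar F ℂ,
      charBinom (A * χ) χ * charBinom (B * χ) (D * χ) * charBinom (C * χ) (E * χ) * χ x

/-! Since `k` divides `q - 1`, it is prime to `|𝔪|`. So `k`-th powers of units are detected in the
residue field `F`, and ordered 4-cliques of `R` number `|𝔪|^4` times those of `F`. Over `F` the
affine maps `x ↦ v + s x` with `s` a nonzero `k`-th power move the first two vertices to `0, 1`.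
What remains is the number of pairs `(a, b)` for which `a, b, 1 - a, 1 - b, a - b` are all `k`-th
powers.

Expanding the five indicator functions in powers of a character `χ` of order `k` gives `k^5` double
character sums (`pow_mul_ncard_cliquePairs`). The symmetric group on the five points `0, 1, ∞, a, b`
of the projective line permutes these sums without changing their values (`weightSum_weightAct`).
Every orbit contains either a sum with trivial character on `a - b`, which is an expression in
Jacobi sums (`pairSum_one_right`), or one of a few representatives: one for `k = 2`, one for `k =
3`, six for `k = 4`. The numbers of weights of each type come from a kernel computation.

The sums with exponents `(1, k-1, 1, 1, k-1)` for `k = 3, 4`, and `(2, 2, 1, 2, 2)` for `k = 4`, are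
`q²` times the `₃F₂` values of the statement (`card_sq_mul_hypF32`). The other representatives
reduce to Jacobi sums, by an analogue of Whipple's summation (`pairSum_wellPoised`) or by Anderson's
evaluation of a Selberg type sum (`selbergSum_eval`).

It remains to identify the Jacobi sums. For characters of order 4, 8 and 3 they lie in `ℤ[i]`,
`ℤ[√-2]` and `ℤ[ω]` and have norm `q`. Their traces are fixed by three facts: a congruence modulo 4
or 3; non-divisibility by `p` when `p` splits, because the sum reduces to a binomial coefficient
prime to `p` by Lucas' theorem; and uniqueness of the representation of `q` by the norm form. When
`p` is inert, descent on the exponent takes the place of the last two. -/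

/-! ### Ordered cliques. -/

/-- The set of ordered `l`-cliques of a graph, as maps from `Fin l`. -/
def orderedCliques {V : Type*} (G : SimpleGraph V) (l : ℕ) : Set (Fin l → V) :=
  {f | ∀ i j, i ≠ j → G.Adj (f i) (f j)}

theorem orderedCliques_injective {V : Type*} {G : SimpleGraph V} {l : ℕ} {f : Fin l → V}
    (hf : f ∈ orderedCliques G l) : Function.Injective f := by
  intro i j hij
  by_contra h
  exact (hf i j h).ne hij

open Classical in
/-- Every clique of size `l` is the range of exactly `l!` ordered cliques. -/
theorem ncard_orderedCliques {V : Type*} [Finite V] (G : SimpleGraph V) (l : ℕ) :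
    (orderedCliques G l).ncard = l.factorial * numCliques G l := by
  have := Fintype.ofFinite V
  rw [numCliques, Set.ncard_eq_toFinset_card', Set.ncard_eq_toFinset_card']
  rw [Finset.card_eq_sum_card_fiberwise (f := fun f : Fin l → V => Finset.image f Finset.univ)
    (t := (G.cliqueSet l).toFinset)]
  · rw [Finset.sum_const_nat (m := l.factorial), mul_comm]
    intro s hs
    rw [Set.mem_toFinset, SimpleGraph.mem_cliqueSet_iff, SimpleGraph.isNClique_iff] at hs
    obtain ⟨hs, hc⟩ := hs
    have e : Fin l ≃ s := (Fintype.equivFinOfCardEq (by simp [hc])).symm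
    have hcard : l.factorial = (Finset.univ : Finset (Equiv.Perm (Fin l))).card := by
      rw [Finset.card_univ, Fintype.card_perm, Fintype.card_fin]
    rw [hcard]
    symm
    refine Finset.card_bij (fun σ _ i => (e (σ i) : V)) ?_ ?_ ?_
    · intro σ _
      simp only [Finset.mem_filter, Set.mem_toFinset]
      constructor
      · intro i j hij
        refine hs (e (σ i)).2 (e (σ j)).2 ?_
        intro h
        exact hij (σ.injective (e.injective (Subtype.ext h)))
      · ext v
        simp only [Finset.mem_image, Finset.mem_univ, true_and]
        constructor
        · rintro ⟨i, rfl⟩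
          exact (e (σ i)).2
        · intro hv
          exact ⟨σ.symm (e.symm ⟨v, hv⟩), by simp⟩
    · intro σ _ τ _ h
      ext1 i
      exact e.injective (Subtype.ext (congrFun h i))
    · intro f hf
      simp only [Finset.mem_filter, Set.mem_toFinset] at hf
      obtain ⟨hf, him⟩ := hf
      have hmem : ∀ i, f i ∈ s := fun i => him ▸ Finset.mem_image_of_mem _ (Finset.mem_univ i)
      have hinj : Function.Injective (fun i => e.symm ⟨f i, hmem i⟩) := by
        intro i j hij
        exact orderedCliques_injective hf (congrArg Subtype.val (e.symm.injective hij))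
      refine ⟨Equiv.ofBijective _ (Finite.injective_iff_bijective.mp hinj), Finset.mem_univ _, ?_⟩
      funext i
      simp
  · intro f hf
    simp only [Set.coe_toFinset] at hf ⊢
    rw [SimpleGraph.mem_cliqueSet_iff, SimpleGraph.isNClique_iff]
    constructor
    · intro v hv w hw hvw
      simp only [Finset.coe_image, Finset.coe_univ, Set.image_univ, Set.mem_range] at hv hw
      obtain ⟨i, rfl⟩ := hv
      obtain ⟨j, rfl⟩ := hw
      exact hf i j (fun h => hvw (h ▸ rfl))
    · rw [Finset.card_image_of_injective _ (orderedCliques_injective hf), Finset.card_univ,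
        Fintype.card_fin]

/-! ### Reduction to the residue field and to pairs completing the edge from 0 to 1. -/

/-- The preimage of a finite set under a surjective homomorphism of finite groups. -/
theorem ncard_preimage_of_surjective {A B : Type*} [AddCommGroup A] [AddCommGroup B] [Finite A]
    (f : A →+ B) (hf : Function.Surjective f) (T : Set B) :
    (f ⁻¹' T).ncard = Nat.card f.ker * T.ncard := by
  have hB : Finite B := Finite.of_surjective f hf
  choose g hg using hf
  let e : f.ker × T ≃ f ⁻¹' T :=
    { toFun := fun x => ⟨x.1 + g x.2, by
        simp only [Set.mem_preimage, map_add, hg, (AddMonoidHom.mem_ker).mp x.1.2, zero_add]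
        exact x.2.2⟩
      invFun := fun x => (⟨x.1 - g (f x.1), by simp [AddMonoidHom.mem_ker, hg]⟩, ⟨f x.1, x.2⟩)
      left_inv := by
        rintro ⟨⟨x, hx⟩, ⟨y, hy⟩⟩
        have : f x = 0 := hx
        simp [hg, this]
      right_inv := by
        rintro ⟨x, hx⟩
        simp }
  rw [← Nat.card_coe_set_eq, ← Nat.card_congr e, Nat.card_prod, Nat.card_coe_set_eq]

theorem zero_notMem_unitPowers (R : Type*) [CommRing R] [Nontrivial R] (k : ℕ) :
    (0 : R) ∉ unitPowers R k := by
  rintro ⟨x, hx⟩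
  exact (x ^ k).ne_zero (by simpa using hx.symm)

theorem unitaryCayleyGraph_adj {R : Type*} [CommRing R] [Nontrivial R] {k : ℕ} {v w : R} :
    (unitaryCayleyGraph R k).Adj v w ↔ w - v ∈ unitPowers R k ∨ v - w ∈ unitPowers R k := by
  rw [unitaryCayleyGraph, SimpleGraph.addCayley_adj']
  constructor
  · rintro ⟨-, g, hg, h | h⟩
    · left; rwa [← h, add_sub_cancel_left]
    · right; rwa [h, add_sub_cancel_left]
  · intro h
    refine ⟨?_, ?_⟩
    · rintro rfl
      simp [zero_notMem_unitPowers] at h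
    · rcases h with h | h
      · exact ⟨_, h, Or.inl (by ring)⟩
      · exact ⟨_, h, Or.inr (by ring)⟩

open IsLocalRing in
-- The kernel is `1 + 𝔪`, and `u ↦ u - 1` is a bijection onto `𝔪`.
theorem card_ker_units_map_residue (R : Type*) [CommRing R] [IsLocalRing R] :
    Nat.card (Units.map (residue R : R →* ResidueField R)).ker = Nat.card (maximalIdeal R) := by
  have hu : ∀ x : maximalIdeal R, IsUnit (1 + x.1) := fun x => by
    rw [← residue_ne_zero_iff_isUnit, map_add, (residue_eq_zero_iff _).mpr x.2]
    simp
  exact Nat.card_congr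
    { toFun := fun u => ⟨(u.1 : R) - 1, by
        have := congrArg Units.val (MonoidHom.mem_ker.mp u.2)
        rw [← residue_eq_zero_iff, map_sub, map_one, sub_eq_zero]
        simpa using this⟩
      invFun := fun x => ⟨(hu x).unit, by
        rw [MonoidHom.mem_ker]
        ext
        simp [(residue_eq_zero_iff _).mpr x.2]⟩
      left_inv := fun u => by ext; simp
      right_inv := fun x => by ext; simp }

open IsLocalRing in
/-- If `k` is prime to the residue characteristic, being a `k`-th power of a unit can be tested
in the residue field. -/
theorem mem_unitPowers_iff_residue {R : Type*} [CommRing R] [IsLocalRing R] {k : ℕ}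
    (hk : (Nat.card (maximalIdeal R)).Coprime k) (x : R) :
    x ∈ unitPowers R k ↔ residue R x ∈ unitPowers (ResidueField R) k := by
  constructor
  · rintro ⟨u, rfl⟩
    exact ⟨Units.map (residue R : R →* ResidueField R) u, by simp⟩
  · rintro ⟨y, hy⟩
    obtain ⟨z, hz⟩ := residue_surjective (R := R) (y : ResidueField R)
    have hzu : IsUnit z := by
      rw [← residue_ne_zero_iff_isUnit, hz]; exact y.ne_zero
    have hxu : IsUnit x := by
      rw [← residue_ne_zero_iff_isUnit, hy]; exact (y ^ k).ne_zero
    obtain ⟨z, rfl⟩ := hzu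
    obtain ⟨x, rfl⟩ := hxu
    rw [← card_ker_units_map_residue R] at hk
    have hmem : x * (z ^ k)⁻¹ ∈ (Units.map (residue R : R →* ResidueField R)).ker := by
      rw [MonoidHom.mem_ker, map_mul, map_inv, mul_inv_eq_one]
      ext
      simp only [Units.coe_map, MonoidHom.coe_coe, map_pow, Units.val_pow_eq_pow_val]
      rw [hy, hz]
    -- The error `x z⁻ᵏ` lies in a finite group of order prime to `k`, where every element is a
    -- `k`-th power.
    obtain ⟨w, hw⟩ := (powCoprime hk).surjective ⟨_, hmem⟩
    refine ⟨w.1 * z, ?_⟩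
    have := congrArg Subtype.val hw
    simp only [powCoprime_apply, SubgroupClass.coe_pow] at this
    rw [← Units.val_pow_eq_pow_val, mul_pow, this, inv_mul_cancel_right]

open IsLocalRing in
-- Adjacency depends only on residues, so the ordered cliques of `R` form a full preimage under the
-- map of `l`-tuples, whose kernel is `𝔪^l`.
theorem ncard_orderedCliques_residue {R : Type*} [CommRing R] [Finite R] [IsLocalRing R] {k : ℕ}
    (hk : (Nat.card (maximalIdeal R)).Coprime k) (l : ℕ) :
    (orderedCliques (unitaryCayleyGraph R k) l).ncard =
      Nat.card (maximalIdeal R) ^ l *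
        (orderedCliques (unitaryCayleyGraph (ResidueField R) k) l).ncard := by
  let f : (Fin l → R) →+ (Fin l → ResidueField R) :=
    (residue R : R →+ ResidueField R).compLeft (Fin l)
  have hf : Function.Surjective f := by
    intro y
    choose g hg using fun i => residue_surjective (R := R) (y i)
    exact ⟨g, funext hg⟩
  have hpre : orderedCliques (unitaryCayleyGraph R k) l =
      f ⁻¹' orderedCliques (unitaryCayleyGraph (ResidueField R) k) l := by
    ext g
    simp only [orderedCliques, Set.mem_ofPred_eq, Set.mem_preimage, unitaryCayleyGraph_adj,
      mem_unitPowers_iff_residue hk, map_sub]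
    rfl
  have hker : Nat.card f.ker = Nat.card (maximalIdeal R) ^ l := by
    have e : f.ker ≃ (Fin l → maximalIdeal R) :=
      { toFun := fun g i => ⟨g.1 i, (residue_eq_zero_iff _).mp (congrFun g.2 i)⟩
        invFun := fun g => ⟨fun i => g i, funext fun i => (residue_eq_zero_iff _).mpr (g i).2⟩
        left_inv := fun g => rfl
        right_inv := fun g => rfl }
    rw [Nat.card_congr e, Nat.card_fun, Nat.card_eq_fintype_card (α := Fin l), Fintype.card_fin]
  rw [hpre, ncard_preimage_of_surjective f hf, hker]

/-- The set of pairs `(a, b)` such that `0, 1, a, b` are pairwise joined by elements of `U`. -/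
def cliquePairs {F : Type*} [CommRing F] (U : Set F) : Set (F × F) :=
  {x | x.1 ∈ U ∧ x.2 ∈ U ∧ 1 - x.1 ∈ U ∧ 1 - x.2 ∈ U ∧ x.1 - x.2 ∈ U}

/-- The set `U` of `k`-th powers is a group containing `-1`, so `x ↦ v + s x` with `s ∈ U` preserves
the graph. An ordered clique is determined by its first vertex `v`, the difference `s` to the
second, and the normalised remaining pair. -/
theorem ncard_orderedCliques_field {F : Type*} [Field F] [Finite F] {k : ℕ}
    (hk : (-1 : F) ∈ unitPowers F k) :
    (orderedCliques (unitaryCayleyGraph F k) 4).ncard =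
      Nat.card F * (unitPowers F k).ncard * (cliquePairs (unitPowers F k)).ncard := by
  have hmul : ∀ {x y : F}, x ∈ unitPowers F k → y ∈ unitPowers F k → x * y ∈ unitPowers F k := by
    rintro _ _ ⟨x, rfl⟩ ⟨y, rfl⟩
    exact ⟨x * y, by simp [mul_pow]⟩
  have hinv : ∀ {x : F}, x ∈ unitPowers F k → x⁻¹ ∈ unitPowers F k := by
    rintro _ ⟨x, rfl⟩
    exact ⟨x⁻¹, by simp⟩
  have hneg : ∀ {x y : F}, x - y ∈ unitPowers F k → y - x ∈ unitPowers F k := by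
    intro x y h
    simpa using hmul hk h
  have hne : ∀ {x : F}, x ∈ unitPowers F k → x ≠ 0 := by
    rintro x h rfl
    exact zero_notMem_unitPowers F k h
  have hadj : ∀ {v w : F}, (unitaryCayleyGraph F k).Adj v w ↔ w - v ∈ unitPowers F k := by
    intro v w
    rw [unitaryCayleyGraph_adj, or_iff_left_of_imp hneg]
  have hcl : ∀ f : Fin 4 → F, f ∈ orderedCliques (unitaryCayleyGraph F k) 4 ↔
      f 1 - f 0 ∈ unitPowers F k ∧ f 2 - f 0 ∈ unitPowers F k ∧ f 3 - f 0 ∈ unitPowers F k ∧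
      f 1 - f 2 ∈ unitPowers F k ∧ f 1 - f 3 ∈ unitPowers F k ∧ f 2 - f 3 ∈ unitPowers F k := by
    intro f
    constructor
    · intro h
      refine ⟨?_, ?_, ?_, ?_, ?_, ?_⟩ <;> exact hadj.mp (h _ _ (by decide))
    · rintro ⟨h1, h2, h3, h4, h5, h6⟩ i j hij
      rw [hadj]
      fin_cases i <;> fin_cases j <;>
        first | exact absurd rfl hij | assumption | (apply hneg; assumption)
  let e : orderedCliques (unitaryCayleyGraph F k) 4 ≃
      F × unitPowers F k × cliquePairs (unitPowers F k) :=
    { toFun := fun f => (f.1 0, ⟨f.1 1 - f.1 0, ((hcl _).mp f.2).1⟩,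
        ⟨((f.1 1 - f.1 0)⁻¹ * (f.1 2 - f.1 0), (f.1 1 - f.1 0)⁻¹ * (f.1 3 - f.1 0)), by
          obtain ⟨h1, h2, h3, h4, h5, h6⟩ := (hcl _).mp f.2
          have h0 := hne h1
          refine ⟨hmul (hinv h1) h2, hmul (hinv h1) h3, ?_, ?_, ?_⟩
          · convert hmul (hinv h1) h4 using 1; field_simp; ring
          · convert hmul (hinv h1) h5 using 1; field_simp; ring
          · convert hmul (hinv h1) h6 using 1; field_simp; ring⟩)
      invFun := fun x => ⟨![x.1, x.1 + x.2.1, x.1 + x.2.1 * x.2.2.1.1, x.1 + x.2.1 * x.2.2.1.2], by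
        obtain ⟨v, ⟨s, hs⟩, ⟨⟨a, b⟩, h1, h2, h3, h4, h5⟩⟩ := x
        rw [hcl]
        simp only [Matrix.cons_val] at *
        refine ⟨?_, ?_, ?_, ?_, ?_, ?_⟩
        · simpa using hs
        · simpa using hmul hs h1
        · simpa using hmul hs h2
        · convert hmul hs h3 using 1; ring
        · convert hmul hs h4 using 1; ring
        · convert hmul hs h5 using 1; ring⟩
      left_inv := by
        rintro ⟨f, hf⟩
        have h0 := hne ((hcl _).mp hf).1
        apply Subtype.ext
        funext i
        fin_cases i <;> simp [h0]
      right_inv := by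
        rintro ⟨v, ⟨s, hs⟩, ⟨⟨a, b⟩, h⟩⟩
        have h0 := hne hs
        simp [h0] }
  rw [← Nat.card_coe_set_eq, Nat.card_congr e, Nat.card_prod, Nat.card_prod, Nat.card_coe_set_eq,
    Nat.card_coe_set_eq, mul_assoc]

/-! ### Detecting powers by characters; double character sums and their symmetries. -/

section CharacterSums

variable {F : Type*} [Field F]

theorem MulChar.apply_mul_inv_self (A : MulChar F ℂ) {x : F} (hx : x ≠ 0) :
    A x * A⁻¹ x = 1 := by
  rw [← MulChar.mul_apply, mul_inv_cancel, MulChar.one_apply (isUnit_iff_ne_zero.mpr hx)]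

theorem MulChar.apply_div (A : MulChar F ℂ) (x y : F) : A (x / y) = A x * A⁻¹ y := by
  rw [div_eq_mul_inv, map_mul, MulChar.inv_apply']

theorem MulChar.apply_sub_comm {A : MulChar F ℂ} (h : A (-1) = 1) (x y : F) :
    A (x - y) = A (y - x) := by
  rw [← neg_sub y x, neg_eq_neg_one_mul, map_mul, h, one_mul]

theorem MulChar.orderOf_apply_generator {g : Fˣ} (hg : ∀ x, x ∈ Subgroup.zpowers g)
    (χ : MulChar F ℂ) : orderOf (χ g) = orderOf χ := by
  refine orderOf_eq_orderOf_iff.mpr fun n => ?_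
  rw [← MulChar.pow_apply_coe, MulChar.eq_iff hg (χ ^ n) 1, MulChar.one_apply_coe]

variable [Fintype F]

/-- The double character sum `∑ A(a) B(b) C(1 - a) D(1 - b) E(a - b)`. -/
noncomputable def pairSum (A B C D E : MulChar F ℂ) : ℂ :=
  ∑ a : F, ∑ b : F, A a * B b * C (1 - a) * D (1 - b) * E (a - b)

/-- For a generator `g` of the cyclic group `Fˣ`, the value `χ g` has order exactly `k`, so `χ (g ^
m) = 1` forces `k ∣ m`. -/
theorem MulChar.apply_eq_one_iff_mem_unitPowers {k : ℕ} {χ : MulChar F ℂ} (hχ : orderOf χ = k)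
    (x : F) : χ x = 1 ↔ x ∈ unitPowers F k := by
  constructor
  · intro h
    have hx : x ≠ 0 := by rintro rfl; simp at h
    obtain ⟨g, hg⟩ := IsCyclic.exists_generator (α := Fˣ)
    obtain ⟨m, hm⟩ := (Submonoid.mem_powers_iff _ _).mp
      (mem_powers_iff_mem_zpowers.mpr (hg (Units.mk0 x hx)))
    have hxm : x = (g : F) ^ m := by
      rw [← Units.val_pow_eq_pow_val, hm, Units.val_mk0]
    rw [hxm, map_pow] at h
    obtain ⟨l, rfl⟩ : k ∣ m := by
      rw [← hχ, ← MulChar.orderOf_apply_generator hg χ]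
      exact orderOf_dvd_of_pow_eq_one h
    exact ⟨g ^ l, by rw [hxm, Units.val_pow_eq_pow_val, ← pow_mul, mul_comm]⟩
  · rintro ⟨y, rfl⟩
    rw [map_pow, ← MulChar.pow_apply_coe, ← hχ, pow_orderOf_eq_one, MulChar.one_apply_coe]

open Classical in
/-- The powers of a character of order `k` detect `k`-th powers. -/
theorem MulChar.sum_pow_apply {k : ℕ} {χ : MulChar F ℂ} (hχ : orderOf χ = k) (x : F) :
    ∑ i ∈ Finset.range k, (χ ^ i) x = if x ∈ unitPowers F k then (k : ℂ) else 0 := by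
  by_cases hx : x = 0
  · subst hx
    rw [if_neg (zero_notMem_unitPowers F k)]
    exact Finset.sum_eq_zero fun i _ => MulChar.map_zero _
  · have hpow : ∀ i, (χ ^ i) x = χ x ^ i := fun i => MulChar.pow_apply_coe χ i (Units.mk0 x hx)
    simp only [hpow]
    rw [← MulChar.apply_eq_one_iff_mem_unitPowers hχ]
    split_ifs with h
    · simp [h]
    · rw [geom_sum_eq h, ← hpow k, ← hχ, pow_orderOf_eq_one,
        MulChar.one_apply (isUnit_iff_ne_zero.mpr hx), sub_self, zero_div]

/-- Summing the detection formula over `F`, only the trivial power of `χ` contributes. -/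
theorem mul_ncard_unitPowers {k : ℕ} {χ : MulChar F ℂ} (hχ : orderOf χ = k) :
    (k : ℂ) * (unitPowers F k).ncard = Fintype.card F - 1 := by
  classical
  have h1 : ∑ x : F, ∑ i ∈ Finset.range k, (χ ^ i) x = k * (unitPowers F k).ncard := by
    simp only [MulChar.sum_pow_apply hχ]
    rw [← Finset.sum_filter, Finset.sum_const, nsmul_eq_mul, mul_comm,
      Set.ncard_eq_toFinset_card']
    congr 3
    ext; simp
  have hk : 0 < k := hχ ▸ MulChar.orderOf_pos χ
  rw [← h1, Finset.sum_comm, ← Finset.add_sum_erase _ _ (Finset.mem_range.mpr hk),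
    Finset.sum_eq_zero (s := (Finset.range k).erase 0), add_zero]
  · simp only [pow_zero]
    rw [MulChar.sum_one_eq_card_units, Fintype.card_units, Nat.cast_sub Fintype.card_pos]
    simp
  · intro i hi
    rw [Finset.mem_erase, Finset.mem_range] at hi
    refine MulChar.sum_eq_zero_of_ne_one fun h => ?_
    have := orderOf_dvd_of_pow_eq_one h
    rw [hχ] at this
    have := Nat.le_of_dvd (by omega) this
    omega

/-- Weights modulo `k` on the five differences of `0, 1, a, b` other than `1 - 0`. -/
def weightBox (k : ℕ) : Finset (ℕ × ℕ × ℕ × ℕ × ℕ) :=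
  .range k ×ˢ .range k ×ˢ .range k ×ˢ .range k ×ˢ .range k

/-- The character sum with characters the powers of `χ` given by a weight. -/
noncomputable def weightSum (χ : MulChar F ℂ) (w : ℕ × ℕ × ℕ × ℕ × ℕ) : ℂ :=
  pairSum (χ ^ w.1) (χ ^ w.2.1) (χ ^ w.2.2.1) (χ ^ w.2.2.2.1) (χ ^ w.2.2.2.2)

theorem pow_mul_ncard_cliquePairs {k : ℕ} {χ : MulChar F ℂ} (hχ : orderOf χ = k) :
    (k : ℂ) ^ 5 * (cliquePairs (unitPowers F k)).ncard = ∑ w ∈ weightBox k, weightSum χ w := by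
  classical
  have h1 : ∑ w ∈ weightBox k, weightSum χ w = ∑ a : F, ∑ b : F,
      (∑ i ∈ Finset.range k, (χ ^ i) a) * (∑ i ∈ Finset.range k, (χ ^ i) b) *
      (∑ i ∈ Finset.range k, (χ ^ i) (1 - a)) * (∑ i ∈ Finset.range k, (χ ^ i) (1 - b)) *
      (∑ i ∈ Finset.range k, (χ ^ i) (a - b)) := by
    simp only [weightSum, pairSum]
    rw [Finset.sum_comm]
    refine Finset.sum_congr rfl fun a _ => ?_
    rw [Finset.sum_comm]
    refine Finset.sum_congr rfl fun b _ => ?_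
    simp only [weightBox, Finset.sum_product, ← Finset.mul_sum, ← Finset.sum_mul]
  rw [h1]
  simp only [MulChar.sum_pow_apply hχ]
  rw [← Fintype.sum_prod_type' (f := fun a b : F => _)]
  rw [Set.ncard_eq_toFinset_card', mul_comm, ← nsmul_eq_mul, ← Finset.sum_const]
  have hset : (cliquePairs (unitPowers F k)).toFinset =
      Finset.univ.filter fun x : F × F => x ∈ cliquePairs (unitPowers F k) := by
    ext; simp
  rw [hset, Finset.sum_filter]
  refine Finset.sum_congr rfl fun x _ => ?_
  by_cases h1 : x.1 ∈ unitPowers F k <;> by_cases h2 : x.2 ∈ unitPowers F k <;>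
    by_cases h3 : 1 - x.1 ∈ unitPowers F k <;> by_cases h4 : 1 - x.2 ∈ unitPowers F k <;>
    by_cases h5 : x.1 - x.2 ∈ unitPowers F k <;> simp [cliquePairs, h1, h2, h3, h4, h5]; ring

/-- A trivial last character only removes the diagonal `a = b`: the full sum factors, and the
diagonal is itself a Jacobi sum. -/
theorem pairSum_one_right (A B C D : MulChar F ℂ) :
    pairSum A B C D 1 = jacobiSum A C * jacobiSum B D - jacobiSum (A * B) (C * D) := by
  classical
  have h : ∀ a b : F, A a * B b * C (1 - a) * D (1 - b) * (1 : MulChar F ℂ) (a - b) =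
      (A a * C (1 - a)) * (B b * D (1 - b)) -
        if a = b then (A * B) a * (C * D) (1 - a) else 0 := by
    intro a b
    by_cases hab : a = b
    · subst hab
      simp only [sub_self, MulChar.map_zero, mul_zero, if_true, MulChar.mul_apply]
      ring
    · rw [MulChar.one_apply (isUnit_iff_ne_zero.mpr (sub_ne_zero.mpr hab)), if_neg hab]
      ring
  simp only [pairSum, h, Finset.sum_sub_distrib, Finset.sum_ite_eq, Finset.mem_univ, if_true]
  rw [← Finset.sum_mul_sum]
  rfl

theorem pairSum_swap {A B C D E : MulChar F ℂ} (hE : E (-1) = 1) :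
    pairSum A B C D E = pairSum B A D C E := by
  rw [pairSum, Finset.sum_comm]
  refine Finset.sum_congr rfl fun a _ => Finset.sum_congr rfl fun b _ => ?_
  rw [MulChar.apply_sub_comm hE b a]
  ring

theorem pairSum_reflect {A B C D E : MulChar F ℂ} (hE : E (-1) = 1) :
    pairSum A B C D E = pairSum C D A B E := by
  rw [pairSum, ← Equiv.sum_comp (Equiv.subLeft (1 : F))]
  refine Finset.sum_congr rfl fun a _ => ?_
  rw [← Equiv.sum_comp (Equiv.subLeft (1 : F))]
  refine Finset.sum_congr rfl fun b _ => ?_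
  simp only [Equiv.subLeft_apply, sub_sub_cancel, sub_sub_sub_cancel_left]
  rw [MulChar.apply_sub_comm hE b a]
  ring

/-- The substitution `a ↦ 1/a`, `b ↦ 1/b`, exchanging the points `0` and `∞`. -/
theorem pairSum_inv {A B C D E : MulChar F ℂ} (hC : C (-1) = 1) (hD : D (-1) = 1)
    (hE : E (-1) = 1) :
    pairSum A B C D E = pairSum (A * C * E)⁻¹ (B * D * E)⁻¹ C D E := by
  rw [pairSum, ← Equiv.sum_comp (Equiv.inv F)]
  refine Finset.sum_congr rfl fun a _ => ?_
  rw [← Equiv.sum_comp (Equiv.inv F)]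
  refine Finset.sum_congr rfl fun b _ => ?_
  simp only [Equiv.inv_apply]
  by_cases ha : a = 0
  · simp [ha, MulChar.map_zero]
  by_cases hb : b = 0
  · simp [hb, MulChar.map_zero]
  have e1 : 1 - a⁻¹ = (a - 1) / a := by field_simp
  have e2 : 1 - b⁻¹ = (b - 1) / b := by field_simp
  have e3 : a⁻¹ - b⁻¹ = (b - a) / (a * b) := by field_simp
  rw [e1, e2, e3]
  simp only [MulChar.apply_div, map_mul, ← MulChar.inv_apply', MulChar.mul_apply, mul_inv]
  rw [MulChar.apply_sub_comm hC a 1, MulChar.apply_sub_comm hD b 1, MulChar.apply_sub_comm hE b a]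
  ring

/-- The substitution `a ↦ 1/a`, `b ↦ b/a`: dividing the five points by `a` exchanges the roles of
`1` and `a`. With `pairSum_swap`, `pairSum_reflect` and `pairSum_inv` this gives transpositions
generating `S₅`. -/
theorem pairSum_scale {A B C D E : MulChar F ℂ} (hC : C (-1) = 1) :
    pairSum A B C D E = pairSum (A * B * C * D * E)⁻¹ B C E D := by
  rw [pairSum, ← Equiv.sum_comp (Equiv.inv F)]
  refine Finset.sum_congr rfl fun a _ => ?_
  simp only [Equiv.inv_apply]
  by_cases ha : a = 0
  · simp [ha, MulChar.map_zero]
  rw [← Equiv.sum_comp (Equiv.divRight₀ a ha)]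
  refine Finset.sum_congr rfl fun b _ => ?_
  have e1 : 1 - a⁻¹ = (a - 1) / a := by field_simp
  have e2 : 1 - b / a = (a - b) / a := by field_simp
  have e3 : a⁻¹ - b / a = (1 - b) / a := by field_simp
  simp only [Equiv.divRight₀_apply]
  rw [e1, e2, e3]
  simp only [MulChar.apply_div, ← MulChar.inv_apply', MulChar.mul_apply, mul_inv]
  rw [MulChar.apply_sub_comm hC a 1]
  ring

end CharacterSums

/-! ### The action of `S₅` on exponents and classification by type. -/

section Orbits

/-- Generators of the action of `S₅` on weights modulo `k`: they permute the points
`0, 1, ∞, a, b`. -/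
def weightAct (k : ℕ) : ℕ → ℕ × ℕ × ℕ × ℕ × ℕ → ℕ × ℕ × ℕ × ℕ × ℕ
  | 0, (a, b, c, d, e) => (b, a, d, c, e)
  | 1, (a, b, c, d, e) => (c, d, a, b, e)
  | 2, (a, b, c, d, e) => ((k - 1) * (a + c + e) % k, (k - 1) * (b + d + e) % k, c, d, e)
  | _, (a, b, c, d, e) => ((k - 1) * (a + b + c + d + e) % k, b, c, e, d)

/-- The action of a word in the generators. -/
def wordAct (k : ℕ) : List ℕ → ℕ × ℕ × ℕ × ℕ × ℕ → ℕ × ℕ × ℕ × ℕ × ℕ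
  | [], w => w
  | g :: l, w => wordAct k l (weightAct k g w)

/-- Elements of `S₅`, as words in the generators, which bring each weight for `k ≤ 4` to one with
trivial last entry or to one of a few representatives. -/
def reductionWords : List (List ℕ) :=
  [[], [3], [0, 3], [1, 3], [0, 1, 3], [3, 0, 1, 2, 3], [2, 1, 3, 0, 1], [0, 2, 1, 3, 0, 1],
    [1, 2, 1, 3, 0, 1, 3], [2, 3, 0, 1, 3], [0, 1], [2, 1], [0], [1], [3, 0], [0, 2, 1],
    [0, 3, 0], [1, 2, 1], [0, 1, 2, 1], [1, 2, 3, 0], [2, 1, 3, 0], [3, 0, 1, 2],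
    [0, 1, 2, 3, 0], [1, 3, 0, 1, 2], [1, 2, 3, 0, 1, 2], [0, 1, 2, 1, 3, 0, 1, 3],
    [0, 2, 1, 3, 0, 1, 2, 3, 1], [1, 2], [3, 1], [1, 3, 1], [2, 3, 1], [0, 3, 0, 1],
    [1, 3, 0, 1], [0, 1, 3, 0, 1]]

/-- The type of the Jacobi sum `J(χ ^ i, χ ^ j)` for `χ` of order `k ≤ 4`: it is `q - 2` for
type `0`, it is `-1` for type `1`, and types `2` and `3` are conjugate. -/
def jacobiType (k i j : ℕ) : ℕ :=
  bif i % k == 0 && j % k == 0 then 0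
  else bif i % k == 0 || j % k == 0 || (i + j) % k == 0 then 1
  else bif (i % k + j % k).ble 3 then 2 else 3

/-- The type of a weight: the types of the three Jacobi sums if the last entry is trivial, and
otherwise the position in the list of representatives. -/
def weightType (k : ℕ) (reps : List (ℕ × ℕ × ℕ × ℕ × ℕ)) : ℕ × ℕ × ℕ × ℕ × ℕ → Option ℕ
  | (a, b, c, d, e) =>
    bif e == 0 then
      -- Three base-4 digits, hence a value below 64; larger types are reserved for representatives.
      some (16 * jacobiType k a c + 4 * jacobiType k b d + jacobiType k (a + b) (c + d))
    else (reps.findIdx? fun r => r.1 == a && r.2.1 == b && r.2.2.1 == c && r.2.2.2.1 == d &&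
      r.2.2.2.2 == e).map (64 + ·)

/-- The type of the first image of a weight under a reduction word which has a type. -/
def orbitType (k : ℕ) (reps : List (ℕ × ℕ × ℕ × ℕ × ℕ)) (w : ℕ × ℕ × ℕ × ℕ × ℕ) : ℕ :=
  -- Legal types are at most 69, so the default 70 signals a weight that no word reduces. The
  -- counting identities rule it out.
  (reductionWords.findSome? fun g => weightType k reps (wordAct k g w)).getD 70

variable {F : Type*} [Field F] [Fintype F] {k : ℕ} {χ : MulChar F ℂ}

/-- Each generator is one of the four substitutions; `χ (-1) = 1` removes all signs, and the
exponent `(k - 1) * i` stands for `-i` in natural numbers. -/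
theorem weightSum_weightAct (hχ : χ ^ k = 1) (hneg : χ (-1) = 1) (hk : 0 < k) (g : ℕ)
    (w : ℕ × ℕ × ℕ × ℕ × ℕ) : weightSum χ (weightAct k g w) = weightSum χ w := by
  obtain ⟨a, b, c, d, e⟩ := w
  have hn : ∀ i, (χ ^ i) (-1) = 1 := fun i => by
    simpa [hneg] using MulChar.pow_apply_coe χ i (-1)
  have hinv : ∀ i, χ ^ ((k - 1) * i % k) = (χ ^ i)⁻¹ := fun i => by
    rw [eq_inv_iff_mul_eq_one, ← pow_mod_orderOf,
      Nat.mod_mod_of_dvd _ (orderOf_dvd_of_pow_eq_one hχ), pow_mod_orderOf, ← pow_add,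
      ← Nat.succ_mul, Nat.succ_eq_add_one, Nat.sub_add_cancel hk, pow_mul,
      hχ, one_pow]
  match g with
  | 0 => exact (pairSum_swap (hn _)).symm
  | 1 => exact (pairSum_reflect (hn _)).symm
  | 2 =>
    simp only [weightAct, weightSum, hinv, pow_add]
    exact (pairSum_inv (hn _) (hn _) (hn _)).symm
  | _ + 3 =>
    simp only [weightAct, weightSum, hinv, pow_add]
    exact (pairSum_scale (hn _)).symm

theorem weightSum_wordAct (hχ : χ ^ k = 1) (hneg : χ (-1) = 1) (hk : 0 < k) (l : List ℕ)
    (w : ℕ × ℕ × ℕ × ℕ × ℕ) : weightSum χ (wordAct k l w) = weightSum χ w := by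
  induction l generalizing w with
  | nil => rfl
  | cons g l ih => rw [wordAct, ih, weightSum_weightAct hχ hneg hk]

/-- The value of the character sum for a given type, where `j` gives the values of the Jacobi
sums of types `0, 1, 2, 3` and `v` the values at the representatives. -/
def typeValue (j v : ℕ → ℂ) (t : ℕ) : ℂ :=
  if t < 64 then j (t / 16) * j (t / 4 % 4) - j (t % 4) else v (t - 64)

theorem jacobiType_lt (k i j : ℕ) : jacobiType k i j < 4 := by
  unfold jacobiType
  rcases (i % k == 0 && j % k == 0) <;> rcases (i % k == 0 || j % k == 0 || (i + j) % k == 0) <;>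
    rcases (i % k + j % k).ble 3 <;> simp

theorem weightSum_eq_typeValue {reps : List (ℕ × ℕ × ℕ × ℕ × ℕ)} {j v : ℕ → ℂ}
    (hj : ∀ a b, jacobiSum (χ ^ a) (χ ^ b) = j (jacobiType k a b))
    (hv : ∀ i (h : i < reps.length), weightSum χ reps[i] = v i)
    {w : ℕ × ℕ × ℕ × ℕ × ℕ} {t : ℕ} (ht : weightType k reps w = some t) :
    weightSum χ w = typeValue j v t := by
  obtain ⟨a, b, c, d, e⟩ := w
  simp only [weightType] at ht
  rcases Nat.eq_zero_or_pos e with rfl | he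
  · simp only [BEq.rfl, cond_true, Option.some.injEq] at ht
    have h1 := jacobiType_lt k a c
    have h2 := jacobiType_lt k b d
    have h3 := jacobiType_lt k (a + b) (c + d)
    rw [typeValue, if_pos (by omega), weightSum, pow_zero, pairSum_one_right, ← pow_add, ← pow_add,
      hj, hj, hj]
    dsimp only
    congr 3 <;> omega
  · have : (e == 0) = false := by simpa using he.ne'
    rw [this, cond_false, Option.map_eq_some_iff] at ht
    obtain ⟨i, hi, rfl⟩ := ht
    rw [List.findIdx?_eq_some_iff_getElem] at hi
    obtain ⟨hlt, hi, -⟩ := hi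
    simp only [Bool.and_eq_true, beq_iff_eq] at hi
    rw [typeValue, if_neg (by omega), Nat.add_sub_cancel_left, ← hv i hlt]
    congr 1
    obtain ⟨⟨⟨⟨h1, h2⟩, h3⟩, h4⟩, h5⟩ := hi
    simp only [Prod.ext_iff]
    exact ⟨h1.symm, h2.symm, h3.symm, h4.symm, h5.symm⟩

theorem weightSum_eq_typeValue_orbitType (hχ : χ ^ k = 1) (hneg : χ (-1) = 1) (hk : 0 < k)
    {reps : List (ℕ × ℕ × ℕ × ℕ × ℕ)} {j v : ℕ → ℂ}
    (hj : ∀ a b, jacobiSum (χ ^ a) (χ ^ b) = j (jacobiType k a b))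
    (hv : ∀ i (h : i < reps.length), weightSum χ reps[i] = v i)
    {w : ℕ × ℕ × ℕ × ℕ × ℕ} (hw : orbitType k reps w < 70) :
    weightSum χ w = typeValue j v (orbitType k reps w) := by
  unfold orbitType at hw ⊢
  cases h : reductionWords.findSome? fun g => weightType k reps (wordAct k g w) with
  | none => simp [h] at hw
  | some t =>
    obtain ⟨g, -, hg⟩ := List.exists_of_findSome?_eq_some h
    rw [Option.getD_some, ← weightSum_wordAct hχ hneg hk g]
    exact weightSum_eq_typeValue hj hv hg

theorem eq_of_sum_mul_pow_eq {B : ℕ} (n : ℕ) {c d : ℕ → ℕ} (hc : ∀ l, c l < B) (hd : ∀ l, d l < B)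
    (h : ∑ l ∈ Finset.range n, c l * B ^ l = ∑ l ∈ Finset.range n, d l * B ^ l) :
    ∀ l < n, c l = d l := by
  induction n generalizing c d with
  | zero => simp
  | succ n ih =>
    have hsplit : ∀ c : ℕ → ℕ, ∑ l ∈ Finset.range (n + 1), c l * B ^ l =
        c 0 + B * ∑ l ∈ Finset.range n, c (l + 1) * B ^ l := fun c => by
      rw [Finset.sum_range_succ', Finset.mul_sum, add_comm, pow_zero, mul_one]
      congr 1
      exact Finset.sum_congr rfl fun l _ => by ring
    rw [hsplit, hsplit] at h
    have h0 : c 0 = d 0 := by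
      have := congrArg (· % B) h
      simpa [Nat.add_mul_mod_self_left, Nat.mod_eq_of_lt (hc 0), Nat.mod_eq_of_lt (hd 0)] using this
    have hB : 0 < B := (Nat.zero_le _).trans_lt (hc 0)
    rw [h0] at h
    have h1 := Nat.eq_of_mul_eq_mul_left hB (Nat.add_left_cancel h)
    intro l hl
    cases l with
    | zero => exact h0
    | succ l => exact ih (fun l => hc (l + 1)) (fun l => hd (l + 1)) h1 l (by omega)

theorem sum_mul_pow_lt {B : ℕ} (n : ℕ) {c : ℕ → ℕ} (hc : ∀ l, c l < B) :
    ∑ l ∈ Finset.range n, c l * B ^ l < B ^ n := by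
  induction n with
  | zero => simp
  | succ n ih =>
    rw [Finset.sum_range_succ, pow_succ]
    have h := Nat.mul_le_mul_right (B ^ n) (Nat.succ_le_of_lt (hc n))
    nlinarith

/-- Counting by types: if the numbers of elements of each type are less than `B`, they can be read
off from the base `B` digits of a single number. -/
theorem sum_comp_of_sum_pow_eq {ι : Type*} (s : Finset ι) (t : ι → ℕ) {B n : ℕ} (hB : s.card < B)
    {c : ℕ → ℕ} (hc : ∀ l, c l < B)
    (h : ∑ i ∈ s, B ^ t i = ∑ l ∈ Finset.range n, c l * B ^ l) :
    (∀ i ∈ s, t i < n) ∧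
      ∀ f : ℕ → ℂ, ∑ i ∈ s, f (t i) = ∑ l ∈ Finset.range n, (c l : ℂ) * f l := by
  -- An element of type at least `n` would by itself contribute `B ^ n` or more, exceeding every
  -- `n`-digit number.
  have hlt : ∀ i ∈ s, t i < n := by
    intro i hi
    have h1 : B ^ t i ≤ ∑ i ∈ s, B ^ t i :=
      Finset.single_le_sum (f := fun i => B ^ t i) (fun _ _ => Nat.zero_le _) hi
    have h2 := h ▸ h1
    have hB1 : 1 < B := lt_of_le_of_lt (Finset.card_pos.mpr ⟨i, hi⟩) hB
    exact (Nat.pow_lt_pow_iff_right hB1).mp (h2.trans_lt (sum_mul_pow_lt n hc))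
  refine ⟨hlt, fun f => ?_⟩
  have hmaps : ∀ i ∈ s, t i ∈ Finset.range n := fun i hi => Finset.mem_range.mpr (hlt i hi)
  rw [← Finset.sum_fiberwise_of_maps_to hmaps] at h
  have hcount : ∀ l ∈ Finset.range n, (s.filter fun i => t i = l).card = c l := by
    intro l hl
    refine eq_of_sum_mul_pow_eq n (c := fun l => (s.filter fun i => t i = l).card)
      (fun l => (Finset.card_filter_le _ _).trans_lt hB) hc ?_ l (Finset.mem_range.mp hl)
    rw [← h]
    refine Finset.sum_congr rfl fun l _ => ?_
    rw [← smul_eq_mul, ← Finset.sum_const]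
    exact Finset.sum_congr rfl fun i hi => by rw [(Finset.mem_filter.mp hi).2]
  rw [← Finset.sum_fiberwise_of_maps_to hmaps]
  refine Finset.sum_congr rfl fun l hl => ?_
  rw [← hcount l hl, ← nsmul_eq_mul, ← Finset.sum_const]
  exact Finset.sum_congr rfl fun i hi => by rw [(Finset.mem_filter.mp hi).2]

theorem card_weightBox (k : ℕ) : (weightBox k).card = k ^ 5 := by
  simp only [weightBox, Finset.card_product, Finset.card_range]
  ring

/-- The sum over all weights, given the number `c t` of weights of each type `t`. -/
theorem sum_weightSum_eq (hχ : χ ^ k = 1) (hneg : χ (-1) = 1) (hk : 0 < k) {B : ℕ} (hB : k ^ 5 < B)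
    {reps : List (ℕ × ℕ × ℕ × ℕ × ℕ)} {j v : ℕ → ℂ}
    (hj : ∀ a b, jacobiSum (χ ^ a) (χ ^ b) = j (jacobiType k a b))
    (hv : ∀ i (h : i < reps.length), weightSum χ reps[i] = v i)
    {c : ℕ → ℕ} (hc : ∀ l, c l < B)
    (h : ∑ w ∈ weightBox k, B ^ orbitType k reps w = ∑ l ∈ Finset.range 70, c l * B ^ l) :
    ∑ w ∈ weightBox k, weightSum χ w = ∑ l ∈ Finset.range 70, (c l : ℂ) * typeValue j v l := by
  obtain ⟨h1, h2⟩ := sum_comp_of_sum_pow_eq _ _ (by rwa [card_weightBox]) hc h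
  rw [← h2]
  exact Finset.sum_congr rfl fun w hw =>
    weightSum_eq_typeValue_orbitType hχ hneg hk hj hv (h1 w hw)

end Orbits

/-! ### Numbers of weights of each type, and the resulting totals. -/

section OrbitCounts

theorem List.getD_zero_lt {L : List ℕ} {B : ℕ} (hB : 0 < B) (h : ∀ x ∈ L, x < B) (l : ℕ) :
    L.getD l 0 < B := by
  by_cases hl : l < L.length
  · rw [List.getD_eq_getElem _ _ hl]
    exact h _ (List.getElem_mem hl)
  · rwa [List.getD_eq_default _ _ (by omega)]

/-- Numbers of weights of each type for `k = 2`. -/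
def quadraticCounts : List ℕ :=
  [1, 0, 0, 0, 0, 5, 0, 0, 0, 0, 0, 0, 0, 0, 0, 0, 0, 3, 0, 0, 7, 15, 0, 0, 0, 0, 0, 0, 0, 0, 0, 0,
    0, 0, 0, 0, 0, 0, 0, 0, 0, 0, 0, 0, 0, 0, 0, 0, 0, 0, 0, 0, 0, 0, 0, 0, 0, 0, 0, 0, 0, 0, 0, 0,
    1]

/-- Numbers of weights of each type for `k = 3`. -/
def cubicCounts : List ℕ :=
  [1, 0, 0, 0, 0, 10, 0, 0, 0, 0, 3, 0, 0, 0, 0, 3, 0, 6, 0, 0, 14, 44, 15, 15, 0, 25, 0, 0, 0, 25,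
    0, 0, 0, 0, 2, 0, 0, 20, 0, 0, 0, 0, 0, 10, 3, 0, 0, 0, 0, 0, 0, 2, 0, 20, 0, 0, 3, 0, 0, 0, 0,
    0, 10, 0, 12]

/-- Numbers of weights of each type for `k = 4`. -/
def quarticCounts : List ℕ :=
  [1, 0, 0, 0, 0, 15, 0, 0, 0, 0, 9, 0, 0, 0, 0, 9, 0, 9, 0, 0, 21, 87, 45, 45, 0, 75, 28, 14, 0,
    75, 14, 28, 0, 0, 6, 0, 0, 60, 32, 16, 0, 15, 0, 60, 9, 30, 0, 0, 0, 0, 0, 6, 0, 60, 16, 32, 9,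
    30, 0, 0, 0, 15, 60, 0, 12, 30, 30, 10, 10, 1]

/-- The base 2048 exceeds `4 ^ 5`, the largest number of weights, so no digit overflows. One
identity of natural numbers thus certifies all counts at once; likewise for `k = 3` and `k = 4`. -/
theorem quadraticCounts_spec :
    ∑ w ∈ weightBox 2, 2048 ^ orbitType 2 [(1, 1, 1, 1, 1)] w =
      ∑ l ∈ Finset.range 70, quadraticCounts.getD l 0 * 2048 ^ l := by
  decide +kernel

theorem cubicCounts_spec :
    ∑ w ∈ weightBox 3, 2048 ^ orbitType 3 [(1, 2, 1, 1, 2)] w =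
      ∑ l ∈ Finset.range 70, cubicCounts.getD l 0 * 2048 ^ l := by
  decide +kernel

/-- Representatives of the weights without trivial characters for `k = 4`. -/
def quarticReps : List (ℕ × ℕ × ℕ × ℕ × ℕ) :=
  [(1, 3, 1, 1, 3), (2, 2, 1, 2, 2), (2, 1, 1, 3, 2), (1, 1, 1, 1, 1), (3, 3, 3, 3, 3),
    (2, 2, 2, 2, 2)]

theorem quarticCounts_spec :
    ∑ w ∈ weightBox 4, 2048 ^ orbitType 4 quarticReps w =
      ∑ l ∈ Finset.range 70, quarticCounts.getD l 0 * 2048 ^ l := by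
  decide +kernel

variable {F : Type*} [Field F] [Fintype F] {χ : MulChar F ℂ}

/-- Types 0 and 1 have forced values: `q - 2` for two trivial characters, `-1` for exactly one, and
`J(ψ, ψ⁻¹) = -ψ(-1) = -1`. Only types 2 and 3 need input. -/
theorem jacobiSum_pow_eq {k : ℕ} (hχ : orderOf χ = k) (hneg : χ (-1) = 1) {π π' : ℂ}
    (h2 : ∀ a < k, ∀ b < k, jacobiType k a b = 2 → jacobiSum (χ ^ a) (χ ^ b) = π)
    (h3 : ∀ a < k, ∀ b < k, jacobiType k a b = 3 → jacobiSum (χ ^ a) (χ ^ b) = π') (a b : ℕ) :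
    jacobiSum (χ ^ a) (χ ^ b) =
      [(Fintype.card F - 2 : ℂ), -1, π, π'].getD (jacobiType k a b) 0 := by
  have hk : 0 < k := hχ ▸ MulChar.orderOf_pos χ
  have hmod : ∀ a, χ ^ (a % k) = χ ^ a := fun a => by rw [← hχ, pow_mod_orderOf]
  have hone : ∀ a, χ ^ a = 1 ↔ a % k = 0 := fun a => by
    rw [← Nat.dvd_iff_mod_eq_zero, ← hχ, orderOf_dvd_iff_pow_eq_one]
  have htype : jacobiType k (a % k) (b % k) = jacobiType k a b := by simp [jacobiType]
  have hcase : jacobiType k a b = 0 ∧ a % k = 0 ∧ b % k = 0 ∨ jacobiType k a b = 1 ∧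
      ¬ (a % k = 0 ∧ b % k = 0) ∧ (a % k = 0 ∨ b % k = 0 ∨ (a + b) % k = 0) ∨
      jacobiType k a b = 2 ∨ jacobiType k a b = 3 := by
    by_cases h0 : a % k = 0 ∧ b % k = 0
    · left; exact ⟨by simp [jacobiType, h0], h0⟩
    right
    by_cases h1 : a % k = 0 ∨ b % k = 0 ∨ (a + b) % k = 0
    · left
      refine ⟨?_, h0, h1⟩
      have e0 : (a % k == 0 && b % k == 0) = false := by simpa using h0
      have e1 : (a % k == 0 || b % k == 0 || (a + b) % k == 0) = true := by
        simpa [or_assoc] using h1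
      rw [jacobiType, e0, e1]; rfl
    right
    have e0 : (a % k == 0 && b % k == 0) = false := by simpa using h0
    have e1 : (a % k == 0 || b % k == 0 || (a + b) % k == 0) = false := by
      simpa [not_or, and_assoc] using h1
    rw [jacobiType, e0, e1]
    rcases (a % k + b % k).ble 3 <;> simp
  rcases hcase with ⟨ht, ha, hb⟩ | ⟨ht, h0, h1⟩ | ht | ht
  · rw [ht, (hone a).mpr ha, (hone b).mpr hb, jacobiSum_one_one]; rfl
  · rw [ht]
    change _ = (-1 : ℂ)
    by_cases ha : a % k = 0
    · rw [(hone a).mpr ha]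
      exact jacobiSum_one_nontrivial fun hb => h0 ⟨ha, (hone b).mp hb⟩
    by_cases hb : b % k = 0
    · rw [(hone b).mpr hb, jacobiSum_comm]
      exact jacobiSum_one_nontrivial fun ha => h0 ⟨(hone a).mp ha, hb⟩
    have hab : χ ^ b = (χ ^ a)⁻¹ := by
      rw [eq_inv_iff_mul_eq_one, ← pow_add, add_comm, hone]
      simpa [ha, hb] using h1
    rw [hab, jacobiSum_nontrivial_inv (fun h => ha ((hone a).mp h))]
    have := MulChar.pow_apply_coe χ a (-1)
    simp only [Units.val_neg, Units.val_one, hneg, one_pow] at this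
    rw [this]
  · rw [ht, ← hmod a, ← hmod b]
    exact h2 _ (Nat.mod_lt _ hk) _ (Nat.mod_lt _ hk) (htype.trans ht)
  · rw [ht, ← hmod a, ← hmod b]
    exact h3 _ (Nat.mod_lt _ hk) _ (Nat.mod_lt _ hk) (htype.trans ht)

theorem sum_weightSum_quadratic (hχ : orderOf χ = 2) (hneg : χ (-1) = 1) :
    ∑ w ∈ weightBox 2, weightSum χ w =
      (Fintype.card F : ℂ) ^ 2 - 20 * Fintype.card F + 81 + pairSum χ χ χ χ χ := by
  rw [sum_weightSum_eq (j := fun t => [(Fintype.card F - 2 : ℂ), -1, 0, 0].getD t 0)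
    (v := fun _ => pairSum χ χ χ χ χ) (hχ ▸ pow_orderOf_eq_one χ) hneg
    (by norm_num) (by norm_num)
    -- Types 2 and 3 do not occur for `k = 2`, so their values are dummies.
    (jacobiSum_pow_eq (π := 0) (π' := 0) hχ hneg
      (fun a ha b hb h => absurd h (by interval_cases a <;> interval_cases b <;> decide))
      (fun a ha b hb h => absurd h (by interval_cases a <;> interval_cases b <;> decide))) ?_
    (List.getD_zero_lt (by norm_num) (by decide)) quadraticCounts_spec]
  · simp [Finset.sum_range_succ, quadraticCounts, typeValue]
    ring
  · intro i hi
    obtain rfl : i = 0 := by simpa using hi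
    simp [weightSum]

theorem sum_weightSum_cubic (hχ : orderOf χ = 3) (hneg : χ (-1) = 1) {π π' : ℂ}
    (h1 : jacobiSum χ χ = π) (h2 : jacobiSum (χ ^ 2) (χ ^ 2) = π') :
    ∑ w ∈ weightBox 3, weightSum χ w =
      (Fintype.card F : ℂ) ^ 2 - 41 * Fintype.card F + 316 + (5 * Fintype.card F - 85) * (π + π') +
        10 * (π ^ 2 + π' ^ 2) + 6 * π * π' + 12 * pairSum χ (χ ^ 2) χ χ (χ ^ 2) := by
  rw [sum_weightSum_eq (j := fun t => [(Fintype.card F - 2 : ℂ), -1, π, π'].getD t 0)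
    (v := fun _ => pairSum χ (χ ^ 2) χ χ (χ ^ 2)) (hχ ▸ pow_orderOf_eq_one χ)
    hneg (by norm_num) (by norm_num)
    (jacobiSum_pow_eq (π := π) (π' := π') hχ hneg ?_ ?_) ?_
    (List.getD_zero_lt (by norm_num) (by decide)) cubicCounts_spec]
  · simp [Finset.sum_range_succ, cubicCounts, typeValue]
    ring
  · intro a ha b hb h
    interval_cases a <;> interval_cases b <;> first | exact absurd h (by decide) | simpa using h1
  · intro a ha b hb h
    interval_cases a <;> interval_cases b <;> first | exact absurd h (by decide) | simpa using h2
  · intro i hi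
    obtain rfl : i = 0 := by simpa using hi
    simp [weightSum]

theorem sum_weightSum_quartic (hχ : orderOf χ = 4) (hneg : χ (-1) = 1) {π π' : ℂ}
    (h1 : jacobiSum χ χ = π) (h2 : jacobiSum χ (χ ^ 2) = π)
    (h3 : jacobiSum (χ ^ 3) (χ ^ 3) = π') (h4 : jacobiSum (χ ^ 2) (χ ^ 3) = π') :
    ∑ w ∈ weightBox 4, weightSum χ w =
      (Fintype.card F : ℂ) ^ 2 - 68 * Fintype.card F + 801 +
        (15 * Fintype.card F - 465) * (π + π') + 75 * (π ^ 2 + π' ^ 2) + 78 * π * π' +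
        12 * pairSum χ (χ ^ 3) χ χ (χ ^ 3) + 30 * pairSum (χ ^ 2) (χ ^ 2) χ (χ ^ 2) (χ ^ 2) +
        30 * pairSum (χ ^ 2) χ χ (χ ^ 3) (χ ^ 2) + 10 * pairSum χ χ χ χ χ +
        10 * pairSum (χ ^ 3) (χ ^ 3) (χ ^ 3) (χ ^ 3) (χ ^ 3) +
        pairSum (χ ^ 2) (χ ^ 2) (χ ^ 2) (χ ^ 2) (χ ^ 2) := by
  rw [sum_weightSum_eq (j := fun t => [(Fintype.card F - 2 : ℂ), -1, π, π'].getD t 0)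
    (v := fun i => weightSum χ (quarticReps.getD i 0))
    (hχ ▸ pow_orderOf_eq_one χ) hneg (by norm_num) (by norm_num)
    (jacobiSum_pow_eq (π := π) (π' := π') hχ hneg ?_ ?_) ?_
    (List.getD_zero_lt (by norm_num) (by decide)) quarticCounts_spec]
  · simp [Finset.sum_range_succ, quarticCounts, typeValue, quarticReps, weightSum]
    ring
  · intro a ha b hb h
    interval_cases a <;> interval_cases b <;>
      first | exact absurd h (by decide) | simpa using h1 | simpa using h2 |
        simpa [jacobiSum_comm (χ ^ 2) χ] using h2
  · intro a ha b hb h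
    interval_cases a <;> interval_cases b <;>
      first | exact absurd h (by decide) | simpa using h3 | simpa using h4 |
        simpa [jacobiSum_comm (χ ^ 3) (χ ^ 2)] using h4
  · intro i hi
    rw [List.getD_eq_getElem _ _ hi]

end OrbitCounts

/-! ### Sums over squares and the quadratic character. -/

section QuadraticTransformations

variable {F : Type*} [Field F]

theorem MulChar.mul_self_eq_one {φ : MulChar F ℂ} (hφ : orderOf φ = 2) : φ * φ = 1 := by
  rw [← sq, ← hφ, pow_orderOf_eq_one]

theorem MulChar.inv_eq_self {φ : MulChar F ℂ} (hφ : orderOf φ = 2) : φ⁻¹ = φ :=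
  inv_eq_of_mul_eq_one_left (MulChar.mul_self_eq_one hφ)

variable [Fintype F]

theorem sum_affine {m : F} (hm : m ≠ 0) (c : F) (f : F → ℂ) : ∑ x, f (m * x + c) = ∑ x, f x :=
  ((Equiv.mulLeft₀ m hm).trans (Equiv.addRight c)).sum_comp f

theorem sum_mul_left {m : F} (hm : m ≠ 0) (f : F → ℂ) : ∑ x, f (m * x) = ∑ x, f x :=
  Equiv.sum_comp (Equiv.mulLeft₀ m hm) f

theorem MulChar.two_ne_zero {φ : MulChar F ℂ} (hφ : orderOf φ = 2) : (2 : F) ≠ 0 := by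
  have h := MulChar.orderOf_dvd_card_sub_one (F := F) φ
  rw [hφ] at h
  refine Ring.two_ne_zero fun h2 => ?_
  have := FiniteField.even_card_of_char_two h2
  have := Fintype.card_pos (α := F)
  omega

theorem MulChar.apply_sq {φ : MulChar F ℂ} (hφ : orderOf φ = 2) {x : F} (hx : x ≠ 0) :
    φ (x ^ 2) = 1 :=
  (MulChar.apply_eq_one_iff_mem_unitPowers hφ _).mpr ⟨Units.mk0 x hx, rfl⟩

open Classical in
-- A complex character of order 2 agrees with `quadraticChar`, for which the count of square roots
-- is known.
theorem MulChar.card_sqrts {φ : MulChar F ℂ} (hφ : orderOf φ = 2) (y : F) :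
    ((Finset.univ.filter fun d : F => d ^ 2 = y).card : ℂ) = 1 + φ y := by
  have h2 : ringChar F ≠ 2 := fun h => MulChar.two_ne_zero hφ (by
    have := ringChar.spec F 2
    rw [h] at this
    exact_mod_cast this.mpr dvd_rfl)
  have hq := quadraticChar_card_sqrts h2 y
  have hset : (Finset.univ.filter fun d : F => d ^ 2 = y) = {x : F | x ^ 2 = y}.toFinset := by
    ext; simp
  rw [hset]
  have hcast : (({x : F | x ^ 2 = y}.toFinset.card : ℤ) : ℂ) =
      ((quadraticChar F y + 1 : ℤ) : ℂ) := by
    rw [hq]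
  have hval : φ y = ((quadraticChar F y : ℤ) : ℂ) := by
    by_cases hy : y = 0
    · simp [hy]
    have hiff : φ y = 1 ↔ quadraticChar F y = 1 := by
      rw [MulChar.apply_eq_one_iff_mem_unitPowers hφ, quadraticChar_one_iff_isSquare hy]
      constructor
      · rintro ⟨x, rfl⟩
        exact ⟨x, by ring⟩
      · rintro ⟨x, rfl⟩
        exact ⟨Units.mk0 x (left_ne_zero_of_mul hy), by simp [sq]⟩
    have hpm : φ y = 1 ∨ φ y = -1 := by
      rw [← sq_eq_one_iff, sq, ← MulChar.mul_apply, MulChar.mul_self_eq_one hφ,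
        MulChar.one_apply (isUnit_iff_ne_zero.mpr hy)]
    rcases quadraticChar_dichotomy hy with h | h
    · rw [hiff.mpr h, h]; simp
    · rcases hpm with h' | h'
      · rw [hiff.mp h'] at h; norm_num at h
      · rw [h, h']; simp
  rw [hval]
  push_cast at hcast
  rw [hcast]
  ring

theorem sum_comp_sq {φ : MulChar F ℂ} (hφ : orderOf φ = 2) (h : F → ℂ) :
    ∑ d, h (d ^ 2) = ∑ y, (1 + φ y) * h y := by
  classical
  rw [← Finset.sum_fiberwise (s := Finset.univ) (g := fun d : F => d ^ 2)]
  refine Finset.sum_congr rfl fun y _ => ?_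
  rw [← MulChar.card_sqrts hφ, ← nsmul_eq_mul, ← Finset.sum_const]
  exact Finset.sum_congr rfl fun i hi => by rw [(Finset.mem_filter.mp hi).2]

theorem sum_apply_sub_eq_zero {C : MulChar F ℂ} (hC : C ≠ 1) (x : F) : ∑ y, C (x - y) = 0 := by
  rw [← MulChar.sum_eq_zero_of_ne_one hC]
  exact (Equiv.subLeft x).sum_comp C

/-- With `x = (1 + y)/2` the product `x (1 - x)` becomes `(1 - y²)/4`, a function of `y²`. -/
theorem jacobiSum_self {φ C : MulChar F ℂ} (hφ : orderOf φ = 2) (hC : C ≠ 1) :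
    jacobiSum C C = C⁻¹ 4 * jacobiSum φ C := by
  have h2 := MulChar.two_ne_zero hφ
  have h4 : (4 : F) ≠ 0 := by rw [show (4 : F) = 2 * 2 by norm_num]; exact mul_ne_zero h2 h2
  rw [jacobiSum, ← sum_affine (inv_ne_zero h2) 2⁻¹]
  have : ∀ x : F, C (2⁻¹ * x + 2⁻¹) * C (1 - (2⁻¹ * x + 2⁻¹)) =
      (fun y => C⁻¹ 4 * C (1 - y)) (x ^ 2) := by
    intro x
    dsimp only
    rw [MulChar.inv_apply', ← map_mul, ← map_mul]
    congr 1
    rw [show (4 : F) = 2 * 2 by norm_num]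
    field_simp
    ring
  rw [Finset.sum_congr rfl fun x _ => this x, sum_comp_sq hφ (fun y => C⁻¹ 4 * C (1 - y)),
    jacobiSum, Finset.mul_sum]
  simp only [add_mul, one_mul, Finset.sum_add_distrib]
  rw [← Finset.mul_sum, sum_apply_sub_eq_zero hC, mul_zero, zero_add]
  exact Finset.sum_congr rfl fun y _ => by ring

open Classical in
/-- The parametrization of the hyperbola `n² - d² = 1`. -/
theorem sum_add_inv {φ : MulChar F ℂ} (hφ : orderOf φ = 2) (f : F → ℂ) :
    ∑ ν ∈ Finset.univ.erase (0 : F), f (ν + ν⁻¹) = ∑ n, (1 + φ (n ^ 2 - 1)) * f (2 * n) := by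
  have h2 := MulChar.two_ne_zero hφ
  have h1 : ∑ n : F, (1 + φ (n ^ 2 - 1)) * f (2 * n) =
      ∑ x ∈ Finset.univ.filter (fun x : F × F => x.2 ^ 2 = x.1 ^ 2 - 1), f (2 * x.1) := by
    rw [Finset.sum_filter, Fintype.sum_prod_type]
    refine Finset.sum_congr rfl fun n _ => ?_
    rw [← MulChar.card_sqrts hφ, ← nsmul_eq_mul, ← Finset.sum_const, Finset.sum_filter]
  rw [h1]
  refine Finset.sum_bij' (fun ν _ => ((ν + ν⁻¹) / 2, (ν - ν⁻¹) / 2)) (fun x _ => x.1 + x.2)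
    ?_ ?_ ?_ ?_ ?_
  · intro ν hν
    have hν : ν ≠ 0 := by simpa using hν
    simp only [Finset.mem_filter, Finset.mem_univ, true_and]
    field_simp
    ring
  · intro x hx
    simp only [Finset.mem_filter, Finset.mem_univ, true_and] at hx
    simp only [Finset.mem_erase, Finset.mem_univ, and_true]
    intro h0
    have : x.1 ^ 2 - x.2 ^ 2 = (x.1 + x.2) * (x.1 - x.2) := by ring
    rw [h0, hx] at this
    simp at this
  · intro ν hν
    ring_nf
    field_simp
  · intro x hx
    simp only [Finset.mem_filter, Finset.mem_univ, true_and] at hx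
    have hinv : (x.1 + x.2)⁻¹ = x.1 - x.2 := by
      refine inv_eq_of_mul_eq_one_right ?_
      have : x.1 ^ 2 - x.2 ^ 2 = (x.1 + x.2) * (x.1 - x.2) := by ring
      rw [← this, hx]
      ring
    ext <;> simp only [hinv] <;> field_simp <;> ring
  · intro ν hν
    simp only
    congr 1
    field_simp

end QuadraticTransformations

/-! ### Closed evaluations: Whipple's summation and the Selberg type sum. -/

section Evaluations

theorem four_ne_zero_of_two_ne_zero {F : Type*} [Field F] (h : (2 : F) ≠ 0) : (4 : F) ≠ 0 := by
  rw [show (4 : F) = 2 * 2 by norm_num]; exact mul_ne_zero h h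

variable {F : Type*} [Field F] [Fintype F] {φ : MulChar F ℂ}

/-- The substitution `b = 1/(1 - s)`, `a = 1 - s/τ` makes `b (1 - a)/(1 - b) = -1/τ`. The three
factors in `A` collapse to `A⁻¹ τ`, and only the quadratic character still depends on `s`. -/
theorem pairSum_wellPoised_change {A : MulChar F ℂ} (hA1 : A (-1) = 1) (hφ : orderOf φ = 2) :
    pairSum φ A A A⁻¹ φ =
      ∑ τ, A⁻¹ τ * ∑ s, φ (s * (s - 1 - τ) * ((s - 1) * (s - τ))) := by
  have hR : ∑ τ, A⁻¹ τ * ∑ s, φ (s * (s - 1 - τ) * ((s - 1) * (s - τ))) =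
      ∑ s, ∑ τ, A⁻¹ τ * φ (s * (s - 1 - τ) * ((s - 1) * (s - τ))) := by
    rw [Finset.sum_comm]
    exact Finset.sum_congr rfl fun τ _ => Finset.mul_sum _ _ _
  rw [hR, pairSum, Finset.sum_comm,
    ← Equiv.sum_comp ((Equiv.subLeft (1 : F)).trans (Equiv.inv F))]
  refine Finset.sum_congr rfl fun s _ => ?_
  simp only [Equiv.trans_apply, Equiv.subLeft_apply, Equiv.inv_apply]
  by_cases hs : s = 0
  · simp [hs, MulChar.map_zero]
  by_cases hs1 : s = 1
  · simp [hs1, MulChar.map_zero]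
  have hs1' : 1 - s ≠ 0 := sub_ne_zero.mpr (Ne.symm hs1)
  rw [← sum_affine (neg_ne_zero.mpr hs) 1, ← Equiv.sum_comp (Equiv.inv F)]
  refine Finset.sum_congr rfl fun τ _ => ?_
  simp only [Equiv.inv_apply]
  by_cases hτ : τ = 0
  · simp [hτ, MulChar.map_zero]
  have e1 : A (1 - s)⁻¹ * A (1 - (-s * τ⁻¹ + 1)) * A⁻¹ (1 - (1 - s)⁻¹) = A⁻¹ τ := by
    rw [MulChar.inv_apply', MulChar.inv_apply', ← map_mul, ← map_mul, ← one_mul (A τ⁻¹), ← hA1,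
      ← map_mul]
    congr 1
    have : 1 - (1 - s)⁻¹ = -s / (1 - s) := by field_simp; ring
    rw [this]
    field_simp
    ring
  have e2 : φ (-s * τ⁻¹ + 1) * φ (-s * τ⁻¹ + 1 - (1 - s)⁻¹) =
      φ (s * (s - 1 - τ) * ((s - 1) * (s - τ))) := by
    have : s * (s - 1 - τ) * ((s - 1) * (s - τ)) =
        (-s * τ⁻¹ + 1) * (-s * τ⁻¹ + 1 - (1 - s)⁻¹) * (τ * (1 - s)) ^ 2 := by
      field_simp
      ring
    rw [this, map_mul φ (_ * _) (_ ^ 2), map_mul, MulChar.apply_sq hφ (mul_ne_zero hτ hs1'),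
      mul_one]
  rw [← e1, ← e2]
  ring

theorem sum_quadratic_mul_sub (hφ : orderOf φ = 2) (hneg : φ (-1) = 1) {x z : F} (h : x ≠ z) :
    ∑ y, φ (y - x) * φ (y - z) = -1 := by
  have hzx : z - x ≠ 0 := sub_ne_zero.mpr h.symm
  rw [← sum_affine hzx x]
  have h1 : ∀ y, φ ((z - x) * y + x - x) * φ ((z - x) * y + x - z) = φ y * φ (1 - y) := by
    intro y
    have e1 : (z - x) * y + x - x = (z - x) * y := by ring
    have e2 : (z - x) * y + x - z = (z - x) * (y - 1) := by ring
    rw [e1, e2, map_mul, map_mul, MulChar.apply_sub_comm hneg y 1]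
    have := MulChar.apply_sq hφ hzx
    rw [map_pow] at this
    linear_combination (φ y * φ (1 - y)) * this
  rw [Finset.sum_congr rfl fun y _ => h1 y]
  have hne : φ ≠ 1 := by rintro rfl; simp at hφ
  have := jacobiSum_nontrivial_inv hne
  rw [MulChar.inv_eq_self hφ, hneg] at this
  exact this

open Classical in
/-- A quartic with roots symmetric about `(1 + τ) / 2`. -/
theorem sum_symmetric_quartic (hφ : orderOf φ = 2) (hneg : φ (-1) = 1) {τ : F} (hτ : τ ≠ 0) :
    ∑ s, φ (s * (s - 1 - τ) * ((s - 1) * (s - τ))) =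
      -1 + φ τ * ∑ ν ∈ Finset.univ.erase (0 : F), φ (ν + ν⁻¹ + (τ + τ⁻¹)) := by
  have h2 := MulChar.two_ne_zero hφ
  have h4 := four_ne_zero_of_two_ne_zero h2
  have hc : ∀ d : F, φ ((2⁻¹ * d + (1 + τ) / 2) * ((2⁻¹ * d + (1 + τ) / 2) - 1 - τ) *
      (((2⁻¹ * d + (1 + τ) / 2) - 1) * ((2⁻¹ * d + (1 + τ) / 2) - τ))) =
      φ (d ^ 2 - (1 + τ) ^ 2) * φ (d ^ 2 - (1 - τ) ^ 2) := by
    intro d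
    rw [← map_mul]
    have : (d ^ 2 - (1 + τ) ^ 2) * (d ^ 2 - (1 - τ) ^ 2) =
        ((2⁻¹ * d + (1 + τ) / 2) * ((2⁻¹ * d + (1 + τ) / 2) - 1 - τ) *
      (((2⁻¹ * d + (1 + τ) / 2) - 1) * ((2⁻¹ * d + (1 + τ) / 2) - τ))) * 4 ^ 2 := by
      field_simp
      ring
    rw [this, map_mul φ _ (4 ^ 2), MulChar.apply_sq hφ h4, mul_one]
  -- Centring at `(1 + τ)/2` makes the quartic a quadratic in `d²`. The part without `φ y` sums to
  -- `-1`; the cubic part is matched with the sum over the hyperbola.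
  rw [← sum_affine (inv_ne_zero h2) ((1 + τ) / 2), Finset.sum_congr rfl fun d _ => hc d,
    sum_comp_sq hφ (fun y => φ (y - (1 + τ) ^ 2) * φ (y - (1 - τ) ^ 2))]
  simp only [add_mul, one_mul, Finset.sum_add_distrib]
  rw [sum_quadratic_mul_sub hφ hneg]
  swap
  · intro h
    have : (4 : F) * τ = 0 := by linear_combination h
    exact mul_ne_zero h4 hτ this
  congr 1
  rw [sum_add_inv hφ (fun n => φ (n + (τ + τ⁻¹)))]
  simp only [add_mul, one_mul, Finset.sum_add_distrib]
  have h0 : ∑ n, φ (2 * n + (τ + τ⁻¹)) = 0 := by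
    rw [sum_affine h2 (τ + τ⁻¹) φ]
    exact MulChar.sum_eq_zero_of_ne_one (by rintro rfl; simp at hφ)
  rw [h0, zero_add, ← sum_affine (mul_ne_zero h2 hτ) (1 + τ ^ 2), Finset.mul_sum]
  refine Finset.sum_congr rfl fun n _ => ?_
  rw [← map_mul, ← map_mul, ← map_mul, ← map_mul]
  have : (2 * τ * n + (1 + τ ^ 2)) * ((2 * τ * n + (1 + τ ^ 2) - (1 + τ) ^ 2) *
      (2 * τ * n + (1 + τ ^ 2) - (1 - τ) ^ 2)) =
      (τ * ((n ^ 2 - 1) * (2 * n + (τ + τ⁻¹)))) * (2 * τ) ^ 2 := by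
    field_simp
    ring
  rw [this, map_mul φ _ ((2 * τ) ^ 2), MulChar.apply_sq hφ (mul_ne_zero h2 hτ), mul_one]

theorem sum_mul_apply_one_add (C φ : MulChar F ℂ) :
    ∑ α, C α * φ (1 + α) = C (-1) * jacobiSum C φ := by
  rw [jacobiSum, Finset.mul_sum, ← Equiv.sum_comp (Equiv.neg F)]
  refine Finset.sum_congr rfl fun α _ => ?_
  rw [Equiv.neg_apply, ← sub_eq_add_neg, neg_eq_neg_one_mul, map_mul, mul_assoc]

/-- A finite field analogue of Whipple's summation, in which `K` and `M` are square roots of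
`A⁻¹ φ` and of `φ`. -/
theorem pairSum_wellPoised {A K M : MulChar F ℂ} (hA : A ≠ 1) (hA1 : A (-1) = 1)
    (hφ : orderOf φ = 2) (hneg : φ (-1) = 1) (hK : K ^ 2 = A⁻¹ * φ) (hM : M ^ 2 = φ) :
    pairSum φ A A A⁻¹ φ =
      jacobiSum (K * M) φ * jacobiSum (K⁻¹ * M) φ +
        jacobiSum (K * M * φ) φ * jacobiSum (K⁻¹ * M * φ) φ := by
  classical
  have hφ1 : φ ≠ 1 := by rintro rfl; simp at hφ
  have hK' : ∀ τ, K (τ ^ 2) = A⁻¹ τ * φ τ := fun τ => by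
    rw [map_pow, ← MulChar.pow_apply' K (by norm_num), hK, MulChar.mul_apply]
  have hM' : ∀ τ, M (τ ^ 2) = φ τ := fun τ => by
    rw [map_pow, ← MulChar.pow_apply' M (by norm_num), hM]
  -- With `ν = τ β` all dependence on `τ`, apart from the term `-A⁻¹ τ` that sums to zero, is
  -- through `τ²`; the square roots `K` and `M` make this visible.
  have step1 : ∀ τ, A⁻¹ τ * ∑ s, φ (s * (s - 1 - τ) * ((s - 1) * (s - τ))) =
      -A⁻¹ τ + ∑ β, φ β * φ (1 + β) * ((K * M) (τ ^ 2) * φ (1 + β * τ ^ 2)) := by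
    intro τ
    by_cases hτ : τ = 0
    · simp [hτ, MulChar.map_zero]
    rw [sum_symmetric_quartic hφ hneg hτ, mul_add, mul_neg_one, ← mul_assoc, ← hK']
    congr 1
    have h1 : ∑ ν ∈ Finset.univ.erase (0 : F), φ (ν + ν⁻¹ + (τ + τ⁻¹)) =
        ∑ ν, φ ν * φ (1 + ν * τ) * φ (1 + ν / τ) := by
      rw [← Finset.add_sum_erase Finset.univ _ (Finset.mem_univ (0 : F)), MulChar.map_zero,
        zero_mul, zero_mul, zero_add]
      refine Finset.sum_congr rfl fun ν hν => ?_
      have hν : ν ≠ 0 := by simpa using hν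
      rw [← map_mul, ← map_mul]
      have : ν * (1 + ν * τ) * (1 + ν / τ) = (ν + ν⁻¹ + (τ + τ⁻¹)) * ν ^ 2 := by
        field_simp
        ring
      rw [this, map_mul φ _ (ν ^ 2), MulChar.apply_sq hφ hν, mul_one]
    rw [h1, ← sum_mul_left hτ, Finset.mul_sum]
    refine Finset.sum_congr rfl fun β _ => ?_
    rw [MulChar.mul_apply, hM', map_mul, mul_div_cancel_left₀ _ hτ,
      show τ * β * τ = β * τ ^ 2 by ring]
    ring
  have step2 : ∀ β, ∑ τ, (K * M) (τ ^ 2) * φ (1 + β * τ ^ 2) =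
      ∑ y, (1 + φ y) * ((K * M) y * φ (1 + β * y)) := fun β =>
    sum_comp_sq hφ (fun y => (K * M) y * φ (1 + β * y))
  -- Setting `y = α/β` separates the variables, leaving products of Jacobi sums.
  have step3 : ∀ β, φ β * φ (1 + β) * ∑ y, (1 + φ y) * ((K * M) y * φ (1 + β * y)) =
      (K⁻¹ * M) β * φ (1 + β) * ∑ α, (K * M) α * φ (1 + α) +
        (K⁻¹ * M * φ) β * φ (1 + β) * ∑ α, (K * M * φ) α * φ (1 + α) := by
    intro β
    by_cases hβ : β = 0
    · simp [hβ, MulChar.map_zero]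
    rw [← sum_mul_left (inv_ne_zero hβ), Finset.mul_sum, Finset.mul_sum, Finset.mul_sum,
      ← Finset.sum_add_distrib]
    refine Finset.sum_congr rfl fun α _ => ?_
    have hMβ : φ β = M β * M β := by rw [← hM' β, sq, map_mul]
    have hMM : M β * M⁻¹ β = 1 := MulChar.apply_mul_inv_self M hβ
    rw [mul_inv_cancel_left₀ hβ]
    simp only [map_mul, MulChar.mul_apply, mul_inv, ← MulChar.inv_apply', MulChar.inv_eq_self hφ]
    rw [hMβ]
    linear_combination (M β * φ (1 + β) * φ (1 + α) * K⁻¹ β * K α * M α *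
      (1 + M β * M β * φ α)) * hMM
  have hsum : ∑ τ, A⁻¹ τ = 0 := MulChar.sum_eq_zero_of_ne_one (inv_ne_one.mpr hA)
  rw [pairSum_wellPoised_change hA1 hφ, Finset.sum_congr rfl fun τ _ => step1 τ,
    Finset.sum_add_distrib, Finset.sum_neg_distrib, hsum, neg_zero, zero_add, Finset.sum_comm]
  simp only [← Finset.mul_sum]
  simp only [step2, step3]
  rw [Finset.sum_add_distrib, ← Finset.sum_mul, ← Finset.sum_mul, sum_mul_apply_one_add,
    sum_mul_apply_one_add, sum_mul_apply_one_add, sum_mul_apply_one_add]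
  have hKK : K (-1) * K⁻¹ (-1) = 1 := MulChar.apply_mul_inv_self K (by simp)
  have hMM : M (-1) * M (-1) = 1 := by
    rw [← map_mul]; simp
  simp only [MulChar.mul_apply, hneg]
  linear_combination (jacobiSum (K * M) φ * jacobiSum (K⁻¹ * M) φ +
        jacobiSum (K * M * φ) φ * jacobiSum (K⁻¹ * M * φ) φ) * (M (-1) * M (-1) * hKK + hMM)

/-- The triple Jacobi sum. -/
theorem sum_sum_jacobi {A B : MulChar F ℂ} (hAB : A * B ≠ 1) (C : MulChar F ℂ) :
    ∑ α, ∑ β, A α * B β * C (1 - α - β) = jacobiSum A B * jacobiSum (A * B) C := by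
  have h1 : ∑ α, ∑ β, A α * B β * C (1 - α - β) = ∑ σ, (∑ α, A α * B (σ - α)) * C (1 - σ) := by
    simp only [Finset.sum_mul]
    rw [Finset.sum_comm (s := Finset.univ) (t := Finset.univ)
      (f := fun σ α => A α * B (σ - α) * C (1 - σ))]
    refine Finset.sum_congr rfl fun α _ => ?_
    rw [← Equiv.sum_comp (Equiv.subRight α)]
    refine Finset.sum_congr rfl fun σ _ => ?_
    rw [Equiv.subRight_apply]
    congr 2
    ring
  have h2 : ∀ σ, ∑ α, A α * B (σ - α) = (A * B) σ * jacobiSum A B := by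
    intro σ
    by_cases hσ : σ = 0
    · subst hσ
      have : ∀ α, A α * B (0 - α) = B (-1) * (A * B) α := fun α => by
        rw [zero_sub, neg_eq_neg_one_mul, map_mul, MulChar.mul_apply]; ring
      rw [Finset.sum_congr rfl fun α _ => this α, ← Finset.mul_sum,
        MulChar.sum_eq_zero_of_ne_one hAB, MulChar.map_zero, mul_zero, zero_mul]
    · rw [← sum_mul_left hσ, jacobiSum, Finset.mul_sum]
      refine Finset.sum_congr rfl fun α _ => ?_
      rw [show σ - σ * α = σ * (1 - α) by ring, map_mul, map_mul, MulChar.mul_apply]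
      ring
  rw [h1, jacobiSum.eq_def (A * B) C, Finset.mul_sum]
  refine Finset.sum_congr rfl fun σ _ => ?_
  rw [h2]
  ring

/-- The Selberg type sum over monic quadratic polynomials with discriminant `D` and trace `s`. -/
noncomputable def selbergSum (A B η : MulChar F ℂ) : ℂ :=
  ∑ s, ∑ D, A ((s ^ 2 - D) / 4) * B (((s - 2) ^ 2 - D) / 4) * η D

/-- Regard `a, b` as the ordered roots of a monic quadratic with trace `s` and discriminant `D = (a
- b)²`. Its values at 0 and 1 are the arguments of `A` and `B`, and `1 + φ D` counts the orderings.
-/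
theorem pairSum_eq_selbergSum (hφ : orderOf φ = 2) (A B η : MulChar F ℂ) :
    pairSum A A B B (η ^ 2) = selbergSum A B η + selbergSum A B (η * φ) := by
  have h2 := MulChar.two_ne_zero hφ
  have h4 := four_ne_zero_of_two_ne_zero h2
  have h1 : pairSum A A B B (η ^ 2) =
      ∑ s, ∑ a, A a * A (s - a) * B (1 - a) * B (1 - (s - a)) * (η ^ 2) (a - (s - a)) := by
    rw [pairSum, Finset.sum_comm (s := Finset.univ) (t := Finset.univ) (f := fun s a =>
      A a * A (s - a) * B (1 - a) * B (1 - (s - a)) * (η ^ 2) (a - (s - a)))]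
    exact Finset.sum_congr rfl fun a _ => (Equiv.sum_comp (Equiv.subRight a) _).symm
  rw [h1, selbergSum, selbergSum, ← Finset.sum_add_distrib]
  refine Finset.sum_congr rfl fun s _ => ?_
  rw [← sum_affine (inv_ne_zero h2) (s / 2), ← Finset.sum_add_distrib]
  have h3 : ∀ d, A (2⁻¹ * d + s / 2) * A (s - (2⁻¹ * d + s / 2)) * B (1 - (2⁻¹ * d + s / 2)) *
      B (1 - (s - (2⁻¹ * d + s / 2))) * (η ^ 2) (2⁻¹ * d + s / 2 - (s - (2⁻¹ * d + s / 2))) =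
      (fun D => A ((s ^ 2 - D) / 4) * B (((s - 2) ^ 2 - D) / 4) * η D) (d ^ 2) := by
    intro d
    dsimp only
    rw [MulChar.pow_apply' η (by norm_num), ← map_pow, ← map_mul, mul_assoc (A _) (B _) (B _),
      ← map_mul]
    congr 2
    · congr 1
      rw [show (4 : F) = 2 * 2 by norm_num]
      field_simp
      ring
    · congr 1
      rw [show (4 : F) = 2 * 2 by norm_num]
      field_simp
      ring
    · field_simp
      ring
  rw [Finset.sum_congr rfl fun d _ => h3 d,
    sum_comp_sq hφ (fun D => A ((s ^ 2 - D) / 4) * B (((s - 2) ^ 2 - D) / 4) * η D)]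
  refine Finset.sum_congr rfl fun D _ => ?_
  rw [MulChar.mul_apply]
  ring

theorem sum_apply_sq_sub (hφ : orderOf φ = 2) {C : MulChar F ℂ} (hC : C ^ 2 ≠ 1) (D : F) :
    ∑ x, C (x ^ 2 - D) = C (-1) * jacobiSum φ C * (C * φ) D := by
  have hC1 : C ≠ 1 := by rintro rfl; simp at hC
  by_cases hD : D = 0
  · subst hD
    simp only [sub_zero, map_pow, MulChar.map_zero, mul_zero, ← MulChar.pow_apply' C two_ne_zero]
    exact MulChar.sum_eq_zero_of_ne_one hC
  rw [sum_comp_sq hφ (fun y => C (y - D))]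
  simp only [add_mul, one_mul, Finset.sum_add_distrib]
  have h0 : ∑ y, C (y - D) = 0 := by
    rw [← MulChar.sum_eq_zero_of_ne_one hC1]
    exact Equiv.sum_comp (Equiv.subRight D) C
  rw [h0, zero_add, ← sum_mul_left hD, jacobiSum, Finset.mul_sum, Finset.sum_mul]
  refine Finset.sum_congr rfl fun z _ => ?_
  rw [show D * z - D = D * (-1 * (1 - z)) by ring, map_mul, map_mul, map_mul, MulChar.mul_apply]
  ring

/-- Anderson's evaluation of the Selberg type sum. -/
theorem selbergSum_eval (hφ : orderOf φ = 2) {A B C : MulChar F ℂ} (hA : A ≠ 1) (hB : B ≠ 1)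
    (hAB : A * B ≠ 1) (hC : C ^ 2 ≠ 1) :
    jacobiSum φ C * selbergSum A B (C * φ) =
      C 4 * jacobiSum (A * C) (B * C) * (jacobiSum A B * jacobiSum (A * B) C) := by
  have h2 := MulChar.two_ne_zero hφ
  have h4 := four_ne_zero_of_two_ne_zero h2
  have hCneg : C (-1) ≠ 0 := by
    intro h
    have := MulChar.apply_mul_inv_self C (x := -1) (by simp)
    rw [h, zero_mul] at this
    exact zero_ne_one this
  -- By `sum_apply_sq_sub`, the factor `(C * φ) D` is traded for a sum over a new point `t` of `C`
  -- at four times the quadratic's value there. The quadratic is then parametrised by its values `P`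
  -- at 0 and `Q` at 1.
  have step1 : C (-1) * jacobiSum φ C * selbergSum A B (C * φ) =
      ∑ t, ∑ P, ∑ Q, A P * B Q * C (4 * (t ^ 2 - t * (1 + P - Q) + P)) := by
    have e1 : C (-1) * jacobiSum φ C * selbergSum A B (C * φ) = ∑ s, ∑ D, ∑ t,
        A ((s ^ 2 - D) / 4) * B (((s - 2) ^ 2 - D) / 4) * C ((2 * t + -s) ^ 2 - D) := by
      rw [selbergSum, Finset.mul_sum]
      refine Finset.sum_congr rfl fun s _ => ?_
      rw [Finset.mul_sum]
      refine Finset.sum_congr rfl fun D _ => ?_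
      rw [← Finset.mul_sum, sum_affine h2 (-s) (fun x => C (x ^ 2 - D)), sum_apply_sq_sub hφ hC]
      ring
    have e2 : ∀ s, ∑ D, ∑ t,
        A ((s ^ 2 - D) / 4) * B (((s - 2) ^ 2 - D) / 4) * C ((2 * t + -s) ^ 2 - D) =
        ∑ P, ∑ t, A P * B (1 - s + P) * C (4 * (t ^ 2 - t * s + P)) := by
      intro s
      rw [← sum_affine (neg_ne_zero.mpr h4) (s ^ 2)]
      refine Finset.sum_congr rfl fun P _ => Finset.sum_congr rfl fun t _ => ?_
      have e3 : (s ^ 2 - (-4 * P + s ^ 2)) / 4 = P := by field_simp; ring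
      have e4 : ((s - 2) ^ 2 - (-4 * P + s ^ 2)) / 4 = 1 - s + P := by field_simp; ring
      have e5 : (2 * t + -s) ^ 2 - (-4 * P + s ^ 2) = 4 * (t ^ 2 - t * s + P) := by ring
      rw [e3, e4, e5]
    rw [e1, Finset.sum_congr rfl fun s _ => e2 s, Finset.sum_comm]
    have e3 : ∀ P, ∑ s, ∑ t, A P * B (1 - s + P) * C (4 * (t ^ 2 - t * s + P)) =
        ∑ Q, ∑ t, A P * B Q * C (4 * (t ^ 2 - t * (1 + P - Q) + P)) := by
      intro P
      rw [← Equiv.sum_comp (Equiv.subLeft (1 + P))]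
      refine Finset.sum_congr rfl fun Q _ => Finset.sum_congr rfl fun t _ => ?_
      rw [Equiv.subLeft_apply]
      congr 3
      ring
    rw [Finset.sum_congr rfl fun P _ => e3 P]
    rw [Finset.sum_comm (s := Finset.univ) (t := Finset.univ) (f := fun t P =>
      ∑ Q, A P * B Q * C (4 * (t ^ 2 - t * (1 + P - Q) + P)))]
    exact Finset.sum_congr rfl fun P _ => Finset.sum_comm
  have step2 : ∀ t, ∑ P, ∑ Q, A P * B Q * C (4 * (t ^ 2 - t * (1 + P - Q) + P)) =
      C 4 * C (-1) * ((A * C) t * (B * C) (1 - t)) * (jacobiSum A B * jacobiSum (A * B) C) := by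
    intro t
    by_cases ht : t = 0
    · subst ht
      rw [MulChar.map_zero, zero_mul, mul_zero, zero_mul]
      refine Finset.sum_eq_zero fun P _ => ?_
      have : ∀ Q, A P * B Q * C (4 * (0 ^ 2 - 0 * (1 + P - Q) + P)) = A P * C (4 * P) * B Q :=
        fun Q => by ring_nf
      rw [Finset.sum_congr rfl fun Q _ => this Q, ← Finset.mul_sum,
        MulChar.sum_eq_zero_of_ne_one hB, mul_zero]
    by_cases ht1 : 1 - t = 0
    · obtain rfl : t = 1 := (sub_eq_zero.mp ht1).symm
      rw [sub_self, MulChar.map_zero, mul_zero, mul_zero, zero_mul, Finset.sum_comm]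
      refine Finset.sum_eq_zero fun Q _ => ?_
      have : ∀ P, A P * B Q * C (4 * (1 ^ 2 - 1 * (1 + P - Q) + P)) = B Q * C (4 * Q) * A P :=
        fun P => by ring_nf
      rw [Finset.sum_congr rfl fun Q _ => this Q, ← Finset.mul_sum,
        MulChar.sum_eq_zero_of_ne_one hA, mul_zero]
    -- With `P = t α` and `Q = (1 - t) β` the value at `t` is `-t (1 - t)(1 - α - β)`, so the sum
    -- over `t` splits off.
    rw [← sum_sum_jacobi hAB, ← sum_mul_left ht, Finset.mul_sum]
    refine Finset.sum_congr rfl fun α _ => ?_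
    rw [← sum_mul_left ht1, Finset.mul_sum]
    refine Finset.sum_congr rfl fun β _ => ?_
    have : 4 * (t ^ 2 - t * (1 + t * α - (1 - t) * β) + t * α) =
        4 * (-1 * (t * ((1 - t) * (1 - α - β)))) := by ring
    rw [this]
    simp only [map_mul, MulChar.mul_apply]
    ring
  have step3 : C (-1) * (jacobiSum φ C * selbergSum A B (C * φ)) =
      C (-1) * (C 4 * jacobiSum (A * C) (B * C) * (jacobiSum A B * jacobiSum (A * B) C)) := by
    rw [← mul_assoc, step1, Finset.sum_congr rfl fun t _ => step2 t, ← Finset.sum_mul,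
      ← Finset.mul_sum]
    rw [jacobiSum.eq_def (A * C)]
    ring
  exact mul_left_cancel₀ hCneg step3

end Evaluations

/-! ### Hypergeometric values as double character sums. -/

section Hypergeometric

variable {F : Type*} [Field F] [Fintype F]

open Classical in
theorem MulChar.sum_apply_eq_ite [Fintype (MulChar F ℂ)] (a : F) :
    ∑ χ : MulChar F ℂ, χ a = if a = 1 then (Fintype.card F : ℂ) - 1 else 0 := by
  split_ifs with ha
  · have h := MulChar.card_eq_card_units_of_hasEnoughRootsOfUnity F ℂ
    rw [Nat.card_eq_fintype_card, Nat.card_eq_fintype_card, Fintype.card_units] at h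
    simp only [ha, map_one, Finset.sum_const, Finset.card_univ, nsmul_eq_mul, mul_one]
    rw [h, Nat.cast_sub Fintype.card_pos, Nat.cast_one]
  · obtain ⟨χ, hχ⟩ := MulChar.exists_apply_ne_one_of_hasEnoughRootsOfUnity F ℂ ha
    refine eq_zero_of_mul_eq_self_left hχ ?_
    simp only [Finset.mul_sum, ← MulChar.mul_apply]
    exact Fintype.sum_bijective _ (Group.mulLeft_bijective χ) _ _ fun χ' => rfl

/-- Replacing `c` by `1/c` turns `J(χ, (Aχ)⁻¹)` into `χ(-1) J(χ, A)`, and the two signs `χ(-1)`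
cancel. -/
theorem charBinom_mul_self (A χ : MulChar F ℂ) :
    charBinom (A * χ) χ = A (-1) / Fintype.card F * jacobiSum χ A := by
  have h : jacobiSum χ (A * χ)⁻¹ = χ (-1) * jacobiSum χ A := by
    rw [jacobiSum_comm, jacobiSum_comm χ A, jacobiSum, jacobiSum, Finset.mul_sum,
      ← Equiv.sum_comp (Equiv.inv F)]
    refine Finset.sum_congr rfl fun c _ => ?_
    rw [Equiv.inv_apply]
    by_cases hc : c = 0
    · simp [hc, MulChar.map_zero]
    have e : 1 - c⁻¹ = -1 * (1 - c) / c := by field_simp; ring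
    have h1 := MulChar.apply_mul_inv_self χ hc
    rw [← MulChar.inv_apply', inv_inv, e, MulChar.apply_div, map_mul, MulChar.mul_apply]
    linear_combination A c * χ (-1) * χ (1 - c) * h1
  have h1 : χ (-1) * χ (-1) = 1 := by rw [← map_mul]; simp
  rw [charBinom, h, MulChar.mul_apply]
  linear_combination (A (-1) / Fintype.card F * jacobiSum χ A) * h1

/-- The summand is a product of three Jacobi sums in variables `x, y, z`; orthogonality over `χ`
imposes `x y z = 1`, leaving a double sum. -/
theorem card_sq_mul_hypF32 {A B C : MulChar F ℂ} (hA : A (-1) = 1) (hB : B (-1) = 1)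
    (hC : C (-1) = 1) :
    (Fintype.card F : ℂ) ^ 2 * hypF32 A B C 1 1 1 = pairSum C⁻¹ B⁻¹ A B C := by
  classical
  have := Fintype.ofFinite (MulChar F ℂ)
  have hq : (Fintype.card F : ℂ) ≠ 0 := Nat.cast_ne_zero.mpr Fintype.card_ne_zero
  have hq1 : (Fintype.card F : ℂ) - 1 ≠ 0 := by
    rw [sub_ne_zero]
    exact_mod_cast (Fintype.one_lt_card (α := F)).ne'
  have key : ∑ χ : MulChar F ℂ, jacobiSum χ A * jacobiSum χ B * jacobiSum χ C =
      (Fintype.card F - 1) * pairSum C⁻¹ B⁻¹ A B C := by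
    have e1 : ∀ χ : MulChar F ℂ, jacobiSum χ A * jacobiSum χ B * jacobiSum χ C =
        ∑ x, ∑ y, ∑ z, χ (x * y * z) * (A (1 - x) * B (1 - y) * C (1 - z)) := by
      intro χ
      simp only [jacobiSum]
      rw [Finset.sum_mul_sum, Finset.sum_mul]
      refine Finset.sum_congr rfl fun x _ => ?_
      rw [Finset.sum_mul_sum]
      refine Finset.sum_congr rfl fun y _ => Finset.sum_congr rfl fun z _ => ?_
      rw [map_mul, map_mul]
      ring
    rw [Finset.sum_congr rfl fun χ _ => e1 χ, Finset.sum_comm, pairSum, Finset.mul_sum]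
    refine Finset.sum_congr rfl fun x _ => ?_
    rw [Finset.sum_comm, Finset.mul_sum, ← Equiv.sum_comp (Equiv.inv F)]
    refine Finset.sum_congr rfl fun y _ => ?_
    rw [Finset.sum_comm]
    simp only [← Finset.sum_mul, MulChar.sum_apply_eq_ite, Equiv.inv_apply]
    by_cases hx : x = 0
    · simp [hx, MulChar.map_zero]
    by_cases hy : y = 0
    · simp [hy, MulChar.map_zero]
    have e2 : ∀ z, x * y⁻¹ * z = 1 ↔ z = y / x := fun z => by
      field_simp
    simp only [e2, ite_mul, zero_mul, Finset.sum_ite_eq', Finset.mem_univ, if_true]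
    have e3 : 1 - y / x = (x - y) / x := by field_simp
    have e4 : 1 - y⁻¹ = (y - 1) / y := by field_simp
    rw [e3, e4, MulChar.apply_div, MulChar.apply_div, MulChar.apply_sub_comm hB y 1]
    ring
  have hsum : ∑ χ : MulChar F ℂ, charBinom (A * χ) χ * charBinom (B * χ) (1 * χ) *
      charBinom (C * χ) (1 * χ) * χ 1 =
      ((Fintype.card F - 1) * pairSum C⁻¹ B⁻¹ A B C) / (Fintype.card F : ℂ) ^ 3 := by
    rw [← key, Finset.sum_div]
    refine Finset.sum_congr rfl fun χ _ => ?_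
    rw [one_mul, charBinom_mul_self, charBinom_mul_self, charBinom_mul_self, hA, hB, hC, map_one]
    field_simp
  rw [hypF32, finsum_eq_sum_of_fintype, hsum]
  field_simp

end Hypergeometric

/-! ### Relations between octic Jacobi sums; the remaining representatives for `k = 2, 4`. -/

section JacobiRelations

variable {F : Type*} [Field F] {θ : MulChar F ℂ}

theorem pow_eight_reduce (hθ : orderOf θ = 8) (n m : ℕ) (h : n % 8 = m % 8 := by norm_num) :
    θ ^ n = θ ^ m := by
  rw [← pow_mod_orderOf θ n, ← pow_mod_orderOf θ m, hθ, h]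

theorem orderOf_pow_odd_of_eight (hθ : orderOf θ = 8) {n : ℕ} (hn : Nat.Coprime 8 n) :
    orderOf (θ ^ n) = 8 := by
  rw [Nat.Coprime.orderOf_pow (by rwa [hθ]), hθ]

theorem orderOf_pow_four_of_eight (hθ : orderOf θ = 8) : orderOf (θ ^ 4) = 2 := by
  rw [orderOf_pow_of_dvd (by norm_num) (by rw [hθ]; norm_num), hθ]

theorem MulChar.pow_even_apply_neg_one (θ : MulChar F ℂ) {n : ℕ} (hn : n ≠ 0) :
    (θ ^ (2 * n)) (-1) = 1 := by
  rw [MulChar.pow_apply' θ (by omega), ← map_pow, pow_mul]; simp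

variable [Fintype F]

theorem sum_sum_jacobi_swap (A B C : MulChar F ℂ) :
    ∑ α, ∑ β, A α * B β * C (1 - α - β) = ∑ α, ∑ β, C α * B β * A (1 - α - β) := by
  rw [Finset.sum_comm, Finset.sum_comm (s := Finset.univ) (t := Finset.univ)
    (f := fun α β => C α * B β * A (1 - α - β))]
  refine Finset.sum_congr rfl fun β _ => ?_
  rw [← Equiv.sum_comp (Equiv.subLeft (1 - β))]
  refine Finset.sum_congr rfl fun α _ => ?_
  rw [Equiv.subLeft_apply, show 1 - (1 - β - α) - β = α by ring, show 1 - β - α = 1 - α - β by ring]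
  ring

/-- The triple Jacobi sum of `θ, θ⁴, θ³` is symmetric. Evaluated in two ways, its second factors are
Jacobi sums of inverse characters, both equal to `-θ(-1)`. -/
theorem jacobiSum_octic (hθ : orderOf θ = 8) :
    jacobiSum (θ ^ 3) (θ ^ 4) = jacobiSum θ (θ ^ 4) := by
  have h8 : θ ^ 8 = 1 := hθ ▸ pow_orderOf_eq_one θ
  have h1 := sum_sum_jacobi (A := θ) (B := θ ^ 4)
    (by rw [← pow_succ']; exact pow_ne_one_of_lt_orderOf (by norm_num) (by rw [hθ]; norm_num))
    (θ ^ 3)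
  have h2 := sum_sum_jacobi (A := θ ^ 3) (B := θ ^ 4)
    (by rw [← pow_add]; exact pow_ne_one_of_lt_orderOf (by norm_num) (by rw [hθ]; norm_num)) θ
  rw [sum_sum_jacobi_swap, h2] at h1
  have e1 : θ ^ 3 * θ ^ 4 = θ⁻¹ := by
    rw [eq_inv_iff_mul_eq_one, ← pow_add, ← pow_succ, h8]
  have e2 : θ * θ ^ 4 = (θ ^ 3)⁻¹ := by
    rw [eq_inv_iff_mul_eq_one, ← pow_succ', ← pow_add, h8]
  have hneg : (θ ^ 3) (-1) = θ (-1) := by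
    have hs : θ (-1) * θ (-1) = 1 := by rw [← map_mul]; simp
    rw [MulChar.pow_apply' θ (by norm_num)]
    linear_combination θ (-1) * hs
  rw [e1, e2, jacobiSum_comm θ⁻¹, jacobiSum_comm (θ ^ 3)⁻¹,
    jacobiSum_nontrivial_inv (by rintro rfl; simp at hθ),
    jacobiSum_nontrivial_inv (pow_ne_one_of_lt_orderOf (by norm_num) (by rw [hθ]; norm_num)),
    hneg] at h1
  have hne : -θ (-1) ≠ 0 := by
    have hs : θ (-1) * θ (-1) = 1 := by rw [← map_mul]; simp
    intro h
    rw [neg_eq_zero] at h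
    rw [h, zero_mul] at hs
    exact zero_ne_one hs
  exact mul_right_cancel₀ hne h1

theorem pairSum_quadratic {χ : MulChar F ℂ} (hχ : orderOf χ = 4) :
    pairSum (χ ^ 2) (χ ^ 2) (χ ^ 2) (χ ^ 2) (χ ^ 2) =
      jacobiSum χ (χ ^ 2) ^ 2 + jacobiSum (χ ^ 3) (χ ^ 2) ^ 2 := by
  have hφ : orderOf (χ ^ 2) = 2 := by
    rw [orderOf_pow_of_dvd (by norm_num) (by rw [hχ]; norm_num), hχ]
  have hneg : (χ ^ 2) (-1) = 1 := by
    rw [MulChar.pow_apply' χ (by norm_num), ← map_pow]; simp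
  have h := pairSum_wellPoised (A := χ ^ 2) (K := 1) (M := χ)
    (pow_ne_one_of_lt_orderOf (by norm_num) (by rw [hχ]; norm_num)) hneg hφ hneg (by simp) rfl
  rw [MulChar.inv_eq_self hφ] at h
  rw [h, inv_one, one_mul, ← pow_succ']
  ring

theorem jacobiSum_octic_inv (hθ : orderOf θ = 8) :
    jacobiSum (θ ^ 5) (θ ^ 4) = jacobiSum (θ ^ 7) (θ ^ 4) := by
  have h := jacobiSum_octic (orderOf_pow_odd_of_eight hθ (n := 5) (by norm_num))
  rw [← pow_mul, ← pow_mul, pow_eight_reduce hθ (5 * 3) 7, pow_eight_reduce hθ (5 * 4) 4] at h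
  exact h.symm

theorem pairSum_quartic_mixed (hθ : orderOf θ = 8) :
    pairSum (θ ^ 4) (θ ^ 2) (θ ^ 2) (θ ^ 6) (θ ^ 4) =
      jacobiSum θ (θ ^ 4) ^ 2 + jacobiSum (θ ^ 7) (θ ^ 4) ^ 2 := by
  have h8 : θ ^ 8 = 1 := hθ ▸ pow_orderOf_eq_one θ
  have hinv : (θ ^ 2)⁻¹ = θ ^ 6 := by
    rw [inv_eq_iff_mul_eq_one, ← pow_add, h8]
  have hinv1 : θ⁻¹ = θ ^ 7 := by
    rw [inv_eq_iff_mul_eq_one, ← pow_succ', h8]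
  have h := pairSum_wellPoised (A := θ ^ 2) (K := θ) (M := θ ^ 2)
    (pow_ne_one_of_lt_orderOf (by norm_num) (by rw [hθ]; norm_num))
    (MulChar.pow_even_apply_neg_one θ one_ne_zero) (orderOf_pow_four_of_eight hθ)
    (MulChar.pow_even_apply_neg_one θ two_ne_zero)
    (by rw [hinv, ← pow_add]; exact pow_eight_reduce hθ _ _) (by rw [← pow_mul])
  rw [hinv, hinv1, ← pow_succ', ← pow_add, ← pow_add, ← pow_add, pow_eight_reduce hθ (7 + 2) 1,
    pow_eight_reduce hθ (7 + 2 + 4) 5, pow_one, jacobiSum_octic hθ, jacobiSum_octic_inv hθ] at h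
  rw [h]
  ring

theorem pairSum_quartic_self (hθ : orderOf θ = 8) (h4 : (θ ^ 2) 4 = 1) :
    pairSum (θ ^ 2) (θ ^ 2) (θ ^ 2) (θ ^ 2) (θ ^ 2) =
      jacobiSum (θ ^ 2) (θ ^ 2) * (jacobiSum θ (θ ^ 4) + jacobiSum (θ ^ 7) (θ ^ 4)) := by
  have hφ := orderOf_pow_four_of_eight hθ
  have hne : ∀ n, 0 < n ∧ n < 8 → θ ^ n ≠ 1 := fun n hn =>
    pow_ne_one_of_lt_orderOf (by omega) (by rw [hθ]; omega)
  have hq : (Fintype.card F : ℂ) ≠ 0 := Nat.cast_ne_zero.mpr Fintype.card_ne_zero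
  have hchar : ringChar ℂ ≠ ringChar F := by
    rw [ringChar.eq_zero]
    exact (CharP.ringChar_ne_zero_of_finite F).symm
  have h44 : (4 : F) ≠ 0 := four_ne_zero_of_two_ne_zero (MulChar.two_ne_zero hφ)
  -- Here `A = B = θ²`, so `A B = θ⁴` is quadratic and the factor `J(θ⁴, θⁿ)` occurs on both sides
  -- of Anderson's formula; its nonvanishing allows cancellation.
  have key : ∀ n, (θ ^ n) ^ 2 ≠ 1 → θ ^ (2 + n) ≠ 1 → θ ^ (4 + n) ≠ 1 →
      selbergSum (θ ^ 2) (θ ^ 2) (θ ^ n * θ ^ 4) =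
        jacobiSum (θ ^ 2) (θ ^ 2) * jacobiSum (θ ^ (2 + n)) (θ ^ 4) := by
    intro n hn hn2 hn4
    have h := selbergSum_eval hφ (hne 2 (by norm_num)) (hne 2 (by norm_num))
      (by rw [← pow_add]; exact hne 4 (by norm_num)) hn
    rw [← pow_add θ 2 n, ← pow_add θ 2 2, jacobiSum_self hφ hn2,
      jacobiSum_comm (θ ^ 4) (θ ^ (2 + n))] at h
    have hJ : jacobiSum (θ ^ 4) (θ ^ n) ≠ 0 := by
      have := jacobiSum_mul_jacobiSum_inv hchar (χ := θ ^ 4) (φ := θ ^ n) (hne 4 (by norm_num))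
        (by rintro h; simp [h] at hn) (by rw [← pow_add]; exact hn4)
      intro h0
      rw [h0, zero_mul] at this
      exact hq this.symm
    refine mul_left_cancel₀ hJ (h.trans ?_)
    have h1 : (θ ^ n) 4 * (θ ^ (2 + n))⁻¹ 4 = 1 := by
      have := MulChar.apply_mul_inv_self (θ ^ (2 + n)) h44
      rw [pow_add, MulChar.mul_apply, h4, one_mul] at this
      rw [pow_add]
      exact this
    linear_combination (jacobiSum (θ ^ 4) (θ ^ n) * jacobiSum (θ ^ 2) (θ ^ 2) *
      jacobiSum (θ ^ (2 + n)) (θ ^ 4)) * h1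
  have h := pairSum_eq_selbergSum hφ (θ ^ 2) (θ ^ 2) θ
  have e1 : θ = θ ^ 5 * θ ^ 4 := by
    rw [← pow_add, pow_eight_reduce hθ (5 + 4) 1, pow_one]
  have k1 := key 5 (by rw [← pow_mul, pow_eight_reduce hθ (5 * 2) 2]; exact hne 2 (by norm_num))
    (hne 7 (by norm_num)) (by rw [pow_eight_reduce hθ (4 + 5) 1]; exact hne 1 (by norm_num))
  have k2 := key 1 (by rw [← pow_mul]; exact hne 2 (by norm_num)) (hne 3 (by norm_num))
    (hne 5 (by norm_num))
  rw [← e1] at k1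
  rw [pow_one] at k2
  rw [h, k1, k2, jacobiSum_octic hθ]
  ring

end JacobiRelations

/-! ### Power sums in the field and reduction of Jacobi sums. -/

section PowerSums

variable {F : Type*} [Field F] [Fintype F]

theorem FiniteField.sum_pow_of_pos {i : ℕ} (hi : 0 < i) :
    ∑ x : F, x ^ i = if Fintype.card F - 1 ∣ i then (-1 : F) else 0 := by
  classical
  rw [← FiniteField.sum_pow_units, ← Finset.add_sum_erase _ _ (Finset.mem_univ (0 : F)),
    zero_pow hi.ne', zero_add]
  symm
  refine Finset.sum_bij (fun x _ => (x : F)) (by simp) (fun x _ y _ h => Units.ext h) ?_ (by simp)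
  intro x hx
  exact ⟨Units.mk0 x (by simpa using hx), Finset.mem_univ _, rfl⟩

/-- The reduction of a Jacobi sum is a binomial coefficient. -/
theorem FiniteField.sum_pow_mul_one_sub_pow {A B k : ℕ} (hA : 0 < A)
    (hAk : A + k = Fintype.card F - 1) (hB : B < Fintype.card F - 1) :
    ∑ x : F, x ^ A * (1 - x) ^ B = -((-1) ^ k * (B.choose k : F)) := by
  have hexp : ∀ x : F, x ^ A * (1 - x) ^ B =
      ∑ l ∈ Finset.range (B + 1), (-1) ^ l * (B.choose l : F) * x ^ (A + l) := by
    intro x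
    rw [sub_eq_neg_add, add_pow, Finset.mul_sum]
    refine Finset.sum_congr rfl fun l _ => ?_
    rw [neg_pow, pow_add]
    ring
  rw [Finset.sum_congr rfl fun x _ => hexp x, Finset.sum_comm]
  simp only [← Finset.mul_sum]
  have hval : ∀ l ∈ Finset.range (B + 1), (-1) ^ l * (B.choose l : F) * ∑ x : F, x ^ (A + l) =
      if l = k then -((-1) ^ k * (B.choose k : F)) else 0 := by
    intro l hl
    rw [Finset.mem_range] at hl
    rw [FiniteField.sum_pow_of_pos (by omega)]
    split_ifs with h1 h2 h2
    · rw [h2]; ring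
    · exfalso
      obtain ⟨c, hc⟩ := h1
      have : c = 1 := by
        have h3 : c < 2 := by
          by_contra h
          have : (Fintype.card F - 1) * 2 ≤ (Fintype.card F - 1) * c :=
            Nat.mul_le_mul_left _ (by omega)
          omega
        have h4 : c ≠ 0 := by rintro rfl; omega
        omega
      subst this
      omega
    · exfalso
      apply h1
      rw [h2, hAk]
    · ring
  rw [Finset.sum_congr rfl hval, Finset.sum_ite_eq']
  split_ifs with h
  · rfl
  · rw [Nat.choose_eq_zero_of_lt (by simpa using h)]
    simp

end PowerSums

/-! ### Binomial coefficients prime to `p`, by Lucas' theorem. -/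

section Binomials

theorem Nat.Prime.not_dvd_choose_of_lt {p a b : ℕ} (hp : p.Prime) (ha : a < p) (hb : b ≤ a) :
    ¬ p ∣ a.choose b := by
  intro h
  have := Nat.choose_mul_factorial_mul_factorial hb
  have h1 : p ∣ a.factorial := this ▸ Dvd.dvd.mul_right (Dvd.dvd.mul_right h _) _
  exact absurd (hp.dvd_factorial.mp h1) (by omega)

theorem Nat.Prime.not_dvd_choose_add_mul {p a b n k : ℕ} (hp : p.Prime) (ha : a < p) (hb : b ≤ a)
    (h : ¬ p ∣ n.choose k) : ¬ p ∣ (a + p * n).choose (b + p * k) := by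
  have := Fact.mk hp
  have hl := Choose.choose_modEq_choose_mod_mul_choose_div_nat (n := a + p * n) (k := b + p * k)
    (p := p)
  rw [Nat.add_mul_mod_self_left, Nat.add_mul_mod_self_left, Nat.mod_eq_of_lt ha,
    Nat.mod_eq_of_lt (hb.trans_lt ha), Nat.add_mul_div_left _ _ hp.pos,
    Nat.add_mul_div_left _ _ hp.pos, Nat.div_eq_of_lt ha, Nat.div_eq_of_lt (hb.trans_lt ha),
    zero_add, zero_add] at hl
  rw [hl.dvd_iff dvd_rfl, hp.dvd_mul]
  exact not_or.mpr ⟨Nat.Prime.not_dvd_choose_of_lt hp ha hb, h⟩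

/-- If `p ≡ 1 (mod n)`, all base `p` digits of `c (p ^ r - 1) / n` are equal. -/
theorem not_dvd_choose_of_modEq_one {p n c d : ℕ} (hp : p.Prime) (hn : n ∣ p - 1)
    (hn0 : 0 < n) (hcn : c ≤ n) (hdc : d ≤ c) (r : ℕ) :
    ¬ p ∣ (c * ((p ^ r - 1) / n)).choose (d * ((p ^ r - 1) / n)) := by
  obtain ⟨m, hm⟩ := hn
  have hp1 := hp.one_lt
  induction r with
  | zero => simpa using hp.one_lt.ne'
  | succ r ih =>
    have hdvd : n ∣ p ^ r - 1 := (Dvd.intro m hm.symm).trans (by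
      simpa using Nat.sub_dvd_pow_sub_pow p 1 r)
    obtain ⟨l, hl⟩ := hdvd
    have hpr : 1 ≤ p ^ r := Nat.one_le_pow _ _ hp.pos
    have e : p ^ (r + 1) - 1 = n * (m + p * l) := by
      have h1 : p ^ r = n * l + 1 := by omega
      have h2 : p = n * m + 1 := by omega
      rw [pow_succ, h1]
      have : (n * l + 1) * p = n * (m + p * l) + 1 := by
        calc (n * l + 1) * p = n * l * p + p := by ring
          _ = n * l * p + (n * m + 1) := by rw [← h2]
          _ = n * (m + p * l) + 1 := by ring
      omega
    rw [e, Nat.mul_div_cancel_left _ hn0]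
    rw [hl, Nat.mul_div_cancel_left _ hn0] at ih
    rw [show c * (m + p * l) = c * m + p * (c * l) by ring,
      show d * (m + p * l) = d * m + p * (d * l) by ring]
    refine Nat.Prime.not_dvd_choose_add_mul hp ?_ (Nat.mul_le_mul_right m hdc) ih
    have := Nat.mul_le_mul_right m hcn
    omega

/-- Write `p = 8 t + 3`. The base `p` digits of the lower entry alternate between `3 t + 1` and `t`,
while all digits of the upper entry are `4 t + 1`; each induction step handles two digits. -/
theorem not_dvd_choose_of_modEq_three {p : ℕ} (hp : p.Prime) (h8 : p % 8 = 3) (s : ℕ) :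
    ¬ p ∣ (4 * (((p ^ 2) ^ s - 1) / 8)).choose (((p ^ 2) ^ s - 1) / 8) := by
  obtain ⟨t, ht⟩ : ∃ t, p = 8 * t + 3 := ⟨p / 8, by omega⟩
  induction s with
  | zero => simpa using hp.one_lt.ne'
  | succ s ih =>
    have hdvd : 8 ∣ (p ^ 2) ^ s - 1 :=
      (show 8 ∣ p ^ 2 - 1 from ⟨8 * t ^ 2 + 6 * t + 1, by
        rw [ht, show (8 * t + 3) ^ 2 = 8 * (8 * t ^ 2 + 6 * t + 1) + 1 by ring]; omega⟩).trans (by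
      simpa using Nat.sub_dvd_pow_sub_pow (p ^ 2) 1 s)
    obtain ⟨l, hl⟩ := hdvd
    have hpr : 1 ≤ (p ^ 2) ^ s := Nat.one_le_pow _ _ (by have := hp.pos; positivity)
    have e : (p ^ 2) ^ (s + 1) - 1 = 8 * ((3 * t + 1) + p * (t + p * l)) := by
      have h1 : (p ^ 2) ^ s = 8 * l + 1 := by omega
      rw [pow_succ, h1]
      have : (8 * l + 1) * p ^ 2 = 8 * ((3 * t + 1) + p * (t + p * l)) + 1 := by
        rw [ht]; ring
      omega
    rw [e, Nat.mul_div_cancel_left _ (by norm_num)]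
    rw [hl, Nat.mul_div_cancel_left _ (by norm_num)] at ih
    have e2 : 4 * (3 * t + 1 + p * (t + p * l)) =
        (4 * t + 1) + p * ((4 * t + 1) + p * (4 * l)) := by
      rw [ht]; ring
    rw [e2]
    exact Nat.Prime.not_dvd_choose_add_mul hp (by omega) (by omega)
      (Nat.Prime.not_dvd_choose_add_mul hp (by omega) (by omega) ih)

end Binomials

/-! ### Representations of prime powers by binary quadratic forms. -/

section QuadraticForms

/-- Uniqueness of the representation of a prime power by `x² + N y²`, up to signs. -/
theorem sq_eq_sq_of_representations {p r : ℕ} (hp : p.Prime) (hp2 : p ≠ 2) (hr : r ≠ 0) {M N : ℤ}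
    (hM : 0 < M) (hMN : M ^ 2 < N) {c d c' d' : ℤ} (h : M * p ^ r = c ^ 2 + N * d ^ 2)
    (h' : M * p ^ r = c' ^ 2 + N * d' ^ 2) (hc : ¬ (p : ℤ) ∣ c) (hc' : ¬ (p : ℤ) ∣ c') :
    c ^ 2 = c' ^ 2 := by
  have hpp : Prime (p : ℤ) := Nat.prime_iff_prime_int.mp hp
  have hq0 : (0 : ℤ) < (p : ℤ) ^ r := by have := hp.pos; positivity
  have hprod : ((p : ℤ) ^ r) ∣ (c * d' - c' * d) * (c * d' + c' * d) :=
    ⟨M * (d' ^ 2 - d ^ 2), by linear_combination d ^ 2 * h' - d' ^ 2 * h⟩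
  have hpq : (p : ℤ) ∣ (p : ℤ) ^ r := dvd_pow_self _ hr
  have hd' : ¬ (p : ℤ) ∣ d' := by
    intro hd
    apply hc'
    refine hpp.dvd_of_dvd_pow (n := 2) ?_
    have : c' ^ 2 = M * p ^ r - N * d' ^ 2 := by linear_combination -h'
    rw [this]
    exact dvd_sub (hpq.mul_left M) ((dvd_pow hd two_ne_zero).mul_left N)
  have hnot : ¬ ((p : ℤ) ∣ c * d' - c' * d ∧ (p : ℤ) ∣ c * d' + c' * d) := by
    rintro ⟨h1, h2⟩
    have h3 : (p : ℤ) ∣ 2 * (c * d') := by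
      have := dvd_add h1 h2
      rwa [show c * d' - c' * d + (c * d' + c' * d) = 2 * (c * d') by ring] at this
    rcases hpp.dvd_or_dvd h3 with h4 | h4
    · have : p ∣ 2 := by exact_mod_cast h4
      exact hp2 ((Nat.prime_dvd_prime_iff_eq hp Nat.prime_two).mp this)
    · rcases hpp.dvd_or_dvd h4 with h5 | h5
      · exact hc h5
      · exact hd' h5
  -- In the composition identity, a nonzero multiple of `p ^ r` in the second square would
  -- contribute at least `N (p ^ r)²`, more than the total because `M ^ 2 < N`.
  have hsmall : ∀ e : ℤ, (c * c' + e * (N * d * d')) ^ 2 + N * (c * d' - e * (c' * d)) ^ 2 =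
      (M * p ^ r) ^ 2 → ((p : ℤ) ^ r) ∣ c * d' - e * (c' * d) → c * d' - e * (c' * d) = 0 := by
    intro e h1 h2
    by_contra h3
    have h4 : ((p : ℤ) ^ r) ^ 2 ≤ (c * d' - e * (c' * d)) ^ 2 := by
      rw [sq_le_sq, abs_of_pos hq0]
      exact Int.le_of_dvd (abs_pos.mpr h3) ((dvd_abs _ _).mpr h2)
    nlinarith [sq_nonneg (c * c' + e * (N * d * d')), mul_le_mul_of_nonneg_left h4
      (show (0 : ℤ) ≤ N by nlinarith), pow_pos hq0 2]
  have hfin : c ^ 2 * d' ^ 2 = c' ^ 2 * d ^ 2 → c ^ 2 = c' ^ 2 := by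
    intro h1
    have h2 : (M * (p : ℤ) ^ r) * c ^ 2 = (M * (p : ℤ) ^ r) * c' ^ 2 := by
      linear_combination c ^ 2 * h' - c' ^ 2 * h + N * h1
    exact mul_left_cancel₀ (mul_pos hM hq0).ne' h2
  by_cases h1 : (p : ℤ) ∣ c * d' - c' * d
  · have h2 : ¬ (p : ℤ) ∣ c * d' + c' * d := fun h2 => hnot ⟨h1, h2⟩
    have hcop : IsCoprime ((p : ℤ) ^ r) (c * d' + c' * d) :=
      ((Prime.coprime_iff_not_dvd hpp).mpr h2).pow_left
    have h3 := hcop.dvd_of_dvd_mul_right hprod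
    have := hsmall 1 (by rw [sq (M * (p : ℤ) ^ r)]; nth_rw 1 [h]; rw [h']; ring) (by simpa using h3)
    apply hfin
    linear_combination (c * d' + c' * d) * this
  · have hcop : IsCoprime ((p : ℤ) ^ r) (c * d' - c' * d) :=
      ((Prime.coprime_iff_not_dvd hpp).mpr h1).pow_left
    have h3 := hcop.dvd_of_dvd_mul_left hprod
    have := hsmall (-1) (by rw [sq (M * (p : ℤ) ^ r)]; nth_rw 1 [h]; rw [h']; ring)
      (by simpa using h3)
    apply hfin
    linear_combination (c * d' - c' * d) * this

/-- If `p` is inert, a power of `p` is represented by `x² + N y²` only with `y = 0`. -/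
theorem eq_zero_of_inert {p : ℕ} (hp : p.Prime) {N : ℤ} (hN : 1 < N)
    (hinert : ∀ x y : ℤ, (p : ℤ) ∣ x ^ 2 + N * y ^ 2 → (p : ℤ) ∣ x ∧ (p : ℤ) ∣ y) (r : ℕ) :
    ∀ x y : ℤ, (p : ℤ) ^ r = x ^ 2 + N * y ^ 2 → y = 0 := by
  induction r using Nat.strong_induction_on with
  | _ r ih =>
    intro x y h
    rcases Nat.eq_zero_or_pos r with rfl | hr
    · by_contra hy
      have : 0 < y ^ 2 := by positivity
      nlinarith [sq_nonneg x]
    have hp0 : (p : ℤ) ≠ 0 := by exact_mod_cast hp.ne_zero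
    obtain ⟨⟨x, rfl⟩, ⟨y, rfl⟩⟩ := hinert x y (h ▸ dvd_pow_self _ hr.ne')
    obtain ⟨r, rfl⟩ : ∃ s, r = s + 1 := ⟨r - 1, by omega⟩
    have h1 : (p : ℤ) ^ r = p * (x ^ 2 + N * y ^ 2) := by
      refine mul_left_cancel₀ hp0 ?_
      linear_combination h
    rcases Nat.eq_zero_or_pos r with rfl | hr
    · exfalso
      rw [pow_zero] at h1
      have := Int.isUnit_iff.mp (IsUnit.of_mul_eq_one _ h1.symm)
      have := hp.one_lt
      omega
    obtain ⟨r, rfl⟩ : ∃ s, r = s + 1 := ⟨r - 1, by omega⟩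
    have h2 : (p : ℤ) ^ r = x ^ 2 + N * y ^ 2 := by
      refine mul_left_cancel₀ hp0 ?_
      linear_combination h1
    rw [ih r (by omega) x y h2, mul_zero]

/-- If `p` is inert in the Eisenstein integers, the elements of norm `p ^ r` are associated to
powers of `p`. -/
theorem eisenstein_inert {p : ℕ} (hp : p.Prime)
    (hinert : ∀ a b : ℤ, (p : ℤ) ∣ a ^ 2 - a * b + b ^ 2 → (p : ℤ) ∣ a ∧ (p : ℤ) ∣ b) (r : ℕ) :
    ∀ a b : ℤ, (p : ℤ) ^ r = a ^ 2 - a * b + b ^ 2 →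
      ∃ a' b' : ℤ, a = p ^ (r / 2) * a' ∧ b = p ^ (r / 2) * b' ∧ a' ^ 2 - a' * b' + b' ^ 2 = 1 := by
  induction r using Nat.strong_induction_on with
  | _ r ih =>
    intro a b h
    rcases Nat.eq_zero_or_pos r with rfl | hr
    · exact ⟨a, b, by simp, by simp, by simpa using h.symm⟩
    have hp0 : (p : ℤ) ≠ 0 := by exact_mod_cast hp.ne_zero
    obtain ⟨⟨a, rfl⟩, ⟨b, rfl⟩⟩ := hinert a b (h ▸ dvd_pow_self _ hr.ne')
    obtain ⟨r, rfl⟩ : ∃ s, r = s + 1 := ⟨r - 1, by omega⟩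
    have h1 : (p : ℤ) ^ r = p * (a ^ 2 - a * b + b ^ 2) := by
      refine mul_left_cancel₀ hp0 ?_
      linear_combination h
    rcases Nat.eq_zero_or_pos r with rfl | hr
    · exfalso
      rw [pow_zero] at h1
      have := Int.isUnit_iff.mp (IsUnit.of_mul_eq_one _ h1.symm)
      have := hp.one_lt
      omega
    obtain ⟨r, rfl⟩ : ∃ s, r = s + 1 := ⟨r - 1, by omega⟩
    have h2 : (p : ℤ) ^ r = a ^ 2 - a * b + b ^ 2 := by
      refine mul_left_cancel₀ hp0 ?_
      linear_combination h1
    obtain ⟨a', b', rfl, rfl, h3⟩ := ih r (by omega) a b h2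
    refine ⟨a', b', ?_, ?_, h3⟩ <;>
    · rw [show (r + 1 + 1) / 2 = r / 2 + 1 by omega]
      ring

/-- Otherwise `x / y` would be a square root of `-N` modulo `p`. -/
theorem dvd_of_dvd_sq_add_mul_sq {p : ℕ} (hp : p.Prime) {N : ℤ}
    (hN : ¬ IsSquare ((-N : ℤ) : ZMod p)) {x y : ℤ} (h : (p : ℤ) ∣ x ^ 2 + N * y ^ 2) :
    (p : ℤ) ∣ x ∧ (p : ℤ) ∣ y := by
  have := Fact.mk hp
  simp only [← ZMod.intCast_zmod_eq_zero_iff_dvd] at h ⊢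
  push_cast at h hN
  have hy : (y : ZMod p) = 0 := by
    by_contra hy
    refine hN ⟨x / y, ?_⟩
    field_simp
    linear_combination -h
  refine ⟨?_, hy⟩
  rw [hy] at h
  simpa using h

theorem dvd_of_dvd_sq_add_four_mul_sq {p : ℕ} (hp : p.Prime) (hp4 : p % 4 = 3) (x y : ℤ)
    (h : (p : ℤ) ∣ x ^ 2 + 4 * y ^ 2) : (p : ℤ) ∣ x ∧ (p : ℤ) ∣ y := by
  have := Fact.mk hp
  refine dvd_of_dvd_sq_add_mul_sq hp (fun hsq => ?_) h
  have h2 : (2 : ZMod p) ≠ 0 := by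
    intro h2
    have : p ∣ 2 := (ZMod.natCast_eq_zero_iff 2 p).mp (by exact_mod_cast h2)
    have := (Nat.prime_dvd_prime_iff_eq hp Nat.prime_two).mp this
    omega
  obtain ⟨z, hz⟩ := hsq
  push_cast at hz
  have : IsSquare (-1 : ZMod p) := ⟨z / 2, by field_simp; linear_combination hz⟩
  exact ZMod.exists_sq_eq_neg_one_iff.mp this hp4

theorem dvd_of_dvd_sq_add_two_mul_sq {p : ℕ} (hp : p.Prime) (hp2 : p ≠ 2)
    (hp8 : ¬ (p % 8 = 1 ∨ p % 8 = 3)) (x y : ℤ) (h : (p : ℤ) ∣ x ^ 2 + 2 * y ^ 2) :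
    (p : ℤ) ∣ x ∧ (p : ℤ) ∣ y := by
  have := Fact.mk hp
  refine dvd_of_dvd_sq_add_mul_sq hp (fun hsq => ?_) h
  push_cast at hsq
  exact hp8 ((ZMod.exists_sq_eq_neg_two_iff hp2).mp hsq)

/-- Otherwise `-a / b` would have order 3 modulo `p`, forcing `3 ∣ p - 1`. -/
theorem dvd_of_dvd_eisenstein_norm {p : ℕ} (hp : p.Prime) (hp3 : p % 3 = 2) (a b : ℤ)
    (h : (p : ℤ) ∣ a ^ 2 - a * b + b ^ 2) : (p : ℤ) ∣ a ∧ (p : ℤ) ∣ b := by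
  have := Fact.mk hp
  simp only [← ZMod.intCast_zmod_eq_zero_iff_dvd] at h ⊢
  push_cast at h
  have hb : (b : ZMod p) = 0 := by
    by_contra hb
    have hroot : (-(a / b) : ZMod p) ^ 2 + -(a / b) + 1 = 0 := by
      field_simp
      linear_combination h
    have h1 : (-(a / b) : ZMod p) ≠ 1 := by
      intro h1
      rw [h1] at hroot
      have h3 : ((3 : ℕ) : ZMod p) = 0 := by push_cast; linear_combination hroot
      have := (Nat.prime_dvd_prime_iff_eq hp Nat.prime_three).mp
        ((ZMod.natCast_eq_zero_iff 3 p).mp h3)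
      omega
    have hord : orderOf (-(a / b) : ZMod p) = 3 :=
      orderOf_eq_prime (by linear_combination (-(a / b : ZMod p) - 1) * hroot) h1
    have := ZMod.orderOf_dvd_card_sub_one (p := p) (a := (-(a / b) : ZMod p)) (by
      intro h0; rw [h0] at hroot; simp at hroot)
    rw [hord] at this
    have := hp.one_lt
    omega
  refine ⟨?_, hb⟩
  rw [hb] at h
  simpa using h

end QuadraticForms

/-! ### Integer coefficients shared by a Jacobi sum and its reduction in `F`. -/

section JacobiCoefficients

variable {F : Type*} [Field F] [Fintype F]

/-- Characters of order `n` in `ℂ` and in `F` are described by one discrete logarithm. -/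
theorem MulChar.exists_log {n : ℕ} {χ : MulChar F ℂ} (hχ : orderOf χ = n) :
    ∃ (ζ : ℂ) (η : F) (l : F → ℕ), IsPrimitiveRoot ζ n ∧ IsPrimitiveRoot η n ∧
      ∀ x ≠ 0, χ x = ζ ^ l x ∧ x ^ ((Fintype.card F - 1) / n) = η ^ l x := by
  obtain ⟨g, hg⟩ := IsCyclic.exists_generator (α := Fˣ)
  have hlog : ∀ x : F, ∃ m : ℕ, x ≠ 0 → x = (g : F) ^ m := by
    intro x
    by_cases hx : x = 0
    · exact ⟨0, fun h => absurd hx h⟩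
    obtain ⟨m, hm⟩ := (Submonoid.mem_powers_iff _ _).mp
      (mem_powers_iff_mem_zpowers.mpr (hg (Units.mk0 x hx)))
    exact ⟨m, fun _ => by rw [← Units.val_pow_eq_pow_val, hm, Units.val_mk0]⟩
  choose l hl using hlog
  have hn : n ∣ Fintype.card F - 1 := hχ ▸ MulChar.orderOf_dvd_card_sub_one (F := F) χ
  have hq : 0 < Fintype.card F - 1 := Nat.sub_pos_of_lt Fintype.one_lt_card
  refine ⟨χ g, (g : F) ^ ((Fintype.card F - 1) / n), l, ?_, ?_, ?_⟩
  · rw [← hχ, ← MulChar.orderOf_apply_generator hg χ]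
    exact IsPrimitiveRoot.orderOf _
  · classical
    have hgo : orderOf g = Fintype.card F - 1 := by
      rw [orderOf_eq_card_of_forall_mem_zpowers hg, Nat.card_eq_fintype_card, Fintype.card_units]
    have h1 : IsPrimitiveRoot (g : F) (Fintype.card F - 1) := by
      rw [← hgo, ← orderOf_units]
      exact IsPrimitiveRoot.orderOf _
    exact h1.pow hq (Nat.div_mul_cancel hn).symm
  · intro x hx
    constructor
    · conv_lhs => rw [hl x hx, map_pow]
    · conv_lhs => rw [hl x hx]
      rw [← pow_mul, ← pow_mul, mul_comm]

theorem sum_mul_pow_log {F A : Type*} [Fintype F] [CommRing A] {n : ℕ} (hn : 0 < n) {ξ : A}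
    (hξ : ξ ^ n = 1) (s : F → ℤ) (l : F → ℕ) (i : ℕ) :
    ∑ x, (s x : A) * (ξ ^ l x) ^ i =
      ∑ j ∈ Finset.range n, ((∑ x with l x % n = j, s x : ℤ) : A) * ξ ^ (i * j) := by
  rw [← Finset.sum_fiberwise_of_maps_to (t := Finset.range n) (g := fun x => l x % n)
    (fun x _ => Finset.mem_range.mpr (Nat.mod_lt _ hn))]
  refine Finset.sum_congr rfl fun j _ => ?_
  rw [Int.cast_sum, Finset.sum_mul]
  refine Finset.sum_congr rfl fun x hx => ?_
  rw [← (Finset.mem_filter.mp hx).2, ← pow_mul]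
  congr 1
  conv_lhs => rw [← Nat.mod_add_div (l x) n]
  rw [add_mul, pow_add, mul_assoc, pow_mul ξ n, hξ, one_pow, mul_one, mul_comm]

theorem MulChar.quadratic_apply {φ : MulChar F ℂ} (hφ : orderOf φ = 2) :
    ∃ ε : F → ℤ, (∀ y, φ y = ε y) ∧ (∀ y, y ^ ((Fintype.card F - 1) / 2) = (ε y : F)) ∧
      ∀ y, y ≠ 0 → ε y = 1 ∨ ε y = -1 := by
  classical
  obtain ⟨ζ, η, l, hζ, hη, hl⟩ := MulChar.exists_log hφ
  have hζ' := hζ.eq_neg_one_of_two_right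
  have hη' := hη.eq_neg_one_of_two_right
  have hpos : (Fintype.card F - 1) / 2 ≠ 0 := by
    have h1 := MulChar.orderOf_dvd_card_sub_one (F := F) φ
    rw [hφ] at h1
    have := Fintype.one_lt_card (α := F)
    omega
  refine ⟨fun y => if y = 0 then 0 else (-1) ^ l y, fun y => ?_, fun y => ?_, fun y hy => ?_⟩
  · by_cases hy : y = 0
    · simp [hy]
    · dsimp only
      rw [(hl y hy).1, if_neg hy, hζ']; push_cast; rfl
  · by_cases hy : y = 0
    · simp [hy, hpos]
    · dsimp only
      rw [(hl y hy).2, if_neg hy, hη']; push_cast; rfl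
  · dsimp only
    rw [if_neg hy]
    exact neg_one_pow_eq_or ℤ _

/-- The Jacobi sums `J(θ ^ i, φ)` with the quadratic character `φ`, and the corresponding power
sums in `F`, in terms of the number `m j` of `x` with `θ(x) = ζ ^ j` and `φ(1 - x) = -1`. -/
theorem exists_jacobiSum_quadratic_coeffs {n : ℕ} {θ φ : MulChar F ℂ} (hθ : orderOf θ = n)
    (hφ : orderOf φ = 2) :
    ∃ (ζ : ℂ) (η : F) (m : ℕ → ℤ), IsPrimitiveRoot ζ n ∧ IsPrimitiveRoot η n ∧
      2 * ∑ j ∈ Finset.range n, m j = Fintype.card F - 1 ∧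
      ∀ i, 0 < i → i < n →
        jacobiSum (θ ^ i) φ = -1 - 2 * ∑ j ∈ Finset.range n, (m j : ℂ) * ζ ^ (i * j) ∧
        -((-1) ^ ((Fintype.card F - 1) / n * (n - i)) *
            ((((Fintype.card F - 1) / 2).choose ((Fintype.card F - 1) / n * (n - i)) : ℕ) : F)) =
          -1 - 2 * ∑ j ∈ Finset.range n, (m j : F) * η ^ (i * j) := by
  classical
  obtain ⟨ζ, η, l, hζ, hη, hl⟩ := MulChar.exists_log hθ
  obtain ⟨ε, hε, hεF, hε1⟩ := MulChar.quadratic_apply hφ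
  have hn : 0 < n := hθ ▸ MulChar.orderOf_pos θ
  have hnq : n ∣ Fintype.card F - 1 := hθ ▸ MulChar.orderOf_dvd_card_sub_one (F := F) θ
  have hq : 0 < Fintype.card F - 1 := Nat.sub_pos_of_lt Fintype.one_lt_card
  have hφ1 : φ ≠ 1 := by rintro rfl; simp at hφ
  have hε0 : ε 0 = 0 := by
    have := hε 0
    rw [MulChar.map_zero] at this
    exact_mod_cast this.symm
  have hεone : ε 1 = 1 := by
    have := hε 1
    rw [map_one] at this
    exact_mod_cast this.symm
  -- `s` is the indicator of `φ (1 - x) = -1`. Writing `φ (1 - x) = 1 - 2 s` away from `x = 1`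
  -- exposes the factor 2 behind the congruences modulo 4; the point `x = 1` accounts for the `-1`.
  let s : F → ℤ := fun x => if x = 1 then 0 else (1 - ε (1 - x)) / 2
  have hs : ∀ x, ε (1 - x) = 1 - 2 * s x - if x = 1 then 1 else 0 := by
    intro x
    by_cases hx : x = 1
    · simp [s, hx, hε0]
    · have := hε1 (1 - x) (sub_ne_zero.mpr (Ne.symm hx))
      simp only [s, if_neg hx]
      rcases this with h | h <;> rw [h] <;> norm_num
  have hs0 : s 0 = 0 := by simp [s, hεone]
  refine ⟨ζ, η, fun j => ∑ x with l x % n = j, s x, hζ, hη, ?_, fun i hi0 hin => ⟨?_, ?_⟩⟩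
  · have h1 : ∑ j ∈ Finset.range n, ∑ x with l x % n = j, s x = ∑ x, s x :=
      Finset.sum_fiberwise_of_maps_to
        (fun x _ => Finset.mem_range.mpr (Nat.mod_lt _ hn)) _
    have h2 : ∑ x, ε (1 - x) = 0 := by
      have : ∑ x, φ (1 - x) = 0 := sum_apply_sub_eq_zero hφ1 1
      simp only [hε] at this
      exact_mod_cast this
    simp only [hs, Finset.sum_sub_distrib, ← Finset.mul_sum, Finset.sum_ite_eq', Finset.mem_univ,
      if_true, Finset.sum_const, Finset.card_univ, nsmul_eq_mul, mul_one] at h2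
    rw [h1]
    linarith
  · rw [← sum_mul_pow_log hn hζ.pow_eq_one s l i]
    have hterm : ∀ x, (θ ^ i) x * φ (1 - x) =
        (θ ^ i) x - 2 * ((s x : ℂ) * (ζ ^ l x) ^ i) - if x = 1 then 1 else 0 := by
      intro x
      by_cases hx : x = 0
      · simp [hx, MulChar.map_zero, hs0]
      rw [hε, hs, ← (hl x hx).1, ← MulChar.pow_apply' θ hi0.ne']
      by_cases hx1 : x = 1
      · simp [hx1, s]
      · simp only [if_neg hx1]
        push_cast
        ring
    rw [jacobiSum, Finset.sum_congr rfl fun x _ => hterm x, Finset.sum_sub_distrib,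
      Finset.sum_sub_distrib, ← Finset.mul_sum, Finset.sum_ite_eq',
      MulChar.sum_eq_zero_of_ne_one (pow_ne_one_of_lt_orderOf hi0.ne' (hθ ▸ hin))]
    simp only [Finset.mem_univ, if_true]
    ring
  · obtain ⟨m, hm⟩ := hnq
    have hdiv : (Fintype.card F - 1) / n = m := by rw [hm, Nat.mul_div_cancel_left _ hn]
    have hm0 : 0 < m := by
      rcases Nat.eq_zero_or_pos m with rfl | h
      · omega
      · exact h
    rw [hdiv] at hl ⊢
    have hmi : m * i + m * (n - i) = Fintype.card F - 1 := by
      rw [hm, ← mul_add, Nat.add_sub_cancel' hin.le, mul_comm]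
    have hmi0 : 0 < m * i := Nat.mul_pos hm0 hi0
    have hmi1 : 0 < m * (n - i) := Nat.mul_pos hm0 (by omega)
    rw [← FiniteField.sum_pow_mul_one_sub_pow hmi0 hmi (by omega),
      ← sum_mul_pow_log hn hη.pow_eq_one s l i]
    have hterm : ∀ x : F, x ^ (m * i) * (1 - x) ^ ((Fintype.card F - 1) / 2) =
        x ^ (m * i) - 2 * ((s x : F) * (η ^ l x) ^ i) - if x = 1 then 1 else 0 := by
      intro x
      by_cases hx : x = 0
      · simp [hx, hs0, hmi0.ne']
      rw [hεF, hs, ← (hl x hx).2, ← pow_mul]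
      by_cases hx1 : x = 1
      · simp [hx1, s]
      · simp only [if_neg hx1]
        push_cast
        ring
    rw [Finset.sum_congr rfl fun x _ => hterm x, Finset.sum_sub_distrib,
      Finset.sum_sub_distrib, ← Finset.mul_sum, Finset.sum_ite_eq',
      FiniteField.sum_pow_of_pos hmi0, if_neg (Nat.not_dvd_of_pos_of_lt hmi0 (by omega))]
    simp only [Finset.mem_univ, if_true]
    ring

end JacobiCoefficients

/-! ### Quartic and octic Jacobi sums as quadratic integers. -/

section JacobiArithmetic

theorem charP_of_card_eq_pow {F : Type*} [Field F] [Fintype F] {p r : ℕ} (hp : p.Prime)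
    (h : Fintype.card F = p ^ r) : CharP F p := by
  obtain ⟨n, hprime, hn⟩ := FiniteField.card F (ringChar F)
  have hdvd : ringChar F ∣ p ^ r := by
    rw [← h, hn]; exact dvd_pow_self _ n.pos.ne'
  have := (Nat.prime_dvd_prime_iff_eq hprime hp).mp (hprime.dvd_of_dvd_pow hdvd)
  rw [← this]
  infer_instance

variable {F : Type*} [Field F] [Fintype F]

theorem ringChar_complex_ne : ringChar ℂ ≠ ringChar F := by
  rw [ringChar.eq_zero]
  exact (CharP.ringChar_ne_zero_of_finite F).symm

/-- The quartic Jacobi sum `J(χ, χ²)` is a Gaussian integer `a + 2 b i` of norm `q`. -/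
theorem jacobiSum_quartic_arith {p r : ℕ} (hp : p.Prime) (hq : Fintype.card F = p ^ r)
    {χ : MulChar F ℂ} (hχ : orderOf χ = 4) :
    ∃ a b : ℤ, jacobiSum χ (χ ^ 2) + jacobiSum (χ ^ 3) (χ ^ 2) = 2 * a ∧
      jacobiSum χ (χ ^ 2) * jacobiSum (χ ^ 3) (χ ^ 2) = Fintype.card F ∧
      (Fintype.card F : ℤ) = a ^ 2 + 4 * b ^ 2 ∧ (p % 4 = 1 → ¬ (p : ℤ) ∣ a) ∧
      (Fintype.card F % 8 = 1 → a % 4 = 3) := by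
  have hφ : orderOf (χ ^ 2) = 2 := by
    rw [orderOf_pow_of_dvd (by norm_num) (by rw [hχ]; norm_num), hχ]
  have hne : ∀ n, 0 < n ∧ n < 4 → χ ^ n ≠ 1 := fun n hn =>
    pow_ne_one_of_lt_orderOf (by omega) (by rw [hχ]; omega)
  have h4 : χ ^ 4 = 1 := hχ ▸ pow_orderOf_eq_one χ
  obtain ⟨ζ, η, m, hζ, hη, hsum, hJ⟩ := exists_jacobiSum_quadratic_coeffs hχ hφ
  have hζ2 : ζ ^ 2 = -1 := (hζ.pow (by norm_num) (show 4 = 2 * 2 by rfl)).eq_neg_one_of_two_right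
  have hη2 : η ^ 2 = -1 := (hη.pow (by norm_num) (show 4 = 2 * 2 by rfl)).eq_neg_one_of_two_right
  obtain ⟨J1, B1⟩ := hJ 1 (by norm_num) (by norm_num)
  obtain ⟨J3, B3⟩ := hJ 3 (by norm_num) (by norm_num)
  simp only [Finset.sum_range_succ, Finset.sum_range_zero, zero_add] at hsum J1 J3 B1 B3
  rw [pow_one] at J1
  obtain ⟨a, ha⟩ : ∃ a, a = -1 - 2 * (m 0 - m 2) := ⟨_, rfl⟩
  obtain ⟨b, hb⟩ : ∃ b, b = -(m 1 - m 3) := ⟨_, rfl⟩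
  have J1' : jacobiSum χ (χ ^ 2) = a + 2 * b * ζ := by
    rw [J1, ha, hb]; push_cast
    linear_combination (-2 * (m 2 : ℂ) - 2 * m 3 * ζ) * hζ2
  have J3' : jacobiSum (χ ^ 3) (χ ^ 2) = a - 2 * b * ζ := by
    rw [J3, ha, hb]; push_cast
    linear_combination (-2 * (m 1 : ℂ) * ζ - 2 * m 2 * (ζ ^ 4 - ζ ^ 2 + 1) -
      2 * m 3 * ζ * (ζ ^ 6 - ζ ^ 4 + ζ ^ 2 - 1)) * hζ2
  have hprod : jacobiSum χ (χ ^ 2) * jacobiSum (χ ^ 3) (χ ^ 2) = Fintype.card F := by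
    have h := jacobiSum_mul_jacobiSum_inv (ringChar_complex_ne (F := F)) (χ := χ) (φ := χ ^ 2)
      (by simpa using hne 1 (by norm_num)) (hne 2 (by norm_num))
      (by rw [← pow_succ']; exact hne 3 (by norm_num))
    rw [MulChar.inv_eq_self hφ, show χ⁻¹ = χ ^ 3 by
      rw [inv_eq_iff_mul_eq_one, ← pow_succ', h4]] at h
    exact h
  have hnorm : (Fintype.card F : ℤ) = a ^ 2 + 4 * b ^ 2 := by
    have : (Fintype.card F : ℂ) = a ^ 2 + 4 * b ^ 2 := by
      rw [← hprod, J1', J3']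
      linear_combination (-4 * (b : ℂ) ^ 2) * hζ2
    exact_mod_cast this
  refine ⟨a, b, by rw [J1', J3']; ring, hprod, hnorm, ?_, ?_⟩
  · intro hp4 hpa
    have := charP_of_card_eq_pow hp hq
    have ha0 : (a : F) = 0 := (CharP.intCast_eq_zero_iff F p a).mpr hpa
    have hdvd4 : 4 ∣ Fintype.card F - 1 := hχ ▸ MulChar.orderOf_dvd_card_sub_one (F := F) χ
    have hpos : 0 < Fintype.card F - 1 := Nat.sub_pos_of_lt Fintype.one_lt_card
    -- For `i = 1` the lower index exceeds the upper one, so the reduction vanishes. If also `p ∣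
    -- a`, then the conjugate reduction vanishes, against the central binomial coefficient being
    -- prime to `p`.
    have hB1 : (0 : F) = a + 2 * b * η := by
      rw [Nat.choose_eq_zero_of_lt (by omega)] at B1
      rw [ha, hb]; push_cast at B1 ⊢
      linear_combination B1 + (-2 * (m 2 : F) - 2 * m 3 * η) * hη2
    have hB3 : (((Fintype.card F - 1) / 2).choose ((Fintype.card F - 1) / 4) : F) = 0 := by
      have h1 : -((-1) ^ ((Fintype.card F - 1) / 4 * (4 - 3)) *
          ((((Fintype.card F - 1) / 2).choose ((Fintype.card F - 1) / 4 * (4 - 3)) : ℕ) : F)) =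
          a - 2 * b * η := by
        rw [B3, ha, hb]; push_cast
        linear_combination (-2 * (m 1 : F) * η - 2 * m 2 * (η ^ 4 - η ^ 2 + 1) -
          2 * m 3 * η * (η ^ 6 - η ^ 4 + η ^ 2 - 1)) * hη2
      have h2 : (a : F) - 2 * b * η = 0 := by linear_combination 2 * ha0 + hB1
      rw [h2, neg_eq_zero, mul_eq_zero, Nat.mul_one] at h1
      exact h1.resolve_left (pow_ne_zero _ (by simp))
    rw [CharP.cast_eq_zero_iff F p] at hB3
    have hp1 := hp.one_lt
    have := not_dvd_choose_of_modEq_one (n := 4) (c := 2) (d := 1) hp (by omega) (by norm_num)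
      (by norm_num) (by norm_num) r
    rw [← hq, one_mul, show 2 * ((Fintype.card F - 1) / 4) = (Fintype.card F - 1) / 2 by omega]
      at this
    exact this hB3
  · intro h8
    -- As `a` is odd, the norm equation modulo 8 makes `b` even. Then `m 1 + m 3` is even, hence so
    -- is `m 0 + m 2`, since the total `(q - 1)/2` is even; this gives `a ≡ -1` modulo 4.
    have hb2 : b % 2 = 0 := by
      rcases Int.emod_two_eq_zero_or_one b with h | h
      · exact h
      exfalso
      obtain ⟨t, rfl⟩ : ∃ t, b = 2 * t + 1 := ⟨b / 2, by omega⟩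
      obtain ⟨w, hw⟩ : ∃ w, a = 2 * w + 1 := ⟨-1 - (m 0 - m 2), by rw [ha]; ring⟩
      have hww := Int.emod_two_eq_zero_or_one (w * (w + 1))
      have heven : (w * (w + 1)) % 2 = 0 := Int.even_iff.mp (Int.even_mul_succ_self w)
      have e1 : (Fintype.card F : ℤ) = 4 * (w * (w + 1)) + 1 + 4 * (4 * (t * t + t) + 1) := by
        rw [hnorm, hw]; ring
      omega
    omega

theorem pow_eq_of_pow_four_eq_neg_one {A : Type*} [CommRing A] {ξ : A} (h : ξ ^ 4 = -1) (n : ℕ) :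
    ξ ^ n = (-1) ^ (n / 4) * ξ ^ (n % 4) := by
  conv_lhs => rw [← Nat.div_add_mod n 4, pow_add, pow_mul, h]

theorem sum_range_eight_of_pow_four {A : Type*} [CommRing A] {ξ : A} (h : ξ ^ 4 = -1)
    (m : ℕ → A) :
    ∑ j ∈ Finset.range 8, m j * ξ ^ (1 * j) =
        (m 0 - m 4) + (m 1 - m 5) * ξ + (m 2 - m 6) * ξ ^ 2 + (m 3 - m 7) * ξ ^ 3 ∧
      ∑ j ∈ Finset.range 8, m j * ξ ^ (3 * j) =
        (m 0 - m 4) + (m 3 - m 7) * ξ - (m 2 - m 6) * ξ ^ 2 + (m 1 - m 5) * ξ ^ 3 ∧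
      ∑ j ∈ Finset.range 8, m j * ξ ^ (7 * j) =
        (m 0 - m 4) - (m 3 - m 7) * ξ - (m 2 - m 6) * ξ ^ 2 - (m 1 - m 5) * ξ ^ 3 := by
  refine ⟨?_, ?_, ?_⟩ <;>
  · simp only [Finset.sum_range_succ, Finset.sum_range_zero, zero_add,
      fun i j : ℕ => pow_eq_of_pow_four_eq_neg_one h (i * j)]
    norm_num
    ring

/-- The octic Jacobi sum `J(θ, θ⁴)` is of the form `u + v √-2` and of norm `q`. -/
theorem jacobiSum_octic_arith {p r : ℕ} (hp : p.Prime) (hq : Fintype.card F = p ^ r)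
    {θ : MulChar F ℂ} (hθ : orderOf θ = 8) :
    ∃ u v : ℤ, jacobiSum θ (θ ^ 4) + jacobiSum (θ ^ 7) (θ ^ 4) = 2 * u ∧
      jacobiSum θ (θ ^ 4) * jacobiSum (θ ^ 7) (θ ^ 4) = Fintype.card F ∧
      (Fintype.card F : ℤ) = u ^ 2 + 2 * v ^ 2 ∧
      (p % 8 = 1 ∨ p % 8 = 3 → ¬ (p : ℤ) ∣ u) ∧ u % 4 = 3 := by
  have hφ := orderOf_pow_four_of_eight hθ
  have hne : ∀ n, 0 < n ∧ n < 8 → θ ^ n ≠ 1 := fun n hn =>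
    pow_ne_one_of_lt_orderOf (by omega) (by rw [hθ]; omega)
  have h8 : θ ^ 8 = 1 := hθ ▸ pow_orderOf_eq_one θ
  obtain ⟨ζ, η, m, hζ, hη, hsum, hJ⟩ := exists_jacobiSum_quadratic_coeffs hθ hφ
  have hζ4 : ζ ^ 4 = -1 := (hζ.pow (by norm_num) (show 8 = 4 * 2 by rfl)).eq_neg_one_of_two_right
  have hη4 : η ^ 4 = -1 := (hη.pow (by norm_num) (show 8 = 4 * 2 by rfl)).eq_neg_one_of_two_right
  obtain ⟨J1, B1⟩ := hJ 1 (by norm_num) (by norm_num)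
  obtain ⟨J3, -⟩ := hJ 3 (by norm_num) (by norm_num)
  obtain ⟨J7, B7⟩ := hJ 7 (by norm_num) (by norm_num)
  obtain ⟨S1, S3, S7⟩ := sum_range_eight_of_pow_four hζ4 fun j => (m j : ℂ)
  obtain ⟨T1, -, T7⟩ := sum_range_eight_of_pow_four hη4 fun j => (m j : F)
  rw [S1, pow_one] at J1
  rw [S3] at J3
  rw [S7] at J7
  rw [T1] at B1
  rw [T7] at B7
  simp only [Finset.sum_range_succ, Finset.sum_range_zero, zero_add] at hsum
  have heq := jacobiSum_octic hθ
  rw [J1, J3] at heq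
  -- The relation `J(θ³, θ⁴) = J(θ, θ⁴)` puts the sum in `ℤ[√-2]`. Since `(1 - ζ²)² = -2 ζ²`,
  -- comparing coefficients becomes the vanishing of a form `X² + 2 Y²`.
  have hz : (m 1 - m 5 : ℤ) - (m 3 - m 7) = 0 ∧ (m 2 - m 6 : ℤ) = 0 := by
    have h1 : (((m 1 - m 5 : ℤ) - (m 3 - m 7) : ℤ) : ℂ) * (1 - ζ ^ 2) =
        -(2 * ((m 2 - m 6 : ℤ) : ℂ) * ζ) := by
      have hζ0 : ζ ≠ 0 := hζ.ne_zero (by norm_num)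
      apply mul_right_cancel₀ hζ0
      push_cast
      linear_combination (1 / 2 : ℂ) * heq
    have h2 : (((m 1 - m 5 : ℤ) - (m 3 - m 7) : ℤ) : ℂ) ^ 2 +
        2 * ((m 2 - m 6 : ℤ) : ℂ) ^ 2 = 0 := by
      have hζ2 : ζ ^ 2 ≠ 0 := pow_ne_zero _ (hζ.ne_zero (by norm_num))
      apply mul_right_cancel₀ hζ2
      linear_combination (-1 / 2 : ℂ) * ((((m 1 - m 5 : ℤ) - (m 3 - m 7) : ℤ) : ℂ) * (1 - ζ ^ 2)
        - 2 * ((m 2 - m 6 : ℤ) : ℂ) * ζ) * h1 +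
        (1 / 2 : ℂ) * (((m 1 - m 5 : ℤ) - (m 3 - m 7) : ℤ) : ℂ) ^ 2 * hζ4
    have h3 : ((m 1 - m 5 : ℤ) - (m 3 - m 7)) ^ 2 + 2 * (m 2 - m 6 : ℤ) ^ 2 = 0 := by
      exact_mod_cast h2
    constructor <;> nlinarith [sq_nonneg ((m 1 - m 5 : ℤ) - (m 3 - m 7)), sq_nonneg (m 2 - m 6 : ℤ)]
  obtain ⟨hz1, hz2⟩ := hz
  obtain ⟨u, hu⟩ : ∃ u, u = -1 - 2 * (m 0 - m 4) := ⟨_, rfl⟩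
  obtain ⟨v, hv⟩ : ∃ v, v = -2 * (m 1 - m 5) := ⟨_, rfl⟩
  have h15 : m 1 = m 5 + m 3 - m 7 := by omega
  have h26 : m 2 = m 6 := by omega
  have J1' : jacobiSum θ (θ ^ 4) = u + v * (ζ + ζ ^ 3) := by
    rw [J1, hu, hv, h15, h26]; push_cast; ring
  have J7' : jacobiSum (θ ^ 7) (θ ^ 4) = u - v * (ζ + ζ ^ 3) := by
    rw [J7, hu, hv, h15, h26]; push_cast; ring
  have hprod : jacobiSum θ (θ ^ 4) * jacobiSum (θ ^ 7) (θ ^ 4) = Fintype.card F := by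
    have h := jacobiSum_mul_jacobiSum_inv (ringChar_complex_ne (F := F)) (χ := θ) (φ := θ ^ 4)
      (by simpa using hne 1 (by norm_num)) (hne 4 (by norm_num))
      (by rw [← pow_succ']; exact hne 5 (by norm_num))
    rw [MulChar.inv_eq_self hφ, show θ⁻¹ = θ ^ 7 by
      rw [inv_eq_iff_mul_eq_one, ← pow_succ', h8]] at h
    exact h
  have hnorm : (Fintype.card F : ℤ) = u ^ 2 + 2 * v ^ 2 := by
    have : (Fintype.card F : ℂ) = u ^ 2 + 2 * v ^ 2 := by
      rw [← hprod, J1', J7']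
      linear_combination (-(v : ℂ) ^ 2 * (ζ ^ 2 + 2)) * hζ4
    exact_mod_cast this
  have hdvd8 : 8 ∣ Fintype.card F - 1 := hθ ▸ MulChar.orderOf_dvd_card_sub_one (F := F) θ
  have hpos : 0 < Fintype.card F - 1 := Nat.sub_pos_of_lt Fintype.one_lt_card
  refine ⟨u, v, by rw [J1', J7']; ring, hprod, hnorm, ?_, by omega⟩
  intro hp8 hpu
  have := charP_of_card_eq_pow hp hq
  have hu0 : (u : F) = 0 := (CharP.intCast_eq_zero_iff F p u).mpr hpu
  have hB1 : (0 : F) = u + v * (η + η ^ 3) := by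
    rw [Nat.choose_eq_zero_of_lt (by omega)] at B1
    rw [h15, h26] at B1
    rw [hu, hv, h15]; push_cast at B1 ⊢
    linear_combination B1
  have hB7 : (((Fintype.card F - 1) / 2).choose ((Fintype.card F - 1) / 8) : F) = 0 := by
    have h1 : (u : F) - v * (η + η ^ 3) = 0 := by linear_combination 2 * hu0 + hB1
    have h2 : -1 - 2 * ((m 0 - m 4 : F) - (m 3 - m 7) * η - (m 2 - m 6) * η ^ 2 -
        (m 1 - m 5) * η ^ 3) = 0 := by
      rw [← h1, hu, hv, h15, h26]; push_cast; ring
    rw [h2, neg_eq_zero, mul_eq_zero, Nat.mul_one] at B7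
    exact B7.resolve_left (pow_ne_zero _ (by simp))
  rw [CharP.cast_eq_zero_iff F p] at hB7
  have hp1 := hp.one_lt
  rcases hp8 with hp8 | hp8
  · have := not_dvd_choose_of_modEq_one (n := 8) (c := 4) (d := 1) hp (by omega) (by norm_num)
      (by norm_num) (by norm_num) r
    rw [← hq, one_mul, show 4 * ((Fintype.card F - 1) / 8) = (Fintype.card F - 1) / 2 by omega]
      at this
    exact this hB7
  -- Odd powers of `p ≡ 3` are again `3` modulo 8, whereas `q ≡ 1`.
  · obtain ⟨s, hs⟩ : Even r := by
      by_contra hodd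
      obtain ⟨s, rfl⟩ := Nat.not_even_iff_odd.mp hodd
      have h9 : (p ^ 2) % 8 = 1 := by rw [Nat.pow_mod, hp8]
      have : p ^ (2 * s + 1) % 8 = 3 := by
        rw [pow_succ, pow_mul, Nat.mul_mod, Nat.pow_mod, h9, hp8]; norm_num
      omega
    have := not_dvd_choose_of_modEq_three hp hp8 s
    rw [← pow_mul, two_mul, ← hs, ← hq,
      show 4 * ((Fintype.card F - 1) / 8) = (Fintype.card F - 1) / 2 by omega] at this
    exact this hB7

end JacobiArithmetic

/-! ### Cubic Jacobi sums as Eisenstein integers. -/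

section CubicJacobiArithmetic

variable {F : Type*} [Field F] [Fintype F]

/-- The Jacobi sums `J(χ ^ i, χ ^ i)` of a character of order `n`, and the corresponding power
sums in `F`, in terms of the number `N j` of `x` with `χ(x(1 - x)) = ζ ^ j`. -/
theorem exists_jacobiSum_self_coeffs {n : ℕ} {χ : MulChar F ℂ} (hχ : orderOf χ = n) :
    ∃ (ζ : ℂ) (η : F) (N : ℕ → ℤ), IsPrimitiveRoot ζ n ∧ IsPrimitiveRoot η n ∧
      ∀ i, 0 < i → i < n →
        jacobiSum (χ ^ i) (χ ^ i) = ∑ j ∈ Finset.range n, (N j : ℂ) * ζ ^ (i * j) ∧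
        -((-1) ^ ((Fintype.card F - 1) / n * (n - i)) *
            ((((Fintype.card F - 1) / n * i).choose ((Fintype.card F - 1) / n * (n - i)) : ℕ) : F))
          = ∑ j ∈ Finset.range n, (N j : F) * η ^ (i * j) := by
  classical
  obtain ⟨ζ, η, l, hζ, hη, hl⟩ := MulChar.exists_log hχ
  have hn : 0 < n := hχ ▸ MulChar.orderOf_pos χ
  obtain ⟨m, hm⟩ : n ∣ Fintype.card F - 1 := hχ ▸ MulChar.orderOf_dvd_card_sub_one (F := F) χ
  have hq : 0 < Fintype.card F - 1 := Nat.sub_pos_of_lt Fintype.one_lt_card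
  have hdiv : (Fintype.card F - 1) / n = m := by rw [hm, Nat.mul_div_cancel_left _ hn]
  have hm0 : 0 < m := by
    rcases Nat.eq_zero_or_pos m with rfl | h
    · omega
    · exact h
  rw [hdiv] at hl ⊢
  let s : F → ℤ := fun x => if x * (1 - x) = 0 then 0 else 1
  refine ⟨ζ, η, fun j => ∑ x with l (x * (1 - x)) % n = j, s x, hζ, hη,
    fun i hi0 hin => ⟨?_, ?_⟩⟩
  · rw [← sum_mul_pow_log hn hζ.pow_eq_one s (fun x => l (x * (1 - x))) i, jacobiSum]
    refine Finset.sum_congr rfl fun x _ => ?_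
    rw [← map_mul]
    by_cases hx : x * (1 - x) = 0
    · simp only [s, if_pos hx, hx, MulChar.map_zero, Int.cast_zero, zero_mul]
    · simp only [s, if_neg hx]
      rw [← (hl _ hx).1, MulChar.pow_apply' χ hi0.ne', Int.cast_one, one_mul]
  · have hmi : m * i + m * (n - i) = Fintype.card F - 1 := by
      rw [hm, ← mul_add, Nat.add_sub_cancel' hin.le, mul_comm]
    have hmi0 : 0 < m * i := Nat.mul_pos hm0 hi0
    have hmi1 : 0 < m * (n - i) := Nat.mul_pos hm0 (by omega)
    rw [← FiniteField.sum_pow_mul_one_sub_pow hmi0 hmi (by omega),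
      ← sum_mul_pow_log hn hη.pow_eq_one s (fun x => l (x * (1 - x))) i]
    refine Finset.sum_congr rfl fun x _ => ?_
    rw [← mul_pow]
    by_cases hx : x * (1 - x) = 0
    · simp only [s, if_pos hx, hx, zero_pow hmi0.ne', Int.cast_zero, zero_mul]
    · simp only [s, if_neg hx]
      rw [← (hl _ hx).2, ← pow_mul, Int.cast_one, one_mul]

theorem IsPrimitiveRoot.sq_add_self_add_one {A : Type*} [CommRing A] [IsDomain A] {ζ : A}
    (hζ : IsPrimitiveRoot ζ 3) : ζ ^ 2 + ζ + 1 = 0 := by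
  have h := hζ.geom_sum_eq_zero (by norm_num)
  simp only [Finset.sum_range_succ, Finset.sum_range_zero] at h
  linear_combination h

theorem exists_int_add_mul_of_mem_adjoin {ζ z : ℂ} (hζ : ζ ^ 2 + ζ + 1 = 0)
    (hz : z ∈ Algebra.adjoin ℤ {ζ}) : ∃ c d : ℤ, z = c + d * ζ := by
  induction hz using Algebra.adjoin_induction with
  | mem x hx => exact ⟨0, 1, by rw [Set.mem_singleton_iff.mp hx]; simp⟩
  | algebraMap r => exact ⟨r, 0, by simp⟩
  | add x y _ _ hx hy =>
    obtain ⟨c, d, rfl⟩ := hx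
    obtain ⟨c', d', rfl⟩ := hy
    exact ⟨c + c', d + d', by push_cast; ring⟩
  | mul x y _ _ hx hy =>
    obtain ⟨c, d, rfl⟩ := hx
    obtain ⟨c', d', rfl⟩ := hy
    exact ⟨c * c' - d * d', c * d' + d * c' - d * d', by
      push_cast; linear_combination (d * d' : ℂ) * hζ⟩

theorem eq_zero_of_int_add_mul_eq_zero {ζ : ℂ} (hζ : ζ ^ 2 + ζ + 1 = 0) {a b : ℤ}
    (h : (a : ℂ) + b * ζ = 0) : a = 0 ∧ b = 0 := by
  have h1 : (a : ℂ) ^ 2 - a * b + b ^ 2 = 0 := by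
    linear_combination (a - b - b * ζ : ℂ) * h + (b : ℂ) ^ 2 * hζ
  have h2 : a ^ 2 - a * b + b ^ 2 = 0 := by exact_mod_cast h1
  constructor <;> nlinarith [sq_nonneg (2 * a - b), sq_nonneg (2 * b - a), sq_nonneg a, sq_nonneg b]

/-- The cubic Jacobi sum `J(χ, χ)` is an Eisenstein integer `a + b ω` of norm `q` that is
congruent to `-1` modulo `3`. -/
theorem jacobiSum_cubic_arith {p r : ℕ} (hp : p.Prime) (hq : Fintype.card F = p ^ r)
    {χ : MulChar F ℂ} (hχ : orderOf χ = 3) :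
    ∃ a b : ℤ, jacobiSum χ χ + jacobiSum (χ ^ 2) (χ ^ 2) = 2 * a - b ∧
      jacobiSum χ χ * jacobiSum (χ ^ 2) (χ ^ 2) = Fintype.card F ∧
      (Fintype.card F : ℤ) = a ^ 2 - a * b + b ^ 2 ∧ a % 3 = 2 ∧ b % 3 = 0 ∧
      (p % 3 = 1 → ¬ (p : ℤ) ∣ 2 * a - b) := by
  have hne : ∀ n, 0 < n ∧ n < 3 → χ ^ n ≠ 1 := fun n hn =>
    pow_ne_one_of_lt_orderOf (by omega) (by rw [hχ]; omega)
  have h3 : χ ^ 3 = 1 := hχ ▸ pow_orderOf_eq_one χ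
  obtain ⟨ζ, η, N, hζ, hη, hJ⟩ := exists_jacobiSum_self_coeffs hχ
  have hζ2 := hζ.sq_add_self_add_one
  have hη2 := hη.sq_add_self_add_one
  obtain ⟨J1, B1⟩ := hJ 1 (by norm_num) (by norm_num)
  obtain ⟨J2, B2⟩ := hJ 2 (by norm_num) (by norm_num)
  simp only [Finset.sum_range_succ, Finset.sum_range_zero, zero_add] at J1 J2 B1 B2
  rw [pow_one] at J1
  obtain ⟨a, ha⟩ : ∃ a, a = N 0 - N 2 := ⟨_, rfl⟩
  obtain ⟨b, hb⟩ : ∃ b, b = N 1 - N 2 := ⟨_, rfl⟩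
  have J1' : jacobiSum χ χ = a + b * ζ := by
    rw [J1, ha, hb]; push_cast
    linear_combination (N 2 : ℂ) * hζ2
  have J2' : jacobiSum (χ ^ 2) (χ ^ 2) = a - b - b * ζ := by
    rw [J2, ha, hb]; push_cast
    linear_combination (N 1 + N 2 * (ζ ^ 2 - ζ) : ℂ) * hζ2
  have hprod : jacobiSum χ χ * jacobiSum (χ ^ 2) (χ ^ 2) = Fintype.card F := by
    have h := jacobiSum_mul_jacobiSum_inv (ringChar_complex_ne (F := F)) (χ := χ) (φ := χ)
      (by simpa using hne 1 (by norm_num)) (by simpa using hne 1 (by norm_num))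
      (by rw [← pow_two]; exact hne 2 (by norm_num))
    rw [show χ⁻¹ = χ ^ 2 by rw [inv_eq_iff_mul_eq_one, ← pow_succ', h3]] at h
    exact h
  have hnorm : (Fintype.card F : ℤ) = a ^ 2 - a * b + b ^ 2 := by
    have : (Fintype.card F : ℂ) = a ^ 2 - a * b + b ^ 2 := by
      rw [← hprod, J1', J2']
      linear_combination (-(b : ℂ) ^ 2) * hζ2
    exact_mod_cast this
  have hdvd3 : 3 ∣ Fintype.card F - 1 := hχ ▸ MulChar.orderOf_dvd_card_sub_one (F := F) χ
  have hmod : a % 3 = 2 ∧ b % 3 = 0 := by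
    -- The sum is `-1 + z (ζ - 1)²` with `z ∈ ℤ[ζ]`, and `(ζ - 1)² = -3 ζ`.
    obtain ⟨z, hz, hz'⟩ := exists_jacobiSum_eq_neg_one_add (by norm_num : 2 < 3) h3 h3 hdvd3 hζ
    obtain ⟨c, d, rfl⟩ := exists_int_add_mul_of_mem_adjoin hζ2 hz
    have := eq_zero_of_int_add_mul_eq_zero (a := a + 1 - 3 * d) (b := b + 3 * c - 3 * d) hζ2 (by
      push_cast
      linear_combination hz' - J1' + (c + d * ζ - 3 * d : ℂ) * hζ2)
    omega
  refine ⟨a, b, by rw [J1', J2']; ring, hprod, hnorm, hmod.1, hmod.2, ?_⟩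
  intro hp3 hpab
  have := charP_of_card_eq_pow hp hq
  have hab : ((2 * a - b : ℤ) : F) = 0 := (CharP.intCast_eq_zero_iff F p _).mpr hpab
  push_cast at hab
  have hpos : 0 < Fintype.card F - 1 := Nat.sub_pos_of_lt Fintype.one_lt_card
  have hB1 : (0 : F) = a + b * η := by
    rw [Nat.choose_eq_zero_of_lt (by omega)] at B1
    rw [ha, hb]; push_cast at B1 ⊢
    linear_combination B1 + (N 2 : F) * hη2
  have hB2 : ((2 * ((Fintype.card F - 1) / 3)).choose (1 * ((Fintype.card F - 1) / 3)) : F) =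
      0 := by
    have h2 : (N 0 : F) * η ^ (2 * 0) + N 1 * η ^ (2 * 1) + N 2 * η ^ (2 * 2) = 0 := by
      rw [ha, hb] at hB1 hab
      push_cast at hB1 hab
      linear_combination (N 1 + N 2 * (η ^ 2 - η) : F) * hη2 + hab + hB1
    rw [h2, neg_eq_zero, mul_eq_zero, Nat.mul_one, mul_comm _ 2] at B2
    rw [one_mul]
    exact B2.resolve_left (pow_ne_zero _ (by simp))
  rw [CharP.cast_eq_zero_iff F p, hq] at hB2
  have hp1 := hp.one_lt
  exact not_dvd_choose_of_modEq_one (n := 3) (c := 2) (d := 1) hp (by omega) (by norm_num)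
    (by norm_num) (by norm_num) r hB2

end CubicJacobiArithmetic

/-! ### Matching the given representations with the Jacobi sums. -/

section Representations

theorem sq_eq_sq_of_eq_sq_add_four_mul_sq {p r : ℕ} (hp : p.Prime) (hp2 : p ≠ 2) (hr : r ≠ 0)
    {x y a b : ℤ} (h : (p : ℤ) ^ r = x ^ 2 + 4 * y ^ 2) (h' : (p : ℤ) ^ r = a ^ 2 + 4 * b ^ 2)
    (hx : p % 4 = 1 → ¬ (p : ℤ) ∣ x) (ha : p % 4 = 1 → ¬ (p : ℤ) ∣ a) : x ^ 2 = a ^ 2 := by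
  have hodd := hp.eq_two_or_odd
  by_cases hp4 : p % 4 = 1
  · exact sq_eq_sq_of_representations hp hp2 hr (M := 1) (N := 4) (by norm_num) (by norm_num)
      (by rw [one_mul, h]) (by rw [one_mul, h']) (hx hp4) (ha hp4)
  · have hinert := dvd_of_dvd_sq_add_four_mul_sq hp (by omega)
    rw [eq_zero_of_inert hp (by norm_num) hinert r x y h] at h
    rw [eq_zero_of_inert hp (by norm_num) hinert r a b h'] at h'
    linarith

theorem sq_eq_sq_of_eq_sq_add_two_mul_sq {p r : ℕ} (hp : p.Prime) (hp2 : p ≠ 2) (hr : r ≠ 0)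
    {x y a b : ℤ} (h : (p : ℤ) ^ r = x ^ 2 + 2 * y ^ 2) (h' : (p : ℤ) ^ r = a ^ 2 + 2 * b ^ 2)
    (hx : p % 8 = 1 ∨ p % 8 = 3 → ¬ (p : ℤ) ∣ x) (ha : p % 8 = 1 ∨ p % 8 = 3 → ¬ (p : ℤ) ∣ a) :
    x ^ 2 = a ^ 2 := by
  by_cases hp8 : p % 8 = 1 ∨ p % 8 = 3
  · exact sq_eq_sq_of_representations hp hp2 hr (M := 1) (N := 2) (by norm_num) (by norm_num)
      (by rw [one_mul, h]) (by rw [one_mul, h']) (hx hp8) (ha hp8)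
  · have hinert := dvd_of_dvd_sq_add_two_mul_sq hp hp2 hp8
    rw [eq_zero_of_inert hp (by norm_num) hinert r x y h] at h
    rw [eq_zero_of_inert hp (by norm_num) hinert r a b h'] at h'
    linarith

theorem eq_of_sq_eq_sq_of_emod_four {a b : ℤ} (h : a ^ 2 = b ^ 2) (ha : a % 4 = 3)
    (hb : b % 4 = 3) : a = b := by
  rcases sq_eq_sq_iff_eq_or_eq_neg.mp h with h | h <;> omega

/-- The trace of a primary Eisenstein integer of norm `p ^ r`, when `p` splits. -/
theorem trace_eq_of_eisenstein_split {p r : ℕ} (hp : p.Prime) (hr : r ≠ 0) (hp3 : p % 3 = 1)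
    {a b c d : ℤ} (h : (p : ℤ) ^ r = a ^ 2 - a * b + b ^ 2) (ha : a % 3 = 2) (hb : b % 3 = 0)
    (hab : ¬ (p : ℤ) ∣ 2 * a - b) (h' : 4 * (p : ℤ) ^ r = c ^ 2 + 27 * d ^ 2) (hc : c % 3 = 1)
    (hpc : ¬ (p : ℤ) ∣ c) : 2 * a - b = c := by
  obtain ⟨t, rfl⟩ : ∃ t, b = 3 * t := ⟨b / 3, by omega⟩
  -- With `b = 3 t`, four times the norm is `(2 a - b)² + 27 t²`; the sign is then settled modulo 3.
  have hsq := sq_eq_sq_of_representations hp (by omega) hr (M := 4) (N := 27) (d := t) (d' := d)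
    (by norm_num) (by norm_num) (by rw [h]; ring) h' hab hpc
  rcases sq_eq_sq_iff_eq_or_eq_neg.mp hsq with h | h <;> omega

/-- The trace of a primary Eisenstein integer of norm `p ^ r`, when `p` is inert. -/
theorem trace_eq_of_eisenstein_inert {p r : ℕ} (hp : p.Prime) (hp3 : p % 3 = 2) {a b : ℤ}
    (h : (p : ℤ) ^ r = a ^ 2 - a * b + b ^ 2) (ha : a % 3 = 2) (hb : b % 3 = 0) :
    2 * a - b = -2 * (-(p : ℤ)) ^ (r / 2) := by
  obtain ⟨a', b', ha', hb', h1⟩ :=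
    eisenstein_inert hp (dvd_of_dvd_eisenstein_norm hp hp3) r a b h
  have hneg : (-(p : ℤ)) ^ (r / 2) % 3 = 1 := by
    have : (-(p : ℤ)) ≡ 1 [ZMOD 3] := by unfold Int.ModEq; omega
    simpa [Int.ModEq] using this.pow (r / 2)
  have hb3 : b' % 3 = 0 := by
    have hd : (3 : ℤ) ∣ p ^ (r / 2) * b' := by rw [← hb']; omega
    rcases Int.prime_three.dvd_or_dvd hd with hd | hd
    · have := Int.prime_three.dvd_of_dvd_pow hd
      omega
    · omega
  -- The unit `a' + b' ω` satisfies `(2 a' - b')² + 3 b'² = 4`, impossible for a nonzero multiple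
  -- `b'` of 3.
  have hb0 : b' = 0 := by
    by_contra hne
    have h2 : 9 ≤ b' ^ 2 := by
      rcases lt_or_gt_of_ne hne with hlt | hgt
      · have : b' ≤ -3 := by omega
        nlinarith
      · have : 3 ≤ b' := by omega
        nlinarith
    nlinarith [sq_nonneg (2 * a' - b')]
  subst hb0
  have ha1 : a' = 1 ∨ a' = -1 := by
    have : a' ^ 2 = 1 := by linarith
    simpa using this
  have hpm : (-(p : ℤ)) ^ (r / 2) = p ^ (r / 2) ∨ (-(p : ℤ)) ^ (r / 2) = -p ^ (r / 2) :=
    (Nat.even_or_odd (r / 2)).imp (fun h => h.neg_pow _) (fun h => h.neg_pow _)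
  rw [mul_zero] at hb'
  rcases ha1 with rfl | rfl <;> rcases hpm with h | h <;> rw [h] at hneg ⊢ <;> omega

end Representations

/-! ### Square roots of quartic characters and the value at 4. -/

section CharacterRoots

variable {F : Type*} [Field F] [Fintype F]

theorem MulChar.eq_of_orderOf_two {φ ψ : MulChar F ℂ} (hφ : orderOf φ = 2) (hψ : orderOf ψ = 2) :
    φ = ψ := by
  obtain ⟨g, hg⟩ := IsCyclic.exists_generator (α := Fˣ)
  have key : ∀ {χ : MulChar F ℂ}, orderOf χ = 2 → χ g = -1 := fun {χ} h =>
    (IsPrimitiveRoot.iff_orderOf.mpr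
      ((MulChar.orderOf_apply_generator hg χ).trans h)).eq_neg_one_of_two_right
  rw [MulChar.eq_iff hg, key hφ, key hψ]

theorem MulChar.exists_sq_eq_of_orderOf_four {χ : MulChar F ℂ} (hχ : orderOf χ = 4)
    (h8 : 8 ∣ Fintype.card F - 1) : ∃ θ : MulChar F ℂ, orderOf θ = 8 ∧ θ ^ 2 = χ := by
  obtain ⟨θ₀, hθ₀⟩ := MulChar.exists_mulChar_orderOf F h8
    (Complex.isPrimitiveRoot_exp 8 (by norm_num))
  obtain ⟨g, hg⟩ := IsCyclic.exists_generator (α := Fˣ)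
  have h1 : IsPrimitiveRoot (θ₀ g) 8 :=
    IsPrimitiveRoot.iff_orderOf.mpr ((MulChar.orderOf_apply_generator hg θ₀).trans hθ₀)
  have h2 : IsPrimitiveRoot (χ g) 4 :=
    IsPrimitiveRoot.iff_orderOf.mpr ((MulChar.orderOf_apply_generator hg χ).trans hχ)
  obtain ⟨i, -, hi⟩ := (h1.pow (by norm_num) (show 8 = 2 * 4 by rfl)).eq_pow_of_pow_eq_one
    h2.pow_eq_one
  have hsq : (θ₀ ^ i) ^ 2 = χ := by
    rw [MulChar.eq_iff hg, MulChar.pow_apply_coe, MulChar.pow_apply_coe, ← hi, ← pow_mul,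
      ← pow_mul, mul_comm]
  refine ⟨θ₀ ^ i, ?_, hsq⟩
  refine orderOf_eq_prime_pow (p := 2) (n := 2) ?_ ?_
  · rw [show 2 ^ 2 = 2 * 2 by rfl, pow_mul, hsq]
    exact pow_ne_one_of_lt_orderOf (by norm_num) (by rw [hχ]; norm_num)
  · rw [show 2 ^ (2 + 1) = 2 * 4 by rfl, pow_mul, hsq, ← hχ, pow_orderOf_eq_one]

/-- Since `q ≡ 1` modulo 8, `2 = s²` in `F`, so `4 = s⁴` and the value is `θ⁸ s`. -/
theorem MulChar.apply_four_of_orderOf_eight {θ : MulChar F ℂ} (hθ : orderOf θ = 8) :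
    (θ ^ 2) 4 = 1 := by
  have h8 : 8 ∣ Fintype.card F - 1 := hθ ▸ MulChar.orderOf_dvd_card_sub_one (F := F) θ
  have h1 := Fintype.one_lt_card (α := F)
  have h2 : (2 : F) ≠ 0 := MulChar.two_ne_zero (orderOf_pow_four_of_eight hθ)
  obtain ⟨s, hs⟩ := (FiniteField.isSquare_two_iff (F := F)).mpr ⟨by omega, by omega⟩
  have hs0 : s ≠ 0 := by rintro rfl; exact h2 (by rw [hs, zero_mul])
  rw [show (4 : F) = s ^ 4 by linear_combination (2 + s * s) * hs, map_pow,
    ← MulChar.pow_apply' _ (by norm_num), ← pow_mul, show 2 * 4 = orderOf θ by rw [hθ],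
    pow_orderOf_eq_one, MulChar.one_apply (isUnit_iff_ne_zero.mpr hs0)]

end CharacterRoots

/-! ### The total character sums in terms of the given integers. -/

section WeightSums

variable {F : Type*} [Field F] [Fintype F] {p r : ℕ}

theorem card_eq_pow_exponent_ne_zero (hq : Fintype.card F = p ^ r) : r ≠ 0 := by
  rintro rfl
  have := Fintype.one_lt_card (α := F)
  simp [hq] at this

theorem ne_two_of_two_dvd_card_sub_one (hq : Fintype.card F = p ^ r)
    (h : 2 ∣ Fintype.card F - 1) : p ≠ 2 := by
  rintro rfl
  have h1 : 2 ∣ Fintype.card F := hq ▸ dvd_pow_self 2 (card_eq_pow_exponent_ne_zero hq)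
  have := Fintype.one_lt_card (α := F)
  omega

theorem sum_weightSum_quadratic_eq (hp : p.Prime) (hq : Fintype.card F = p ^ r)
    {χ : MulChar F ℂ} (hχ : orderOf χ = 4) {x y : ℤ}
    (hxy : (Fintype.card F : ℤ) = x ^ 2 + 4 * y ^ 2) (hx : p % 4 = 1 → ¬ (p : ℤ) ∣ x) :
    ∑ w ∈ weightBox 2, weightSum (χ ^ 2) w =
      ((Fintype.card F : ℂ) - 9) ^ 2 - 16 * (y : ℂ) ^ 2 := by
  have hφ : orderOf (χ ^ 2) = 2 := by
    rw [orderOf_pow_of_dvd (by norm_num) (by rw [hχ]; norm_num), hχ]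
  obtain ⟨a, b, hadd, hmul, hab, ha, -⟩ := jacobiSum_quartic_arith hp hq hχ
  have h4 : 4 ∣ Fintype.card F - 1 := hχ ▸ MulChar.orderOf_dvd_card_sub_one (F := F) χ
  have hqz : (Fintype.card F : ℤ) = (p : ℤ) ^ r := by exact_mod_cast hq
  have hsq : x ^ 2 = a ^ 2 := sq_eq_sq_of_eq_sq_add_four_mul_sq hp
    (ne_two_of_two_dvd_card_sub_one hq (by omega)) (card_eq_pow_exponent_ne_zero hq)
    (hqz ▸ hxy) (hqz ▸ hab) hx ha
  have ha2 : (a : ℂ) ^ 2 = Fintype.card F - 4 * (y : ℂ) ^ 2 := by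
    have : a ^ 2 = Fintype.card F - 4 * y ^ 2 := by rw [← hsq, hxy]; ring
    exact_mod_cast this
  rw [sum_weightSum_quadratic hφ (MulChar.pow_even_apply_neg_one χ (n := 1) (by norm_num)),
    pairSum_quadratic hχ]
  linear_combination (jacobiSum χ (χ ^ 2) + jacobiSum (χ ^ 3) (χ ^ 2) + 2 * a) * hadd -
    2 * hmul + 4 * ha2

theorem sum_weightSum_cubic_eq (hp : p.Prime) (hq : Fintype.card F = p ^ r)
    {χ : MulChar F ℂ} (hχ : orderOf χ = 3) {c : ℤ}
    (hc : p % 3 = 1 → (∃ d : ℤ, 4 * (Fintype.card F : ℤ) = c ^ 2 + 27 * d ^ 2) ∧ c % 3 = 1 ∧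
      ¬ (p : ℤ) ∣ c)
    (hc' : p % 3 = 2 → c = -2 * (-(p : ℤ)) ^ (r / 2)) :
    ∑ w ∈ weightBox 3, weightSum χ w =
      (Fintype.card F : ℂ) ^ 2 + 5 * Fintype.card F * (c - 11) + 10 * (c : ℂ) ^ 2 - 85 * c + 316 +
        12 * (Fintype.card F : ℂ) ^ 2 * hypF32 χ χ χ⁻¹ 1 1 1 := by
  have h3 : χ ^ 3 = 1 := hχ ▸ pow_orderOf_eq_one χ
  have hinv : χ⁻¹ = χ ^ 2 := by rw [inv_eq_iff_mul_eq_one, ← pow_succ', h3]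
  have hneg : χ (-1) = 1 := MulChar.val_neg_one_eq_one_of_odd_order (by decide : Odd 3) h3
  have hneg' : χ⁻¹ (-1) = 1 := by
    rw [hinv, MulChar.pow_apply' _ (by norm_num), hneg, one_pow]
  obtain ⟨a, b, hadd, hmul, hab, ha, hb, hpab⟩ := jacobiSum_cubic_arith hp hq hχ
  have hr := card_eq_pow_exponent_ne_zero hq
  have hqz : (Fintype.card F : ℤ) = (p : ℤ) ^ r := by exact_mod_cast hq
  have hdvd : 3 ∣ Fintype.card F - 1 := hχ ▸ MulChar.orderOf_dvd_card_sub_one (F := F) χ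
  have hp0 : p % 3 ≠ 0 := by
    intro h
    have h1 : 3 ∣ Fintype.card F := hq ▸ (Nat.dvd_of_mod_eq_zero h).trans (dvd_pow_self p hr)
    have := Fintype.one_lt_card (α := F)
    omega
  have hac : 2 * a - b = c := by
    rcases (by omega : p % 3 = 1 ∨ p % 3 = 2) with hp3 | hp3
    · obtain ⟨⟨d, hd⟩, hc1, hpc⟩ := hc hp3
      exact trace_eq_of_eisenstein_split hp hr hp3 (hqz ▸ hab) ha hb (hpab hp3) (hqz ▸ hd) hc1 hpc
    · rw [hc' hp3]
      exact trace_eq_of_eisenstein_inert hp hp3 (hqz ▸ hab) ha hb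
  have hac' : (2 * a - b : ℂ) = c := by exact_mod_cast hac
  rw [hac'] at hadd
  have hhyp := card_sq_mul_hypF32 hneg hneg hneg'
  rw [inv_inv, hinv] at hhyp
  rw [sum_weightSum_cubic hχ hneg rfl rfl, hinv]
  linear_combination (5 * (Fintype.card F : ℂ) - 85 +
    10 * (jacobiSum χ χ + jacobiSum (χ ^ 2) (χ ^ 2) + c)) * hadd - 14 * hmul - 12 * hhyp

/-- The evaluations of pair sums in the quartic case. -/
theorem pairSum_quartic_evaluations {χ θ : MulChar F ℂ} (hθ : orderOf θ = 8) (hχ : θ ^ 2 = χ) :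
    jacobiSum χ χ = jacobiSum χ (χ ^ 2) ∧ jacobiSum (χ ^ 3) (χ ^ 3) = jacobiSum (χ ^ 3) (χ ^ 2) ∧
    pairSum (χ ^ 2) χ χ (χ ^ 3) (χ ^ 2) =
      jacobiSum θ (θ ^ 4) ^ 2 + jacobiSum (θ ^ 7) (θ ^ 4) ^ 2 ∧
    pairSum χ χ χ χ χ =
      jacobiSum χ χ * (jacobiSum θ (θ ^ 4) + jacobiSum (θ ^ 7) (θ ^ 4)) ∧
    pairSum (χ ^ 3) (χ ^ 3) (χ ^ 3) (χ ^ 3) (χ ^ 3) =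
      jacobiSum (χ ^ 3) (χ ^ 3) * (jacobiSum θ (θ ^ 4) + jacobiSum (θ ^ 7) (θ ^ 4)) := by
  have hφ := orderOf_pow_four_of_eight hθ
  have hfour := MulChar.apply_four_of_orderOf_eight hθ
  have hθ3 := orderOf_pow_odd_of_eight hθ (n := 3) (by norm_num)
  have hfour3 := MulChar.apply_four_of_orderOf_eight hθ3
  have hmixed := pairSum_quartic_mixed hθ
  have hself := pairSum_quartic_self hθ hfour
  have hself3 := pairSum_quartic_self hθ3 hfour3
  rw [← pow_mul θ 3 4, ← pow_mul θ 3 7, pow_eight_reduce hθ (3 * 4) 4,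
    pow_eight_reduce hθ (3 * 7) 5, jacobiSum_octic hθ, jacobiSum_octic_inv hθ] at hself3
  have h2 : χ ^ 2 = θ ^ 4 := by rw [← hχ, ← pow_mul]
  have h3 : χ ^ 3 = θ ^ 6 := by rw [← hχ, ← pow_mul]
  have h3' : (θ ^ 3) ^ 2 = θ ^ 6 := by rw [← pow_mul]
  have hinv : ∀ {ψ : MulChar F ℂ}, ψ 4 = 1 → ψ⁻¹ 4 = 1 := fun {ψ} h => by
    rw [MulChar.inv_apply_eq_inv', h, inv_one]
  rw [h3'] at hself3 hfour3
  rw [h2, h3, ← hχ]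
  refine ⟨?_, ?_, hmixed, hself, hself3⟩
  · rw [jacobiSum_self hφ (pow_ne_one_of_lt_orderOf (by norm_num) (by rw [hθ]; norm_num)),
      hinv hfour, one_mul, jacobiSum_comm]
  · rw [jacobiSum_self hφ (pow_ne_one_of_lt_orderOf (by norm_num) (by rw [hθ]; norm_num)),
      hinv hfour3, one_mul, jacobiSum_comm]

theorem sum_weightSum_quartic_eq (hp : p.Prime) (hq : Fintype.card F = p ^ r)
    {χ φ : MulChar F ℂ} (hχ : orderOf χ = 4) (hφ : orderOf φ = 2) (h8 : 8 ∣ Fintype.card F - 1)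
    {e f u v : ℤ} (hef : (Fintype.card F : ℤ) = e ^ 2 + 4 * f ^ 2) (he : e % 4 = 1)
    (hpe : p % 4 = 1 → ¬ (p : ℤ) ∣ e)
    (huv : (Fintype.card F : ℤ) = u ^ 2 + 2 * v ^ 2) (hu : u % 4 = 3)
    (hpu : p % 8 = 1 ∨ p % 8 = 3 → ¬ (p : ℤ) ∣ u) :
    ∑ w ∈ weightBox 4, weightSum χ w =
      (Fintype.card F : ℂ) ^ 2 - 2 * Fintype.card F * (15 * e + 101) + 304 * (e : ℂ) ^ 2 +
        (930 - 40 * u) * e + 801 + 120 * (u : ℂ) ^ 2 +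
        12 * (Fintype.card F : ℂ) ^ 2 * hypF32 χ χ χ⁻¹ 1 1 1 +
        30 * (Fintype.card F : ℂ) ^ 2 * hypF32 χ φ φ 1 1 1 := by
  have hp2 := ne_two_of_two_dvd_card_sub_one hq ((by norm_num : 2 ∣ 8).trans h8)
  have h8' : Fintype.card F % 8 = 1 := by
    have hcard := Fintype.one_lt_card (α := F)
    clear hχ hφ
    omega
  obtain ⟨θ, hθ, hθχ⟩ := MulChar.exists_sq_eq_of_orderOf_four hχ h8
  have hχ2 : orderOf (χ ^ 2) = 2 := by
    rw [orderOf_pow_of_dvd (by norm_num) (by rw [hχ]; norm_num), hχ]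
  obtain rfl := MulChar.eq_of_orderOf_two hφ hχ2
  have hneg : χ (-1) = 1 := hθχ ▸ MulChar.pow_even_apply_neg_one θ (n := 1) (by norm_num)
  have hneg2 : (χ ^ 2) (-1) = 1 := MulChar.pow_even_apply_neg_one χ (n := 1) (by norm_num)
  have hinv : χ⁻¹ = χ ^ 3 := by
    rw [inv_eq_iff_mul_eq_one, ← pow_succ', show 3 + 1 = orderOf χ by rw [hχ], pow_orderOf_eq_one]
  have hneg3 : χ⁻¹ (-1) = 1 := by rw [MulChar.inv_apply_eq_inv', hneg, inv_one]
  obtain ⟨hJ1, hJ3, hv2, hv3, hv4⟩ := pairSum_quartic_evaluations hθ hθχ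
  obtain ⟨a, b, hadd, hmul, hab, ha, ha4⟩ := jacobiSum_quartic_arith hp hq hχ
  obtain ⟨s, t, hadd', hmul', hst, hs, hs4⟩ := jacobiSum_octic_arith hp hq hθ
  have hqz : (Fintype.card F : ℤ) = (p : ℤ) ^ r := by exact_mod_cast hq
  have hr := card_eq_pow_exponent_ne_zero hq
  -- The Jacobi sum has half-trace `a ≡ 3` modulo 4 while `e ≡ 1`, so the signs are opposite.
  have hae : a = -e := eq_of_sq_eq_sq_of_emod_four
    (by rw [neg_sq]; exact (sq_eq_sq_of_eq_sq_add_four_mul_sq hp hp2 hr (hqz ▸ hef) (hqz ▸ hab)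
      hpe ha).symm) (ha4 h8') (by clear hχ hφ hχ2 hθ; omega)
  have hsu : s = u := eq_of_sq_eq_sq_of_emod_four
    (sq_eq_sq_of_eq_sq_add_two_mul_sq hp hp2 hr (hqz ▸ hst) (hqz ▸ huv) hs hpu) hs4 hu
  rw [hae, Int.cast_neg] at hadd
  rw [hsu] at hadd'
  have hhyp1 := card_sq_mul_hypF32 hneg hneg hneg3
  rw [inv_inv, hinv] at hhyp1
  have hhyp2 := card_sq_mul_hypF32 hneg hneg2 hneg2
  rw [MulChar.inv_eq_self hχ2] at hhyp2
  rw [sum_weightSum_quartic hχ hneg hJ1 rfl hJ3 (jacobiSum_comm _ _), hinv, hv2, hv3, hv4,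
    pairSum_quadratic hχ, hJ1, hJ3, ← hhyp1, ← hhyp2]
  generalize jacobiSum χ (χ ^ 2) = π₁ at hadd hmul ⊢
  generalize jacobiSum (χ ^ 3) (χ ^ 2) = π₂ at hadd hmul ⊢
  generalize jacobiSum θ (θ ^ 4) = σ₁ at hadd' hmul' ⊢
  generalize jacobiSum (θ ^ 7) (θ ^ 4) = σ₂ at hadd' hmul' ⊢
  linear_combination (15 * (Fintype.card F : ℂ) - 465 + 76 * (π₁ + π₂ - 2 * e) +
    10 * (σ₁ + σ₂)) * hadd - 74 * hmul + (30 * (σ₁ + σ₂ + 2 * u) - 20 * e) * hadd' - 60 * hmul'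

end WeightSums

/-! ### Assembly of the clique counts. -/

section CliqueCounts

open IsLocalRing in
/-- The number of `4`-cliques in terms of the character sums of a character of order `k`. -/
theorem numCliques_eq_sum_weightSum {R : Type*} [CommRing R] [Finite R] [IsLocalRing R]
    [Fintype (ResidueField R)] {k : ℕ} {χ : MulChar (ResidueField R) ℂ} (hχ : orderOf χ = k)
    (hneg : χ (-1) = 1) (hk : (Nat.card (maximalIdeal R)).Coprime k) :
    24 * (k : ℂ) ^ 6 * numCliques (unitaryCayleyGraph R k) 4 =
      (Nat.card (maximalIdeal R) : ℂ) ^ 4 * Fintype.card (ResidueField R) *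
        (Fintype.card (ResidueField R) - 1) * ∑ w ∈ weightBox k, weightSum χ w := by
  have h1 := ncard_orderedCliques (unitaryCayleyGraph R k) 4
  rw [ncard_orderedCliques_residue hk, ncard_orderedCliques_field
    ((MulChar.apply_eq_one_iff_mem_unitPowers hχ _).mp hneg),
    Nat.card_eq_fintype_card (α := ResidueField R),
    show Nat.factorial 4 = 24 by rfl] at h1
  have h2 := congrArg (Nat.cast : ℕ → ℂ) h1
  push_cast at h2
  -- The factor `24 * k ^ 6` is `4!` for orderings, `k` for the size of the set of powers, and `k ^
  -- 5` for the five indicators.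
  rw [← mul_ncard_unitPowers hχ, ← pow_mul_ncard_cliquePairs hχ]
  linear_combination -(k : ℂ) ^ 6 * h2

theorem Nat.coprime_pow_left_of_dvd_sub_one {q k : ℕ} (hq : 0 < q) (h : k ∣ q - 1) (n : ℕ) :
    (q ^ n).Coprime k := by
  refine Nat.Coprime.pow_left n (Nat.Coprime.of_dvd_right h ?_)
  obtain ⟨m, rfl⟩ : ∃ m, q = m + 1 := ⟨q - 1, by omega⟩
  simp

end CliqueCounts

theorem proposition4p1 {R : Type*} [CommRing R] [Finite R] [IsLocalRing R]
    [Fintype (IsLocalRing.ResidueField R)]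
    (p r q β : ℕ) (hp : p.Prime) (hqp : q = p ^ r)
    (hq : Nat.card (IsLocalRing.ResidueField R) = q)
    (hm : Nat.card (IsLocalRing.maximalIdeal R) = q ^ β) :
    -- k = 2
    (q ≡ 1 [MOD 4] →
      ∀ x y : ℤ, (q : ℤ) = x ^ 2 + 4 * y ^ 2 →
        (p ≡ 1 [MOD 4] → ¬ (p : ℤ) ∣ x) →
        (numCliques (unitaryCayleyGraph R 2) 4 : ℚ) =
          (q : ℚ) ^ (4 * β + 1) * ((q : ℚ) - 1) * (((q : ℚ) - 9) ^ 2 - 16 * (y : ℚ) ^ 2)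
            / (2 ^ 9 * 3)) ∧
    -- k = 3
    ((Even q → 3 ∣ q - 1) → (Odd q → 6 ∣ q - 1) →
      ∀ c : ℤ,
        (p ≡ 1 [MOD 3] →
          (∃ d : ℤ, 4 * (q : ℤ) = c ^ 2 + 27 * d ^ 2) ∧ c ≡ 1 [ZMOD 3] ∧ ¬ (p : ℤ) ∣ c) →
        (p ≡ 2 [MOD 3] → c = -2 * (-(p : ℤ)) ^ (r / 2)) →
        ∀ χ₃ : MulChar (IsLocalRing.ResidueField R) ℂ, orderOf χ₃ = 3 →
        (numCliques (unitaryCayleyGraph R 3) 4 : ℂ) =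
          (q : ℂ) ^ (4 * β + 1) * ((q : ℂ) - 1) / (2 ^ 3 * 3 ^ 7) *
            ((q : ℂ) ^ 2 + 5 * (q : ℂ) * ((c : ℂ) - 11) + 10 * (c : ℂ) ^ 2 - 85 * (c : ℂ) + 316
              + 12 * (q : ℂ) ^ 2 * hypF32 χ₃ χ₃ χ₃⁻¹ 1 1 1)) ∧
    -- k = 4
    (q ≡ 1 [MOD 8] →
      ∀ e f : ℤ, (q : ℤ) = e ^ 2 + 4 * f ^ 2 → e ≡ 1 [ZMOD 4] →
        (p ≡ 1 [MOD 4] → ¬ (p : ℤ) ∣ e) →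
      ∀ u v : ℤ, (q : ℤ) = u ^ 2 + 2 * v ^ 2 → u ≡ 3 [ZMOD 4] →
        (p ≡ 1 [MOD 8] ∨ p ≡ 3 [MOD 8] → ¬ (p : ℤ) ∣ u) →
      ∀ φ χ₄ : MulChar (IsLocalRing.ResidueField R) ℂ, orderOf φ = 2 → orderOf χ₄ = 4 →
        (numCliques (unitaryCayleyGraph R 4) 4 : ℂ) =
          (q : ℂ) ^ (4 * β + 1) * ((q : ℂ) - 1) / (2 ^ 15 * 3) *
            ((q : ℂ) ^ 2 - 2 * (q : ℂ) * (15 * (e : ℂ) + 101) + 304 * (e : ℂ) ^ 2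
              + (930 - 40 * (u : ℂ)) * (e : ℂ) + 801 + 120 * (u : ℂ) ^ 2
              + 12 * (q : ℂ) ^ 2 * hypF32 χ₄ χ₄ χ₄⁻¹ 1 1 1
              + 30 * (q : ℂ) ^ 2 * hypF32 χ₄ φ φ 1 1 1)) := by
  have hcard : Fintype.card (IsLocalRing.ResidueField R) = q := by
    rw [← hq, Nat.card_eq_fintype_card]
  have hcardp : Fintype.card (IsLocalRing.ResidueField R) = p ^ r := hcard.trans hqp
  have hq1 : 1 < q := hcard ▸ Fintype.one_lt_card
  have hcop : ∀ k, k ∣ q - 1 → (Nat.card (IsLocalRing.maximalIdeal R)).Coprime k := fun k hk =>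
    hm ▸ Nat.coprime_pow_left_of_dvd_sub_one (by omega) hk β
  refine ⟨fun hq4 x y hxy hx => ?_, fun heven hodd c hc hc' χ hχ => ?_,
    fun hq8 e f hef he hpe u v huv hu hpu φ χ hφ hχ => ?_⟩
  · have hdvd : 4 ∣ q - 1 := (Nat.modEq_iff_dvd' hq1.le).mp hq4.symm
    -- The quadratic character is taken as the square of a quartic one, whose Jacobi sum supplies
    -- the representation `x² + 4 y²`.
    obtain ⟨χ, hχ⟩ := MulChar.exists_mulChar_orderOf (IsLocalRing.ResidueField R)
      (hcard.symm ▸ hdvd) (Complex.isPrimitiveRoot_exp 4 (by norm_num))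
    have hφ : orderOf (χ ^ 2) = 2 := by
      rw [orderOf_pow_of_dvd (by norm_num) (by rw [hχ]; norm_num), hχ]
    have h := numCliques_eq_sum_weightSum hφ
      (MulChar.pow_even_apply_neg_one χ (n := 1) (by norm_num))
      (hcop 2 ((by norm_num : 2 ∣ 4).trans hdvd))
    rw [sum_weightSum_quadratic_eq hp hcardp hχ (x := x) (y := y) (by rw [hcard, hxy]) hx, hm,
      hcard] at h
    push_cast at h
    have h' : 24 * (2 : ℚ) ^ 6 * numCliques (unitaryCayleyGraph R 2) 4 =
        ((q : ℚ) ^ β) ^ 4 * q * (q - 1) * ((q - 9) ^ 2 - 16 * (y : ℚ) ^ 2) := by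
      exact_mod_cast h
    rw [eq_div_iff (by norm_num)]
    linear_combination h'
  · have hdvd : 3 ∣ q - 1 := by
      rcases Nat.even_or_odd q with h | h
      · exact heven h
      · exact (by norm_num : 3 ∣ 6).trans (hodd h)
    have h := numCliques_eq_sum_weightSum hχ
      (MulChar.val_neg_one_eq_one_of_odd_order (by decide : Odd 3) (hχ ▸ pow_orderOf_eq_one χ))
      (hcop 3 hdvd)
    rw [sum_weightSum_cubic_eq hp hcardp hχ (c := c) (by rw [hcard]; exact hc) hc', hm, hcard] at h
    push_cast at h
    linear_combination (1 / (2 ^ 3 * 3 ^ 7) : ℂ) * h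
  · have hdvd : 8 ∣ q - 1 := (Nat.modEq_iff_dvd' hq1.le).mp hq8.symm
    have hneg : χ (-1) = 1 := by
      obtain ⟨θ, -, rfl⟩ := MulChar.exists_sq_eq_of_orderOf_four hχ (hcard.symm ▸ hdvd)
      exact MulChar.pow_even_apply_neg_one θ (n := 1) (by norm_num)
    have h := numCliques_eq_sum_weightSum hχ hneg (hcop 4 ((by norm_num : 4 ∣ 8).trans hdvd))
    rw [sum_weightSum_quartic_eq hp hcardp hχ hφ (by rw [hcard]; exact hdvd)
      (by rw [hcard]; exact hef) he hpe (by rw [hcard]; exact huv) hu hpu, hm, hcard] at h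
    push_cast at h
    linear_combination (1 / (2 ^ 15 * 3) : ℂ) * h
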